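/- Let $(M,g)$ be a nonempty smooth Riemannian manifold of dimension $n\ge 2$, with Levi-Civita connection $\dot\nabla$. For $y\in TM$ put $t=\tfrac12 g(y,y)\in[0,\infty)$, and let $X^H_y, X^V_y$ be the horizontal lift (with respect to $\dot\nabla$) and the vertical lift at $y$ of a vector $X$ tangent to $M$ at the base point of $y$. Let $a_\alpha,b_\alpha$ $(\alpha=1,\dots,4)$ and $c_\alpha,d_\alpha$ $(\alpha=1,2,3)$ be smooth functions on $[0,\infty)$, evaluated at $t$, and define tensor fields $J$ and $G$ ($G$ symmetric) on $TM$ by $$JX^H_y=a_1X^V_y+b_1g(X,y)y^V_y+a_4X^H_y+b_4g(X,y)y^H_y,\qquad JX^V_y=a_3X^V_y+b_3g(X,y)y^V_y-a_2X^H_y-b_2g(X,y)y^H_y,$$ $$G(X^H_y,Y^H_y)=c_1g(X,Y)+d_1g(X,y)g(Y,y),\quad G(X^V_y,Y^V_y)=c_2g(X,Y)+d_2g(X,y)g(Y,y),\quad G(X^V_y,Y^H_y)=c_3g(X,Y)+d_3g(X,y)g(Y,y).$$ Assume that $(G,J)$ is an almost anti-Hermitian structure on the whole of $TM$: $J^2=-\mathrm{id}$,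 $G$ is nondegenerate, and $G(JU,JV)=-G(U,V)$ for all $U,V$. Call $J$ integrable if its Nijenhuis tensor vanishes, and call $(TM,G,J)$ anti-Kähler if $G((\nabla_XJ)Y,Z)=0$ for all $X,Y,Z$, where $\nabla$ is the Levi-Civita connection of $G$. A prime denotes the derivative in $t$ (one-sided at $t=0$). (i) $J$ is integrable if and only if $(M,g)$ has constant sectional curvature $c$ for some $c\in\mathbb R$ and, for all $t\ge0$, $E:=a_1-2ta_1'-2cta_2-4ct^2a_2'\neq0$ and $$b_1=\frac{2c^2ta_2^2+2cta_1a_2'+a_1a_1'-c+3ca_3^2}{E},\quad b_2=\frac{2ta_3'^2-2ta_1'a_2'+ca_2^2+2cta_2a_2'+a_1a_2'}{E},\quad b_3=\frac{a_1a_3'+2ca_2a_3+4cta_2'a_3-2cta_2a_3'}{E}.$$ (ii) $(TM,G,J)$ is anti-Kähler if and only if $J$ is integrable and, with $c$ the constant sectional curvature of $(M,g)$ and $D:=a_1^4+4a_1^2(a_3^2-1)ct+4(1+a_3^2)^2c^2t^2$, for all $t\ge0$ $$d_1=c\,c_2,\qquad d_3=\frac{a_3'c_1-a_1'c_3}{a_1},$$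 $$c_1'=-2ca_1^2\,\frac{2c_3[a_1(a_3+a_3't)-2a_1'a_3t]-c_1(1+a_3^2)}{D}-2c(1+a_3^2)\,\frac{cc_1t[2a_1(1+a_3^2+4a_3a_3't)-4a_1'(1+a_3^2)t]+2a_1^2t(a_1'c_1-2a_3'cc_3t)}{a_1D},$$ $$c_3'=2ca_1\,\frac{c_3\{a_1+a_3[4t(a_1'a_3-a_1a_3')-3a_1a_3]\}+2a_3c_1(1+a_3^2+2a_3a_3't)}{D}+\frac{(a_3'c_1-a_1'c_3)[a_1^4-4(1+a_3^2)^2c^2t^2]-4a_1(1+a_3^2)c[2a_1'a_3c_1+(1+a_3^2)cc_3]t}{a_1D}.$$ (iii) If $J$ is integrable and $(M,g)$ has constant sectional curvature $c$ (in particular if $(TM,G,J)$ is anti-Kähler), then for every $t\ge0$ one has $a_1\ne0$ and $D\neq0$, the latter being the inequality $$(a_1^2-2ct)^2\neq-4a_3^2ct\,(a_1^2+2ct+a_3^2ct).$$ Thus for $c>0$ the formulas in (ii) are meaningful on the whole of $TM$ without any further condition, and for $c<0$ the inequality holds necessarily. -/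

import Mathlib

set_option maxSynthPendingDepth 3

open scoped Manifold ContDiff

noncomputable section

namespace AntiKaehler

/-! ### Tensor calculus in a coordinate domain

Fields on an open subset of a vector space `W` (the image of a chart) are functions on `W`. -/

section Chart

variable {W : Type*} [NormedAddCommGroup W] [NormedSpace ℝ W]

/-- Koszul's expression for a symmetric bilinear form field `B` and constant vector fields:
`koszul B x X Y Z = X (B (Y, Z)) + Y (B (X, Z)) - Z (B (X, Y))` at the point `x`. -/
def koszul (B : W → W →L[ℝ] W →L[ℝ] ℝ) (x : W) : W →L[ℝ] W →L[ℝ] W →L[ℝ] ℝ :=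
  let D : W →L[ℝ] W →L[ℝ] W →L[ℝ] ℝ := fderiv ℝ B x
  let D' : W →L[ℝ] W →L[ℝ] W →L[ℝ] ℝ :=
    (ContinuousLinearMap.flipₗᵢ ℝ W W ℝ).toContinuousLinearEquiv.toContinuousLinearMap ∘L D.flip
  D + D.flip - D'

theorem koszul_apply (B : W → W →L[ℝ] W →L[ℝ] ℝ) (x X Y Z : W) :
    koszul B x X Y Z
      = fderiv ℝ B x X Y Z + fderiv ℝ B x Y X Z - fderiv ℝ B x Z X Y := rfl

/-- The Christoffel symbols of the Levi-Civita connection of a nondegenerate `B`: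
`christoffel B x X Y = Γ_x(X, Y)` is the vector with
`B_x(Γ_x(X, Y), Z) = (1/2) (X (B (Y, Z)) + Y (B (X, Z)) - Z (B (X, Y)))` for all `Z`. -/
def christoffel (B : W → W →L[ℝ] W →L[ℝ] ℝ) (x : W) : W →L[ℝ] W →L[ℝ] W :=
  (2⁻¹ : ℝ) • (ContinuousLinearMap.compL ℝ W (W →L[ℝ] ℝ) W (B x).inverse ∘L koszul B x)

theorem christoffel_apply (B : W → W →L[ℝ] W →L[ℝ] ℝ) (x X Y : W) :
    christoffel B x X Y = (2⁻¹ : ℝ) • (B x).inverse (koszul B x X Y) := rfl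

/-- The Riemann curvature tensor `R(X, Y)Z = ∇_X ∇_Y Z - ∇_Y ∇_X Z - ∇_[X,Y] Z` of the
Levi-Civita connection of `B`, at the point `x`. -/
def curvature (B : W → W →L[ℝ] W →L[ℝ] ℝ) (x X Y Z : W) : W :=
  fderiv ℝ (christoffel B) x X Y Z - fderiv ℝ (christoffel B) x Y X Z
    + christoffel B x X (christoffel B x Y Z) - christoffel B x Y (christoffel B x X Z)

/-- The covariant derivative `(∇_X J) Y` of a `(1,1)`-tensor field `J` with respect to the
Levi-Civita connection of `B`, at the point `p`. -/
def covDeriv (B : W → W →L[ℝ] W →L[ℝ] ℝ) (J : W → W →L[ℝ] W) (p X Y : W) : W :=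
  fderiv ℝ J p X Y + christoffel B p X (J p Y) - J p (christoffel B p X Y)

/-- The `(0,3)`-tensor `F(X, Y, Z) = B((∇_X J) Y, Z)`. -/
def tensorF (B : W → W →L[ℝ] W →L[ℝ] ℝ) (J : W → W →L[ℝ] W) (p X Y Z : W) : ℝ :=
  B p (covDeriv B J p X Y) Z

/-- The Nijenhuis tensor `[JX, JY] - J[JX, Y] - J[X, JY] - [X, Y]` of `J`, at the point `p`,
evaluated on the constant extensions of the vectors `X` and `Y` (it is a tensor). -/
def nijenhuis (J : W → W →L[ℝ] W) (p X Y : W) : W :=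
  VectorField.lieBracket ℝ (fun q => J q X) (fun q => J q Y) p
    - J p (VectorField.lieBracket ℝ (fun q => J q X) (fun _ => Y) p)
    - J p (VectorField.lieBracket ℝ (fun _ => X) (fun q => J q Y) p)
    - VectorField.lieBracket ℝ (fun _ => X) (fun _ => Y) p

end Chart

/-! ### General natural lifts

The coefficients are smooth functions of the energy density `t ∈ [0, ∞)`. -/

/-- Coefficients of a general natural `(1,1)`-tensor field `J` on the tangent bundle. -/
structure EndoCoeffs where
  a₁ : ℝ → ℝ
  a₂ : ℝ → ℝ
  a₃ : ℝ → ℝ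
  a₄ : ℝ → ℝ
  b₁ : ℝ → ℝ
  b₂ : ℝ → ℝ
  b₃ : ℝ → ℝ
  b₄ : ℝ → ℝ
  smooth_a₁ : ContDiffOn ℝ ∞ a₁ (Set.Ici 0)
  smooth_a₂ : ContDiffOn ℝ ∞ a₂ (Set.Ici 0)
  smooth_a₃ : ContDiffOn ℝ ∞ a₃ (Set.Ici 0)
  smooth_a₄ : ContDiffOn ℝ ∞ a₄ (Set.Ici 0)
  smooth_b₁ : ContDiffOn ℝ ∞ b₁ (Set.Ici 0)
  smooth_b₂ : ContDiffOn ℝ ∞ b₂ (Set.Ici 0)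
  smooth_b₃ : ContDiffOn ℝ ∞ b₃ (Set.Ici 0)
  smooth_b₄ : ContDiffOn ℝ ∞ b₄ (Set.Ici 0)

/-- Coefficients of a general natural symmetric `(0,2)`-tensor field `G` on the tangent bundle. -/
structure MetricCoeffs where
  c₁ : ℝ → ℝ
  c₂ : ℝ → ℝ
  c₃ : ℝ → ℝ
  d₁ : ℝ → ℝ
  d₂ : ℝ → ℝ
  d₃ : ℝ → ℝ
  smooth_c₁ : ContDiffOn ℝ ∞ c₁ (Set.Ici 0)
  smooth_c₂ : ContDiffOn ℝ ∞ c₂ (Set.Ici 0)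
  smooth_c₃ : ContDiffOn ℝ ∞ c₃ (Set.Ici 0)
  smooth_d₁ : ContDiffOn ℝ ∞ d₁ (Set.Ici 0)
  smooth_d₂ : ContDiffOn ℝ ∞ d₂ (Set.Ici 0)
  smooth_d₃ : ContDiffOn ℝ ∞ d₃ (Set.Ici 0)

section Lift

variable {E : Type*} [NormedAddCommGroup E] [NormedSpace ℝ E]

/- In an induced chart of the tangent bundle a point is a pair `p = (x, y)` and a tangent vector
at `p` is a pair `(ξ, η)`, standing for `ξ^i ∂/∂x^i + η^i ∂/∂y^i`. Here `γ` is the metric of the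
base in the chart. -/

/-- The energy density `t = (1/2) γ_x(y, y)`. -/
def energy (γ : E → E →L[ℝ] E →L[ℝ] ℝ) (p : E × E) : ℝ := γ p.1 p.2 p.2 / 2

/-- The vector `X` with `X^H` the horizontal part of a tangent vector: `(ξ, η) ↦ ξ`. -/
def horPart : E × E →L[ℝ] E := ContinuousLinearMap.fst ℝ E E

/-- The vector `X` with `X^V` the vertical part of a tangent vector: `(ξ, η) ↦ η + Γ_x(y, ξ)`. -/
def verPart (γ : E → E →L[ℝ] E →L[ℝ] ℝ) (p : E × E) : E × E →L[ℝ] E :=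
  ContinuousLinearMap.snd ℝ E E + christoffel γ p.1 p.2 ∘L ContinuousLinearMap.fst ℝ E E

/-- The tangent vector `X^H + Z^V` at `p`, written `(X, Z - Γ_x(y, X))` in the chart, where
`X` and `Z` depend linearly on a tangent vector. -/
def ofParts (γ : E → E →L[ℝ] E →L[ℝ] ℝ) (p : E × E) (X Z : E × E →L[ℝ] E) :
    E × E →L[ℝ] E × E :=
  X.prod (Z - christoffel γ p.1 p.2 ∘L X)

/-- The general natural tensor field `J`:
`J X^H = a₁ X^V + b₁ g(X,y) y^V + a₄ X^H + b₄ g(X,y) y^H`,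
`J X^V = a₃ X^V + b₃ g(X,y) y^V - a₂ X^H - b₂ g(X,y) y^H`. -/
def liftEndo (A : EndoCoeffs) (γ : E → E →L[ℝ] E →L[ℝ] ℝ) (p : E × E) : E × E →L[ℝ] E × E :=
  let t := energy γ p
  let y := p.2
  let H : E × E →L[ℝ] E := horPart
  let V : E × E →L[ℝ] E := verPart γ p
  let θH : E × E →L[ℝ] ℝ := γ p.1 y ∘L H
  let θV : E × E →L[ℝ] ℝ := γ p.1 y ∘L V
  ofParts γ p
    (A.a₄ t • H + A.b₄ t • θH.smulRight y - A.a₂ t • V - A.b₂ t • θV.smulRight y)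
    (A.a₁ t • H + A.b₁ t • θH.smulRight y + A.a₃ t • V + A.b₃ t • θV.smulRight y)

/-- The general natural tensor field `G`:
`G(X^H, Y^H) = c₁ g(X,Y) + d₁ g(X,y) g(Y,y)`,
`G(X^V, Y^V) = c₂ g(X,Y) + d₂ g(X,y) g(Y,y)`,
`G(X^V, Y^H) = G(Y^H, X^V) = c₃ g(X,Y) + d₃ g(X,y) g(Y,y)`. -/
def liftMetric (C : MetricCoeffs) (γ : E → E →L[ℝ] E →L[ℝ] ℝ) (p : E × E) :
    E × E →L[ℝ] E × E →L[ℝ] ℝ :=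
  let t := energy γ p
  let y := p.2
  let H : E × E →L[ℝ] E := horPart
  let V : E × E →L[ℝ] E := verPart γ p
  let θH : E × E →L[ℝ] ℝ := γ p.1 y ∘L H
  let θV : E × E →L[ℝ] ℝ := γ p.1 y ∘L V
  C.c₁ t • (γ p.1).bilinearComp H H + C.d₁ t • θH.smulRight θH
    + (C.c₂ t • (γ p.1).bilinearComp V V + C.d₂ t • θV.smulRight θV)
    + (C.c₃ t • ((γ p.1).bilinearComp V H + (γ p.1).bilinearComp H V)
      + C.d₃ t • (θV.smulRight θH + θH.smulRight θV))

end Lift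

/-! ### Riemannian manifolds and their tangent bundles -/

section Global

variable {n : ℕ} {M : Type*} [TopologicalSpace M] [ChartedSpace (EuclideanSpace ℝ (Fin n)) M]
  [IsManifold 𝓘(ℝ, EuclideanSpace ℝ (Fin n)) ∞ M]

/-- The coordinate expression `g_ij(x)` in the chart `e` of the Riemannian metric `g`. -/
def localMetric
    (g : Bundle.ContMDiffRiemannianMetric 𝓘(ℝ, EuclideanSpace ℝ (Fin n)) ∞
      (EuclideanSpace ℝ (Fin n)) (TangentSpace 𝓘(ℝ, EuclideanSpace ℝ (Fin n)) (M := M)))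
    (e : OpenPartialHomeomorph M (EuclideanSpace ℝ (Fin n))) (x : EuclideanSpace ℝ (Fin n)) :
    EuclideanSpace ℝ (Fin n) →L[ℝ] EuclideanSpace ℝ (Fin n) →L[ℝ] ℝ :=
  let De : EuclideanSpace ℝ (Fin n) →L[ℝ] EuclideanSpace ℝ (Fin n) :=
    mfderiv 𝓘(ℝ, EuclideanSpace ℝ (Fin n)) 𝓘(ℝ, EuclideanSpace ℝ (Fin n)) e.symm x
  let B : EuclideanSpace ℝ (Fin n) →L[ℝ] EuclideanSpace ℝ (Fin n) →L[ℝ] ℝ :=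
    g.inner (e.symm x)
  B.bilinearComp De De

/-- `g` has constant sectional curvature `c`, that is `R(X, Y)Z = c (g(Y, Z) X - g(X, Z) Y)`. -/
def HasConstantCurvature
    (g : Bundle.ContMDiffRiemannianMetric 𝓘(ℝ, EuclideanSpace ℝ (Fin n)) ∞
      (EuclideanSpace ℝ (Fin n)) (TangentSpace 𝓘(ℝ, EuclideanSpace ℝ (Fin n)) (M := M)))
    (c : ℝ) : Prop :=
  ∀ e ∈ IsManifold.maximalAtlas 𝓘(ℝ, EuclideanSpace ℝ (Fin n)) ∞ M, ∀ x ∈ e.target,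
    ∀ X Y Z : EuclideanSpace ℝ (Fin n),
      curvature (localMetric g e) x X Y Z
        = c • (localMetric g e x Y Z • X - localMetric g e x X Z • Y)

/-- `P` holds for the metric of the base in every chart `e` of `M`, at every point `(x, y)` of the
induced chart `e.target × ℝⁿ` of the tangent bundle. -/
def OnTangentBundle
    (g : Bundle.ContMDiffRiemannianMetric 𝓘(ℝ, EuclideanSpace ℝ (Fin n)) ∞
      (EuclideanSpace ℝ (Fin n)) (TangentSpace 𝓘(ℝ, EuclideanSpace ℝ (Fin n)) (M := M)))
    (P : (EuclideanSpace ℝ (Fin n) →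
        EuclideanSpace ℝ (Fin n) →L[ℝ] EuclideanSpace ℝ (Fin n) →L[ℝ] ℝ) →
      EuclideanSpace ℝ (Fin n) × EuclideanSpace ℝ (Fin n) → Prop) : Prop :=
  ∀ e ∈ IsManifold.maximalAtlas 𝓘(ℝ, EuclideanSpace ℝ (Fin n)) ∞ M, ∀ x ∈ e.target,
    ∀ y : EuclideanSpace ℝ (Fin n), P (localMetric g e) (x, y)

/-- `(G, J)` is an almost anti-Hermitian structure on `TM`: `J` is an almost complex structure,
`G` is a (nondegenerate) semi-Riemannian metric, and `G(JU, JV) = -G(U, V)`; such a `G` always has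
signature `(n, n)`. -/
def IsAlmostAntiHermitian
    (g : Bundle.ContMDiffRiemannianMetric 𝓘(ℝ, EuclideanSpace ℝ (Fin n)) ∞
      (EuclideanSpace ℝ (Fin n)) (TangentSpace 𝓘(ℝ, EuclideanSpace ℝ (Fin n)) (M := M)))
    (A : EndoCoeffs) (C : MetricCoeffs) : Prop :=
  OnTangentBundle g fun γ p =>
    (∀ U, liftEndo A γ p (liftEndo A γ p U) = -U) ∧
    (∀ U, (∀ V, liftMetric C γ p U V = 0) → U = 0) ∧
    (∀ U V, liftMetric C γ p (liftEndo A γ p U) (liftEndo A γ p V) = -liftMetric C γ p U V)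

/-- `J` is integrable on `TM`: its Nijenhuis tensor vanishes. -/
def IsIntegrable
    (g : Bundle.ContMDiffRiemannianMetric 𝓘(ℝ, EuclideanSpace ℝ (Fin n)) ∞
      (EuclideanSpace ℝ (Fin n)) (TangentSpace 𝓘(ℝ, EuclideanSpace ℝ (Fin n)) (M := M)))
    (A : EndoCoeffs) : Prop :=
  OnTangentBundle g fun γ p => ∀ X Y, nijenhuis (liftEndo A γ) p X Y = 0

/-- `(TM, G, J)` is anti-Kähler: the tensor `F(X, Y, Z) = G((∇_X J) Y, Z)` vanishes, with `∇` the
Levi-Civita connection of `G`. -/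
def IsAntiKaehler
    (g : Bundle.ContMDiffRiemannianMetric 𝓘(ℝ, EuclideanSpace ℝ (Fin n)) ∞
      (EuclideanSpace ℝ (Fin n)) (TangentSpace 𝓘(ℝ, EuclideanSpace ℝ (Fin n)) (M := M)))
    (A : EndoCoeffs) (C : MetricCoeffs) : Prop :=
  OnTangentBundle g fun γ p => ∀ X Y Z, tensorF (liftMetric C γ) (liftEndo A γ) p X Y Z = 0

end Global

/-! ### The conditions on the coefficients -/

/-- The derivative of a function of `t ∈ [0, ∞)` (one-sided at `t = 0`). -/
def dt (f : ℝ → ℝ) (t : ℝ) : ℝ := derivWithin f (Set.Ici 0) t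

/-- The expressions of `b₁`, `b₂`, `b₃` at `t` for an integrable `J` over a space form of
curvature `c`, their common denominator being nonzero. -/
def IntegrabilityEqs (A : EndoCoeffs) (c t : ℝ) : Prop :=
  let a₁ := A.a₁ t
  let a₂ := A.a₂ t
  let a₃ := A.a₃ t
  let a₁' := dt A.a₁ t
  let a₂' := dt A.a₂ t
  let a₃' := dt A.a₃ t
  let E := a₁ - 2 * t * a₁' - 2 * c * t * a₂ - 4 * c * t ^ 2 * a₂'
  E ≠ 0 ∧
  A.b₁ t = (2 * c ^ 2 * t * a₂ ^ 2 + 2 * c * t * a₁ * a₂' + a₁ * a₁' - c + 3 * c * a₃ ^ 2) / E ∧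
  A.b₂ t = (2 * t * a₃' ^ 2 - 2 * t * a₁' * a₂' + c * a₂ ^ 2 + 2 * c * t * a₂ * a₂'
      + a₁ * a₂') / E ∧
  A.b₃ t = (a₁ * a₃' + 2 * c * a₂ * a₃ + 4 * c * t * a₂' * a₃ - 2 * c * t * a₂ * a₃') / E

/-- The denominator `a₁⁴ + 4 a₁² (a₃² - 1) c t + 4 (1 + a₃²)² c² t²`. -/
def denom (A : EndoCoeffs) (c t : ℝ) : ℝ :=
  A.a₁ t ^ 4 + 4 * A.a₁ t ^ 2 * (A.a₃ t ^ 2 - 1) * c * t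
    + 4 * (1 + A.a₃ t ^ 2) ^ 2 * c ^ 2 * t ^ 2

/-- The expressions of `d₁`, `d₃`, `c₁'`, `c₃'` at `t`. -/
def MetricEqs (A : EndoCoeffs) (C : MetricCoeffs) (c t : ℝ) : Prop :=
  let a₁ := A.a₁ t
  let a₃ := A.a₃ t
  let a₁' := dt A.a₁ t
  let a₃' := dt A.a₃ t
  let c₁ := C.c₁ t
  let c₃ := C.c₃ t
  let D := denom A c t
  C.d₁ t = c * C.c₂ t ∧
  C.d₃ t = (a₃' * c₁ - a₁' * c₃) / a₁ ∧
  dt C.c₁ t =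
    -2 * c * a₁ ^ 2 *
      ((2 * c₃ * (a₁ * (a₃ + a₃' * t) - 2 * a₁' * a₃ * t) - c₁ * (1 + a₃ ^ 2)) / D)
    - 2 * c * (1 + a₃ ^ 2) *
      ((c * c₁ * t * (2 * a₁ * (1 + a₃ ^ 2 + 4 * a₃ * a₃' * t) - 4 * a₁' * (1 + a₃ ^ 2) * t)
        + 2 * a₁ ^ 2 * t * (a₁' * c₁ - 2 * a₃' * c * c₃ * t)) / (a₁ * D)) ∧
  dt C.c₃ t =
    2 * c * a₁ *
      ((c₃ * (a₁ + a₃ * (4 * t * (a₁' * a₃ - a₁ * a₃') - 3 * a₁ * a₃))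
        + 2 * a₃ * c₁ * (1 + a₃ ^ 2 + 2 * a₃ * a₃' * t)) / D)
    + ((a₃' * c₁ - a₁' * c₃) * (a₁ ^ 4 - 4 * (1 + a₃ ^ 2) ^ 2 * c ^ 2 * t ^ 2)
        - 4 * a₁ * (1 + a₃ ^ 2) * c * (2 * a₁' * a₃ * c₁ + (1 + a₃ ^ 2) * c * c₃) * t)
      / (a₁ * D)

end AntiKaehler

end

/-! On each fibre `J` and `G` split into two blocks, one on vectors orthogonal to `y`, with
coefficients a_i and c_i, and one along `y`, with coefficients a_i + 2t b_i and c_i + 2t d_i. The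
anti-Hermitian conditions on the blocks give `CoeffRelations`; in particular a₁ and a₁ + 2t b₁ never
vanish, so the horizontal vectors and their images under `J` fill the tangent space
(`exists_frame_add`). It is therefore enough to test tensors compatible with `J` on horizontal
vectors. There the derivatives of `J` and `G` are explicit up to terms in the auxiliary connection
`liftConn`, and in the tensors considered these terms combine to its torsion, which is the vertical
lift of R(·,·)y.

Integrability. The Nijenhuis tensor on y^H and ξ^H, with ξ orthogonal to y, gives R(y,ξ)y = -2tκ(t)ξ
with κ a function of the coefficients alone (`curvature_of_nijenhuis`). On unit vectors κ(1/2) is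
one and the same number at every point, so the curvature is constant without Schur's lemma, also in
dimension two. What remains of the integrability condition is `NijenhuisEqs`, linear in b₁ and b₃,
with determinant a₁E. Since a₁²(a₁ + 2t b₁)E = D, and D solves a linear equation D' = fD with D(0) =
a₁(0)⁴ ≠ 0 (`denom_ne`), neither D nor E vanishes. Cramer's rule then gives b₁ and b₃, and J² = -1
gives b₂ (`integrabilityEqs`).

Anti-Kähler condition. The tensor F(X,Y,Z) = G((∇_X J)Y,Z) vanishes if and only if the Nijenhuis
tensor vanishes and Tachibana's operator vanishes on horizontal vectors both for G and for the twin
metric G(J·,·) (`tensorF_eq_zero_iff`). This avoids computing the Levi-Civita connection of G. Each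
of the two operators has three scalar coefficients. Those of G yield d₁ and c₁', those of the twin
yield d₃ and c₃' (`metricEqs_iff`), and the third coefficient of each follows by differentiating the
relation d₁ = c c₂ (`dt_d₁`). -/

namespace AntiKaehler

open Filter Topology

/-! ### Levi-Civita connection and curvature in a chart. -/

section ChartCalculus

variable {W : Type*} [NormedAddCommGroup W] [NormedSpace ℝ W]

theorem isInvertible_of_nondegenerate [FiniteDimensional ℝ W] {b : W →L[ℝ] W →L[ℝ] ℝ}
    (h : ∀ U, (∀ V, b U V = 0) → U = 0) : b.IsInvertible := by
  have hinj : Function.Injective (b : W →ₗ[ℝ] W →L[ℝ] ℝ) := by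
    rw [← LinearMap.ker_eq_bot, LinearMap.ker_eq_bot']
    intro U hU
    exact h U fun V => by
      have : b U = 0 := hU
      simp [this]
  have hfin : Module.finrank ℝ W = Module.finrank ℝ (W →L[ℝ] ℝ) := by
    rw [← (LinearMap.toContinuousLinearMap : (W →ₗ[ℝ] ℝ) ≃ₗ[ℝ] W →L[ℝ] ℝ).finrank_eq]
    exact (Subspace.dual_finrank_eq (K := ℝ) (V := W)).symm
  refine ⟨(LinearEquiv.ofInjectiveOfFinrankEq (b : W →ₗ[ℝ] W →L[ℝ] ℝ) hinj
    hfin).toContinuousLinearEquiv, ?_⟩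
  ext U V
  rfl

variable {B : W → W →L[ℝ] W →L[ℝ] ℝ} {x : W}

theorem apply_christoffel (hB : (B x).IsInvertible) (X Y Z : W) :
    B x (christoffel B x X Y) Z
      = (fderiv ℝ B x X Y Z + fderiv ℝ B x Y X Z - fderiv ℝ B x Z X Y) / 2 := by
  rw [christoffel_apply, map_smul, hB.self_apply_inverse, _root_.smul_apply,
    koszul_apply, smul_eq_mul]
  ring

theorem fderiv_symm (hd : DifferentiableAt ℝ B x) (hs : ∀ᶠ q in 𝓝 x, ∀ X Y, B q X Y = B q Y X)
    (V X Y : W) : fderiv ℝ B x V X Y = fderiv ℝ B x V Y X := by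
  have h : ∀ X Y, fderiv ℝ B x V X Y = fderiv ℝ (fun q => B q X Y) x V := by
    intro X Y
    have := ((hd.hasFDerivAt.clm_apply (hasFDerivAt_const X x)).clm_apply
      (hasFDerivAt_const Y x)).fderiv
    rw [this]
    simp
  rw [h, h]
  have : (fun q => B q X Y) =ᶠ[𝓝 x] fun q => B q Y X := hs.mono fun q hq => hq X Y
  rw [this.fderiv_eq]

theorem christoffel_symm (hd : DifferentiableAt ℝ B x)
    (hs : ∀ᶠ q in 𝓝 x, ∀ X Y, B q X Y = B q Y X) (X Y : W) :
    christoffel B x X Y = christoffel B x Y X := by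
  rw [christoffel_apply, christoffel_apply]
  congr 2
  ext Z
  rw [koszul_apply, koszul_apply, fderiv_symm hd hs Z X Y]
  ring

theorem fderiv_metric (hd : DifferentiableAt ℝ B x) (hB : (B x).IsInvertible)
    (hs : ∀ᶠ q in 𝓝 x, ∀ X Y, B q X Y = B q Y X) (X Y Z : W) :
    fderiv ℝ B x X Y Z = B x (christoffel B x X Y) Z + B x Y (christoffel B x X Z) := by
  rw [hs.self_of_nhds Y, apply_christoffel hB, apply_christoffel hB, fderiv_symm hd hs X Z Y,
    fderiv_symm hd hs Y X Z, fderiv_symm hd hs Z X Y]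
  ring

theorem differentiableAt_christoffel [CompleteSpace W] (h2 : ContDiffAt ℝ 2 B x) (hB : (B x).IsInvertible) :
    DifferentiableAt ℝ (christoffel B) x := by
  have h1 : DifferentiableAt ℝ (fun q => (B q).inverse) x :=
    (ContDiffAt.comp x (hB.contDiffAt_map_inverse (n := 2)) h2).differentiableAt (by norm_num)
  have h3 : DifferentiableAt ℝ (fderiv ℝ B) x :=
    (h2.fderiv_right (m := 1) (by norm_num)).differentiableAt (by norm_num)
  have hflip : ∀ {F G H : Type _} [NormedAddCommGroup F] [NormedSpace ℝ F]
      [NormedAddCommGroup G] [NormedSpace ℝ G] [NormedAddCommGroup H] [NormedSpace ℝ H]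
      {f : W → F →L[ℝ] G →L[ℝ] H}, DifferentiableAt ℝ f x →
      DifferentiableAt ℝ (fun q => (f q).flip) x := fun {F G H} _ _ _ _ _ _ {f} hf =>
    ((ContinuousLinearMap.flipₗᵢ ℝ F G H).toContinuousLinearEquiv.differentiableAt).comp x hf
  have h4 : DifferentiableAt ℝ (koszul B) x := by
    unfold koszul
    exact (h3.add (hflip h3)).sub ((differentiableAt_const _).clm_comp (hflip h3))
  unfold christoffel
  have h5 : DifferentiableAt ℝ (fun q =>
      ContinuousLinearMap.compL ℝ W (W →L[ℝ] ℝ) W (B q).inverse ∘L koszul B q) x :=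
    ((ContinuousLinearMap.compL ℝ W (W →L[ℝ] ℝ) W).differentiableAt.comp x h1).clm_comp h4
  exact h5.const_smul (2⁻¹ : ℝ)

theorem curvature_antisymm (X Y Z : W) : curvature B x X Y Z = -curvature B x Y X Z := by
  unfold curvature
  abel

theorem fderiv_christoffel_symm (hd : DifferentiableAt ℝ (christoffel B) x)
    (hs : ∀ᶠ q in 𝓝 x, ∀ X Y, christoffel B q X Y = christoffel B q Y X) (V X Y : W) :
    fderiv ℝ (christoffel B) x V X Y = fderiv ℝ (christoffel B) x V Y X := by
  have h : ∀ X Y, fderiv ℝ (christoffel B) x V X Y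
      = fderiv ℝ (fun q => christoffel B q X Y) x V := by
    intro X Y
    rw [((hd.hasFDerivAt.clm_apply (hasFDerivAt_const X x)).clm_apply
      (hasFDerivAt_const Y x)).fderiv]
    simp
  rw [h, h]
  have : (fun q => christoffel B q X Y) =ᶠ[𝓝 x] fun q => christoffel B q Y X :=
    hs.mono fun q hq => hq X Y
  rw [this.fderiv_eq]

theorem curvature_bianchi (hd : DifferentiableAt ℝ (christoffel B) x)
    (hs : ∀ᶠ q in 𝓝 x, ∀ X Y, christoffel B q X Y = christoffel B q Y X) (X Y Z : W) :
    curvature B x X Y Z + curvature B x Y Z X + curvature B x Z X Y = 0 := by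
  unfold curvature
  have h := fderiv_christoffel_symm hd hs
  have h' := hs.self_of_nhds
  rw [h X Y Z, h Y Z X, h Z X Y, h' Y Z, h' Z X, h' X Y]
  abel

/-- Second derivatives of the function B(Z, Z) commute. Written with metric compatibility, the
antisymmetrised second derivative is 2B(R(X,Y)Z, Z). -/
theorem curvature_skew [CompleteSpace W] (h2 : ContDiffAt ℝ 2 B x) (hn : ∀ᶠ q in 𝓝 x, (B q).IsInvertible)
    (hs : ∀ᶠ q in 𝓝 x, ∀ X Y, B q X Y = B q Y X) (X Y Z : W) :
    B x (curvature B x X Y Z) Z = 0 := by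
  have hd : DifferentiableAt ℝ B x := h2.differentiableAt (by norm_num)
  have hc := differentiableAt_christoffel h2 hn.self_of_nhds
  have h3 : DifferentiableAt ℝ (fderiv ℝ B) x :=
    (h2.fderiv_right (m := 1) (by norm_num)).differentiableAt (by norm_num)
  have hev : ∀ Y, (fun q => fderiv ℝ B q Y Z Z)
      =ᶠ[𝓝 x] fun q => 2 * B q (christoffel B q Y Z) Z := by
    intro Y
    have hd' : ∀ᶠ q in 𝓝 x, DifferentiableAt ℝ B q := by
      filter_upwards [h2.eventually (by norm_num)] with q hq
      exact hq.differentiableAt (by norm_num)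
    filter_upwards [hd', hn, hs.eventually_nhds] with q h1 h2 h3
    rw [fderiv_metric h1 h2 h3, h3.self_of_nhds Z]
    ring
  have key : ∀ X Y, fderiv ℝ (fderiv ℝ B) x X Y Z Z
      = 2 * (fderiv ℝ B x X (christoffel B x Y Z) Z
        + B x (fderiv ℝ (christoffel B) x X Y Z) Z) := by
    intro X Y
    have e1 := (((h3.hasFDerivAt.clm_apply (hasFDerivAt_const Y x)).clm_apply
      (hasFDerivAt_const Z x)).clm_apply (hasFDerivAt_const Z x)).fderiv
    have e2 := ((hd.hasFDerivAt.clm_apply ((hc.hasFDerivAt.clm_apply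
      (hasFDerivAt_const Y x)).clm_apply (hasFDerivAt_const Z x))).clm_apply
      (hasFDerivAt_const Z x)).const_mul (2 : ℝ)
    have e3 := (hev Y).fderiv_eq (𝕜 := ℝ)
    rw [e1, e2.fderiv] at e3
    have := congrArg (fun L : W →L[ℝ] ℝ => L X) e3
    simp at this
    linarith
  have hsym := h2.isSymmSndFDerivAt (by simp) X Y
  have h5 := congrArg (fun L : W →L[ℝ] W →L[ℝ] ℝ => L Z Z) hsym
  simp only [key, fderiv_metric hd hn.self_of_nhds hs] at h5
  have h6 := hs.self_of_nhds (christoffel B x X Z) (christoffel B x Y Z)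
  simp only [curvature, map_add, map_sub, _root_.add_apply,
    _root_.sub_apply]
  linarith

/-- A curvature-like tensor is determined by the values `R(y, Y)y`. -/
theorem eq_constantCurvature_of_sectional {b : W → W → ℝ} {R : W → W → W → W} {c : ℝ}
    (hb1 : ∀ u v w, b (u + v) w = b u w + b v w) (hb2 : ∀ u v, b u v = b v u)
    (hR1 : ∀ X X' Y Z, R (X + X') Y Z = R X Y Z + R X' Y Z)
    (hR3 : ∀ X Y Z Z', R X Y (Z + Z') = R X Y Z + R X Y Z')
    (hanti : ∀ X Y Z, R X Y Z = -R Y X Z)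
    (hbian : ∀ X Y Z, R X Y Z + R Y Z X + R Z X Y = 0)
    (h : ∀ y Y, R y Y y = c • (b Y y • y - b y y • Y)) (X Y Z : W) :
    R X Y Z = c • (b Y Z • X - b X Z • Y) := by
  have hb1' : ∀ u v w, b w (u + v) = b w u + b w v := fun u v w => by
    rw [hb2, hb1, hb2 u, hb2 v]
  -- Polarisation of the hypothesis in `y`.
  have pol : ∀ y z Y, R y Y z + R z Y y
      = c • (b Y z • y + b Y y • z - (2 * b y z) • Y) := by
    intro y z Y
    have h1 := h (y + z) Y
    rw [hR1, hR3, hR3, h, h, hb1, hb1', hb1', hb1', hb2 z y] at h1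
    have : R y Y z + R z Y y = c • (b Y y • y - b y y • Y) + R y Y z
        + (R z Y y + c • (b Y z • z - b z z • Y)) - c • (b Y y • y - b y y • Y)
        - c • (b Y z • z - b z z • Y) := by abel
    rw [this, h1]
    module
  have e1 := pol X Z Y
  have e2 := pol Y X Z
  have e3 := pol Y Z X
  have e4 := hbian X Y Z
  have a1 := hanti Z Y X
  have a2 := hanti Y Z X
  have a3 := hanti X Z Y
  have a4 := hanti Y X Z
  -- Polarisation and antisymmetry turn both other terms of the Bianchi sum into R(X,Y)Z plus metric
  -- terms, so the cyclic identity becomes an equation for 3R(X,Y)Z.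
  have : (3 : ℝ) • R X Y Z = (3 : ℝ) • (c • (b Y Z • X - b X Z • Y)) := by
    rw [hb2 Z X, hb2 Z Y] at *
    rw [a1] at e1
    rw [a4] at e3
    have f1 : R Y Z X = R X Y Z - c • (b Y Z • X + b Y X • Z - (2 * b X Z) • Y) := by
      rw [← e1]; abel
    have f3 : R Z X Y = R X Y Z + c • (b X Z • Y + b X Y • Z - (2 * b Y Z) • X) := by
      rw [← e3]; abel
    rw [f1, f3, hb2 Y X] at e4
    have : (3 : ℝ) • R X Y Z = R X Y Z + (R X Y Z - c • (b Y Z • X + b X Y • Z - (2 * b X Z) • Y))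
        + (R X Y Z + c • (b X Z • Y + b X Y • Z - (2 * b Y Z) • X))
        + (3 : ℝ) • (c • (b Y Z • X - b X Z • Y)) := by module
    rw [this, e4, zero_add]
  exact smul_right_injective W (by norm_num : (3 : ℝ) ≠ 0) this

end ChartCalculus

/-! ### The anti-Kähler condition through the Nijenhuis tensor and Tachibana's operator. -/

section Tachibana

variable {W : Type*} [NormedAddCommGroup W] [NormedSpace ℝ W]

theorem fderiv_apply_const {F : Type*} [NormedAddCommGroup F] [NormedSpace ℝ F]
    {J : W → W →L[ℝ] F} {p : W} (hJ : DifferentiableAt ℝ J p) (X Y : W) :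
    fderiv ℝ (fun q => J q Y) p X = fderiv ℝ J p X Y := by
  rw [(hJ.hasFDerivAt.clm_apply (hasFDerivAt_const Y p)).fderiv]
  simp

theorem fderiv_apply_const₂ {B : W → W →L[ℝ] W →L[ℝ] ℝ} {p : W} (hB : DifferentiableAt ℝ B p)
    (X Y Z : W) : fderiv ℝ (fun q => B q Y Z) p X = fderiv ℝ B p X Y Z := by
  rw [((hB.hasFDerivAt.clm_apply (hasFDerivAt_const Y p)).clm_apply
    (hasFDerivAt_const Z p)).fderiv]
  simp

theorem nijenhuis_eq {J : W → W →L[ℝ] W} {p : W} (hJ : DifferentiableAt ℝ J p) (X Y : W) :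
    nijenhuis J p X Y = fderiv ℝ J p (J p X) Y - fderiv ℝ J p (J p Y) X
      + J p (fderiv ℝ J p Y X) - J p (fderiv ℝ J p X Y) := by
  simp only [nijenhuis, VectorField.lieBracket, fderiv_apply_const hJ,
    fderiv_fun_const, Pi.zero_apply, _root_.zero_apply, zero_sub, sub_zero, map_neg]
  abel

/-- Tachibana's operator of a pair `B`, `B'` of tensor fields, where `B'(U, V) = B(JU, V)`. -/
noncomputable def tachibana (B B' : W → W →L[ℝ] W →L[ℝ] ℝ) (J : W → W →L[ℝ] W) (p X Y Z : W) : ℝ :=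
  fderiv ℝ B p (J p X) Y Z - fderiv ℝ B' p X Y Z + B p (fderiv ℝ J p Y X) Z
    + B p Y (fderiv ℝ J p Z X)

/-- `(B, J)` is an almost anti-Hermitian structure near `p`, of class `C¹`. -/
structure AntiHermitianNear (B : W → W →L[ℝ] W →L[ℝ] ℝ) (J : W → W →L[ℝ] W) (p : W) : Prop where
  diff_metric : DifferentiableAt ℝ B p
  diff_endo : DifferentiableAt ℝ J p
  invertible : (B p).IsInvertible
  symm : ∀ᶠ q in 𝓝 p, ∀ U V, B q U V = B q V U
  sq : ∀ᶠ q in 𝓝 p, ∀ U, J q (J q U) = -U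
  adj : ∀ᶠ q in 𝓝 p, ∀ U V, B q (J q U) V = B q U (J q V)

namespace AntiHermitianNear

variable {B B' : W → W →L[ℝ] W →L[ℝ] ℝ} {J : W → W →L[ℝ] W} {p : W}

theorem fderiv_sq (h : AntiHermitianNear B J p) (X Y : W) :
    fderiv ℝ J p X (J p Y) = -J p (fderiv ℝ J p X Y) := by
  have hd := h.diff_endo.hasFDerivAt
  have e1 := (hd.clm_apply (hd.clm_apply (hasFDerivAt_const Y p))).fderiv
  have e2 : (fun q => J q (J q Y)) =ᶠ[𝓝 p] fun _ => -Y := h.sq.mono fun q hq => hq Y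
  rw [e2.fderiv_eq] at e1
  have := congrArg (fun L : W →L[ℝ] W => L X) e1
  simp at this
  rw [eq_neg_iff_add_eq_zero, add_comm]
  exact this.symm

theorem fderiv_twin (h : AntiHermitianNear B J p)
    (h' : ∀ᶠ q in 𝓝 p, ∀ U V, B' q U V = B q (J q U) V) (hd : DifferentiableAt ℝ B' p)
    (X Y Z : W) :
    fderiv ℝ B' p X Y Z = fderiv ℝ B p X (J p Y) Z + B p (fderiv ℝ J p X Y) Z := by
  have e1 := ((h.diff_metric.hasFDerivAt.clm_apply (h.diff_endo.hasFDerivAt.clm_apply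
    (hasFDerivAt_const Y p))).clm_apply (hasFDerivAt_const Z p)).fderiv
  have e2 : (fun q => B' q Y Z) =ᶠ[𝓝 p] fun q => B q (J q Y) Z := h'.mono fun q hq => hq Y Z
  rw [← e2.fderiv_eq] at e1
  have := congrArg (fun L : W →L[ℝ] ℝ => L X) e1
  simp only [fderiv_apply_const₂ hd] at this
  simpa [add_comm] using this

theorem fderiv_adj (h : AntiHermitianNear B J p) (X Y Z : W) :
    fderiv ℝ B p X (J p Y) Z + B p (fderiv ℝ J p X Y) Z
      = fderiv ℝ B p X Y (J p Z) + B p Y (fderiv ℝ J p X Z) := by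
  have e1 := ((h.diff_metric.hasFDerivAt.clm_apply (h.diff_endo.hasFDerivAt.clm_apply
    (hasFDerivAt_const Y p))).clm_apply (hasFDerivAt_const Z p)).fderiv
  have e2 := ((h.diff_metric.hasFDerivAt.clm_apply (hasFDerivAt_const Y p)).clm_apply
    (h.diff_endo.hasFDerivAt.clm_apply (hasFDerivAt_const Z p))).fderiv
  have e3 : (fun q => B q (J q Y) Z) =ᶠ[𝓝 p] fun q => B q Y (J q Z) :=
    h.adj.mono fun q hq => hq Y Z
  rw [e3.fderiv_eq, e2] at e1
  have := congrArg (fun L : W →L[ℝ] ℝ => L X) e1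
  simp at this
  linarith

theorem christoffel_comm (h : AntiHermitianNear B J p) (X Y : W) :
    christoffel B p X Y = christoffel B p Y X :=
  christoffel_symm h.diff_metric h.symm X Y

theorem fderiv_eq (h : AntiHermitianNear B J p) (X Y Z : W) :
    fderiv ℝ B p X Y Z = B p (christoffel B p X Y) Z + B p (christoffel B p X Z) Y := by
  rw [fderiv_metric h.diff_metric h.invertible h.symm, h.symm.self_of_nhds Y]

theorem tensorF_eq (X Y Z : W) : tensorF B J p X Y Z
    = B p (fderiv ℝ J p X Y) Z + B p (christoffel B p X (J p Y)) Z
      - B p (J p (christoffel B p X Y)) Z := by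
  simp [tensorF, covDeriv]

theorem tensorF_symm (h : AntiHermitianNear B J p) (X Y Z : W) :
    tensorF B J p X Y Z = tensorF B J p X Z Y := by
  have h1 := h.fderiv_adj X Y Z
  have hs := h.symm.self_of_nhds
  have ha := h.adj.self_of_nhds
  simp only [h.fderiv_eq, tensorF_eq] at h1 ⊢
  rw [ha, ha (christoffel B p X Z), hs Y] at *
  linarith

theorem tensorF_endo (h : AntiHermitianNear B J p) (X Y Z : W) :
    tensorF B J p X (J p Y) Z = -tensorF B J p X Y (J p Z) := by
  have ha := h.adj.self_of_nhds
  have h2 := h.sq.self_of_nhds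
  simp only [tensorF_eq, h.fderiv_sq, h2, map_neg, _root_.neg_apply, ← ha]
  ring

/-- As the Levi-Civita connection has no torsion, the partial derivatives in the Nijenhuis tensor
may be replaced by covariant ones. -/
theorem metric_nijenhuis (h : AntiHermitianNear B J p) (X Y Z : W) :
    B p (nijenhuis J p X Y) Z = tensorF B J p (J p X) Y Z - tensorF B J p (J p Y) X Z
      + tensorF B J p Y X (J p Z) - tensorF B J p X Y (J p Z) := by
  have ha := h.adj.self_of_nhds
  have h2 := h.sq.self_of_nhds
  simp only [nijenhuis_eq h.diff_endo, tensorF_eq, map_add, map_sub, _root_.add_apply,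
    _root_.sub_apply, ← ha, h2, map_neg, _root_.neg_apply]
  rw [h.christoffel_comm (J p X) (J p Y), h.christoffel_comm Y X, h.christoffel_comm (J p X) Y,
    h.christoffel_comm X (J p Y)]
  ring

/-- Metric compatibility eliminates the derivatives of `B`, and the Christoffel terms cancel by
symmetry. The right side determines F, since F is symmetric in its last two arguments. -/
theorem tachibana_eq (h : AntiHermitianNear B J p)
    (h' : ∀ᶠ q in 𝓝 p, ∀ U V, B' q U V = B q (J q U) V) (hd : DifferentiableAt ℝ B' p)
    (X Y Z : W) :
    tachibana B B' J p X Y Z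
      = -tensorF B J p X Y Z + tensorF B J p Y X Z + tensorF B J p Z X Y := by
  have hs := h.symm.self_of_nhds
  have ha := h.adj.self_of_nhds
  simp only [tachibana, h.fderiv_twin h' hd, tensorF_eq, h.fderiv_eq]
  rw [hs Y (fderiv ℝ J p Z X), h.christoffel_comm (J p X) Y, h.christoffel_comm (J p X) Z,
    h.christoffel_comm Y X, h.christoffel_comm Z X, ha _ Z, ha _ Y]
  have := hs (christoffel B p X Z) (J p Y)
  have := ha (christoffel B p X Z) Y
  have := ha (christoffel B p X Y) Z
  linarith

/-- The twin of `B'` is B(J²·,·) = -B. The operator of this second pair is still expressed through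
the connection of `B`, so that both pairs constrain the same tensor F. -/
theorem tachibana_twin (h : AntiHermitianNear B J p)
    (h' : ∀ᶠ q in 𝓝 p, ∀ U V, B' q U V = B q (J q U) V) (hd : DifferentiableAt ℝ B' p)
    (X Y Z : W) :
    tachibana B' (fun q => -B q) J p X Y Z
      = tensorF B J p (J p X) Y Z + tensorF B J p Y X (J p Z) + tensorF B J p Z X (J p Y) := by
  have hs := h.symm.self_of_nhds
  have ha := h.adj.self_of_nhds
  have h2 := h.sq.self_of_nhds
  have h3 := h'.self_of_nhds
  have hneg : fderiv ℝ (fun q => -B q) p = -fderiv ℝ B p := fderiv_fun_neg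
  simp only [tachibana, h.fderiv_twin h' hd, tensorF_eq, h.fderiv_eq, h3, hneg,
    _root_.neg_apply]
  rw [hs (J p Y) (fderiv ℝ J p Z X)]
  simp only [ha, h2, map_neg]
  rw [h.christoffel_comm Y X, h.christoffel_comm Z X, h.christoffel_comm Y (J p X),
    h.christoffel_comm Z (J p X)]
  ring

theorem nijenhuis_endo_left (hJ : DifferentiableAt ℝ J p)
    (hsq : ∀ X Y, fderiv ℝ J p X (J p Y) = -J p (fderiv ℝ J p X Y))
    (h2 : ∀ U, J p (J p U) = -U) (X Y : W) :
    nijenhuis J p (J p X) Y = -J p (nijenhuis J p X Y) := by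
  simp only [nijenhuis_eq hJ, hsq, h2, map_add, map_sub, map_neg, _root_.neg_apply]
  abel

theorem nijenhuis_antisymm (hJ : DifferentiableAt ℝ J p) (X Y : W) :
    nijenhuis J p X Y = -nijenhuis J p Y X := by
  simp only [nijenhuis_eq hJ]
  abel

/-- The rule N(JX, Y) = -J N(X, Y) and antisymmetry carry the vanishing from horizontal vectors to
the span of these vectors and their images under `J`. -/
theorem nijenhuis_eq_zero (h : AntiHermitianNear B J p) {E : Type*} {hor : E → W}
    (hspan : ∀ U, ∃ X Y, U = hor X + J p (hor Y))
    (h0 : ∀ X Y, nijenhuis J p (hor X) (hor Y) = 0) (U V : W) : nijenhuis J p U V = 0 := by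
  have hadd : ∀ U U' V, nijenhuis J p (U + U') V = nijenhuis J p U V + nijenhuis J p U' V := by
    intro U U' V
    simp only [nijenhuis_eq h.diff_endo, map_add, _root_.add_apply]
    abel
  have hl : ∀ V, (∀ X, nijenhuis J p (hor X) V = 0) → ∀ U, nijenhuis J p U V = 0 := by
    intro V hV U
    obtain ⟨X, Y, rfl⟩ := hspan U
    rw [hadd, hV, nijenhuis_endo_left h.diff_endo h.fderiv_sq h.sq.self_of_nhds, hV]
    simp
  refine hl V (fun X => ?_) U
  rw [nijenhuis_antisymm h.diff_endo, hl (hor X) (fun Y => h0 Y X), neg_zero]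

/-- The anti-Kähler condition in terms of the Nijenhuis tensor and Tachibana's operator. -/
theorem tensorF_eq_zero_iff (h : AntiHermitianNear B J p)
    (h' : ∀ᶠ q in 𝓝 p, ∀ U V, B' q U V = B q (J q U) V) (hd : DifferentiableAt ℝ B' p)
    {E : Type*} {hor : E → W} (hspan : ∀ U, ∃ X Y, U = hor X + J p (hor Y)) :
    (∀ X Y Z, tensorF B J p X Y Z = 0) ↔
      (∀ X Y, nijenhuis J p X Y = 0) ∧
      (∀ X Y Z, tachibana B B' J p (hor X) (hor Y) (hor Z) = 0) ∧
      (∀ X Y Z, tachibana B' (fun q => -B q) J p (hor X) (hor Y) (hor Z) = 0) := by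
  constructor
  · intro h0
    refine ⟨fun X Y => ?_, fun X Y Z => ?_, fun X Y Z => ?_⟩
    · have h1 : B p (nijenhuis J p X Y) = 0 := by
        ext Z
        rw [h.metric_nijenhuis]
        simp [h0]
      exact (injective_iff_map_eq_zero (B p)).1 h.invertible.bijective.1 _ h1
    · rw [h.tachibana_eq h' hd]
      simp [h0]
    · rw [h.tachibana_twin h' hd]
      simp [h0]
  · rintro ⟨hN, hP, hQ⟩
    simp only [h.tachibana_eq h' hd] at hP
    simp only [h.tachibana_twin h' hd] at hQ
    have hF1 : ∀ X X' Y Z, tensorF B J p (X + X') Y Z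
        = tensorF B J p X Y Z + tensorF B J p X' Y Z := fun X X' Y Z => by
      simp only [tensorF_eq, map_add, _root_.add_apply]
      ring
    have hF2 : ∀ X Y Y' Z, tensorF B J p X (Y + Y') Z
        = tensorF B J p X Y Z + tensorF B J p X Y' Z := fun X Y Y' Z => by
      simp only [tensorF_eq, map_add, _root_.add_apply]
      ring
    have hF3 : ∀ X Y Z Z', tensorF B J p X Y (Z + Z')
        = tensorF B J p X Y Z + tensorF B J p X Y Z' := fun X Y Z Z' => by
      simp only [tensorF_eq, map_add]
      ring
    have hsq := h.sq.self_of_nhds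
    have hs := h.tensorF_symm
    have he := h.tensorF_endo
    have hneg : ∀ X Y Z, tensorF B J p (-X) Y Z = -tensorF B J p X Y Z := fun X Y Z => by
      simp [tensorF_eq]
      ring
    have hN' : ∀ X Y Z, tensorF B J p (J p X) Y Z - tensorF B J p (J p Y) X Z
      + tensorF B J p Y X (J p Z) - tensorF B J p X Y (J p Z) = 0 := fun X Y Z => by
      rw [← h.metric_nijenhuis, hN]
      simp
    set P : W → W → W → ℝ := fun X Y Z =>
      -tensorF B J p X Y Z + tensorF B J p Y X Z + tensorF B J p Z X Y with hPdef
    set Q : W → W → W → ℝ := fun X Y Z =>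
      tensorF B J p (J p X) Y Z + tensorF B J p Y X (J p Z) + tensorF B J p Z X (J p Y) with hQdef
    have hPsymm : ∀ X Y Z, P X Y Z = P X Z Y := fun X Y Z => by
      simp only [hPdef]
      rw [hs X Y Z]
      ring
    have hPQ1 : ∀ X Y Z, P (J p X) Y Z = -Q X Y Z := fun X Y Z => by
      simp only [hPdef, hQdef, he]
      ring
    have hQsymm : ∀ X Y Z, Q X Y Z = Q X Z Y := fun X Y Z => by
      simp only [hQdef]
      rw [hs _ Y Z]
      ring
    -- The only use of the vanishing Nijenhuis tensor: it allows `J` to be moved out of the second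
    -- argument. Together with `hPQ1`, every value of `P` then reduces to values of `P` and `Q` on
    -- horizontal vectors.
    have hPQ2 : ∀ X Y Z, P X (J p Y) Z = Q X Y Z := fun X Y Z => by
      simp only [hPdef, hQdef]
      linarith [he X Y Z, hN' X Y Z]
    have hQP : ∀ X Y Z, Q (J p X) Y Z = P X Y Z := fun X Y Z => by
      simp only [hPdef, hQdef, hsq, hneg, he]
      have h1 : ∀ X Y Z, tensorF B J p X Y (-Z) = -tensorF B J p X Y Z := fun X Y Z => by
        simp [tensorF_eq]
        ring
      simp only [h1]
      ring
    have hQ2 : ∀ X Y Z, Q X (J p Y) Z = -P X Y Z := fun X Y Z => by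
      rw [← hPQ2, hsq]
      simp only [hPdef, tensorF_eq, map_neg, _root_.neg_apply]
      ring
    have hP1 : ∀ X X' Y Z, P (X + X') Y Z = P X Y Z + P X' Y Z := fun X X' Y Z => by
      simp only [hPdef, hF1, hF2]
      ring
    have hP2 : ∀ X Y Y' Z, P X (Y + Y') Z = P X Y Z + P X Y' Z := fun X Y Y' Z => by
      simp only [hPdef, hF1, hF2, hF3]
      ring
    have hQ1 : ∀ X X' Y Z, Q (X + X') Y Z = Q X Y Z + Q X' Y Z := fun X X' Y Z => by
      simp only [hQdef, map_add, hF1, hF2]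
      ring
    have hQ2' : ∀ X Y Y' Z, Q X (Y + Y') Z = Q X Y Z + Q X Y' Z := fun X Y Y' Z => by
      simp only [hQdef, map_add, hF1, hF2, hF3]
      ring
    have hmid : ∀ X Z, (∀ Y, P X (hor Y) Z = 0) → (∀ Y, Q X (hor Y) Z = 0) →
        ∀ Y, P X Y Z = 0 ∧ Q X Y Z = 0 := by
      intro X Z h1 h2 Y
      obtain ⟨Y1, Y2, rfl⟩ := hspan Y
      rw [hP2, hQ2', hPQ2, hQ2, h1, h1, h2, h2]
      simp
    have hlow : ∀ X Y Z, P (hor X) Y Z = 0 ∧ Q (hor X) Y Z = 0 := by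
      intro X Y Z
      have h1 : ∀ Y Z, P (hor X) Y (hor Z) = 0 ∧ Q (hor X) Y (hor Z) = 0 := fun Y Z =>
        hmid _ _ (fun Y => hP X Y Z) (fun Y => hQ X Y Z) Y
      exact hmid _ _ (fun Y => by rw [hPsymm]; exact (h1 Z Y).1)
        (fun Y => by rw [hQsymm]; exact (h1 Z Y).2) Y
    have hall : ∀ X Y Z, P X Y Z = 0 := by
      intro X Y Z
      obtain ⟨X1, X2, rfl⟩ := hspan X
      rw [hP1, hPQ1, (hlow _ _ _).1, (hlow _ _ _).2]
      simp
    intro X Y Z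
    -- P(Y,Z,X) + P(Z,Y,X) = 2F(X,Y,Z), by the symmetry of F.
    have h1 := hall Y Z X
    have h2 := hall Z Y X
    simp only [hPdef] at h1 h2
    linarith [hs X Y Z]

end AntiHermitianNear

end Tachibana

/-- A family of evaluations of continuous linear maps on a finite-dimensional space is
differentiable only if the family of maps is. -/
theorem differentiableAt_clm_of_apply {D V F : Type*} [NormedAddCommGroup D] [NormedSpace ℝ D]
    [NormedAddCommGroup V] [NormedSpace ℝ V] [FiniteDimensional ℝ V]
    [NormedAddCommGroup F] [NormedSpace ℝ F] {f : D → V →L[ℝ] F} {x : D}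
    (h : ∀ v, DifferentiableAt ℝ (fun q => f q v) x) : DifferentiableAt ℝ f x := by
  let d := Module.finrank ℝ V
  have hd : d = Module.finrank ℝ (Fin d → ℝ) := (Module.finrank_fin_fun ℝ).symm
  let e₁ := ContinuousLinearEquiv.ofFinrankEq hd
  let e₂ := (e₁.arrowCongr (1 : F ≃L[ℝ] F)).trans (ContinuousLinearEquiv.piRing (Fin d))
  rw [← Function.id_comp f, ← e₂.symm_comp_self]
  exact e₂.symm.differentiable.differentiableAt.comp x
    (differentiableAt_pi.mpr fun i => h _)

/-! ### Horizontal and vertical frames; the auxiliary connection. -/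

section Frame

variable {E : Type*} [NormedAddCommGroup E] [NormedSpace ℝ E]

/-- `γ` is a smooth Riemannian metric on the open set `U`. -/
structure IsLocalMetric (γ : E → E →L[ℝ] E →L[ℝ] ℝ) (U : Set E) : Prop where
  isOpen : IsOpen U
  smooth : ContDiffOn ℝ ∞ γ U
  symm : ∀ x ∈ U, ∀ X Y, γ x X Y = γ x Y X
  pos : ∀ x ∈ U, ∀ X, X ≠ 0 → 0 < γ x X X

/-- The tangent vector `X^H + Z^V` at `p`. -/
noncomputable def frame (γ : E → E →L[ℝ] E →L[ℝ] ℝ) (p : E × E) (X Z : E) : E × E :=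
  (X, Z - christoffel γ p.1 p.2 X)

theorem frame_parts (γ : E → E →L[ℝ] E →L[ℝ] ℝ) (p U : E × E) :
    frame γ p U.1 (verPart γ p U) = U := by
  simp [frame, verPart]

@[simp] theorem verPart_frame (γ : E → E →L[ℝ] E →L[ℝ] ℝ) (p : E × E) (X Z : E) :
    verPart γ p (frame γ p X Z) = Z := by
  simp [frame, verPart]

@[simp] theorem frame_fst (γ : E → E →L[ℝ] E →L[ℝ] ℝ) (p : E × E) (X Z : E) :
    (frame γ p X Z).1 = X := rfl

theorem frame_add (γ : E → E →L[ℝ] E →L[ℝ] ℝ) (p : E × E) (X Z X' Z' : E) :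
    frame γ p X Z + frame γ p X' Z' = frame γ p (X + X') (Z + Z') := by
  simp only [frame, Prod.mk_add_mk, map_add]
  congr 1
  abel

theorem frame_sub (γ : E → E →L[ℝ] E →L[ℝ] ℝ) (p : E × E) (X Z X' Z' : E) :
    frame γ p X Z - frame γ p X' Z' = frame γ p (X - X') (Z - Z') := by
  simp only [frame, Prod.mk_sub_mk, map_sub]
  congr 1
  abel

theorem frame_eq_zero {γ : E → E →L[ℝ] E →L[ℝ] ℝ} {p : E × E} {X Z : E} :
    frame γ p X Z = 0 ↔ X = 0 ∧ Z = 0 := by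
  simp only [frame, Prod.mk_eq_zero]
  constructor
  · rintro ⟨rfl, h⟩
    simpa using h
  · rintro ⟨rfl, rfl⟩
    simp

theorem liftEndo_eq (A : EndoCoeffs) (γ : E → E →L[ℝ] E →L[ℝ] ℝ) (p U : E × E) :
    liftEndo A γ p U = frame γ p
      (A.a₄ (energy γ p) • U.1 + (A.b₄ (energy γ p) * γ p.1 p.2 U.1) • p.2
        - A.a₂ (energy γ p) • verPart γ p U
        - (A.b₂ (energy γ p) * γ p.1 p.2 (verPart γ p U)) • p.2)
      (A.a₁ (energy γ p) • U.1 + (A.b₁ (energy γ p) * γ p.1 p.2 U.1) • p.2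
        + A.a₃ (energy γ p) • verPart γ p U
        + (A.b₃ (energy γ p) * γ p.1 p.2 (verPart γ p U)) • p.2) := by
  simp [liftEndo, ofParts, frame, horPart, smul_smul]

theorem liftEndo_frame (A : EndoCoeffs) (γ : E → E →L[ℝ] E →L[ℝ] ℝ) (p : E × E) (X Z : E) :
    liftEndo A γ p (frame γ p X Z) = frame γ p
      (A.a₄ (energy γ p) • X + (A.b₄ (energy γ p) * γ p.1 p.2 X) • p.2
        - A.a₂ (energy γ p) • Z - (A.b₂ (energy γ p) * γ p.1 p.2 Z) • p.2)
      (A.a₁ (energy γ p) • X + (A.b₁ (energy γ p) * γ p.1 p.2 X) • p.2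
        + A.a₃ (energy γ p) • Z + (A.b₃ (energy γ p) * γ p.1 p.2 Z) • p.2) := by
  rw [liftEndo_eq, verPart_frame, frame_fst]

theorem liftMetric_eq (C : MetricCoeffs) (γ : E → E →L[ℝ] E →L[ℝ] ℝ) (p U V : E × E) :
    liftMetric C γ p U V
      = C.c₁ (energy γ p) * γ p.1 U.1 V.1
        + C.d₁ (energy γ p) * (γ p.1 p.2 U.1 * γ p.1 p.2 V.1)
        + (C.c₂ (energy γ p) * γ p.1 (verPart γ p U) (verPart γ p V)
          + C.d₂ (energy γ p) * (γ p.1 p.2 (verPart γ p U) * γ p.1 p.2 (verPart γ p V)))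
        + (C.c₃ (energy γ p) * (γ p.1 (verPart γ p U) V.1 + γ p.1 U.1 (verPart γ p V))
          + C.d₃ (energy γ p) * (γ p.1 p.2 (verPart γ p U) * γ p.1 p.2 V.1
            + γ p.1 p.2 U.1 * γ p.1 p.2 (verPart γ p V))) := by
  simp [liftMetric, horPart]
  ring

theorem liftMetric_frame (C : MetricCoeffs) (γ : E → E →L[ℝ] E →L[ℝ] ℝ) (p : E × E)
    (X Z X' Z' : E) :
    liftMetric C γ p (frame γ p X Z) (frame γ p X' Z')
      = C.c₁ (energy γ p) * γ p.1 X X' + C.d₁ (energy γ p) * (γ p.1 p.2 X * γ p.1 p.2 X')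
        + (C.c₂ (energy γ p) * γ p.1 Z Z' + C.d₂ (energy γ p) * (γ p.1 p.2 Z * γ p.1 p.2 Z'))
        + (C.c₃ (energy γ p) * (γ p.1 Z X' + γ p.1 X Z')
          + C.d₃ (energy γ p) * (γ p.1 p.2 Z * γ p.1 p.2 X' + γ p.1 p.2 X * γ p.1 p.2 Z')) := by
  rw [liftMetric_eq]
  simp only [verPart_frame, frame_fst]

/-- The connection of the tangent bundle for which horizontal and vertical lifts are parallel
along horizontal directions, and horizontal and vertical lifts of fixed vectors are parallel
along the fibres: its value on constant vector fields. -/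
noncomputable def liftConn (γ : E → E →L[ℝ] E →L[ℝ] ℝ) (p W V : E × E) : E × E :=
  frame γ p (christoffel γ p.1 W.1 V.1)
    (fderiv ℝ (christoffel γ) p.1 W.1 p.2 V.1 + christoffel γ p.1 W.2 V.1
      + christoffel γ p.1 W.1 (verPart γ p V))

namespace IsLocalMetric

variable {γ : E → E →L[ℝ] E →L[ℝ] ℝ} {U : Set E} {p : E × E}

theorem mem_nhds (h : IsLocalMetric γ U) {x : E} (hx : x ∈ U) : U ∈ 𝓝 x := h.isOpen.mem_nhds hx

theorem contDiffAt (h : IsLocalMetric γ U) {x : E} (hx : x ∈ U) : ContDiffAt ℝ ∞ γ x :=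
  h.smooth.contDiffAt (h.mem_nhds hx)

theorem differentiableAt (h : IsLocalMetric γ U) {x : E} (hx : x ∈ U) :
    DifferentiableAt ℝ γ x := (h.contDiffAt hx).differentiableAt (by simp)

theorem eventually_symm (h : IsLocalMetric γ U) {x : E} (hx : x ∈ U) :
    ∀ᶠ q in 𝓝 x, ∀ X Y, γ q X Y = γ q Y X :=
  (Filter.eventually_of_mem (h.mem_nhds hx)) h.symm

theorem nonneg (h : IsLocalMetric γ U) {x : E} (hx : x ∈ U) (X : E) : 0 ≤ γ x X X := by
  by_cases hX : X = 0
  · simp [hX]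
  · exact (h.pos x hx X hX).le

theorem eq_zero (h : IsLocalMetric γ U) {x : E} (hx : x ∈ U) {X : E} (h0 : γ x X X = 0) :
    X = 0 := by
  by_contra hX
  exact (h.pos x hx X hX).ne' h0

theorem christoffel_comm (h : IsLocalMetric γ U) {x : E} (hx : x ∈ U) (X Y : E) :
    christoffel γ x X Y = christoffel γ x Y X :=
  christoffel_symm (h.differentiableAt hx) (h.eventually_symm hx) X Y

theorem eventually_christoffel_comm (h : IsLocalMetric γ U) {x : E} (hx : x ∈ U) :
    ∀ᶠ q in 𝓝 x, ∀ X Y, christoffel γ q X Y = christoffel γ q Y X :=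
  (Filter.eventually_of_mem (h.mem_nhds hx)) fun _ hq => h.christoffel_comm hq

theorem eventually_base_mem (h : IsLocalMetric γ U) (hp : p.1 ∈ U) : ∀ᶠ q in 𝓝 p, q.1 ∈ U :=
  continuous_fst.continuousAt.preimage_mem_nhds (h.mem_nhds hp)

theorem hasDerivAt_metric (h : IsLocalMetric γ U) (hp : p.1 ∈ U) (W : E × E) :
    HasDerivAt (fun s : ℝ => γ (p + s • W).1) (fderiv ℝ γ p.1 W.1) 0 := by
  have := ((h.differentiableAt hp).hasFDerivAt).hasLineDerivAt W.1
  simpa [HasLineDerivAt] using this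

theorem hasDerivAt_fibre (p W : E × E) : HasDerivAt (fun s : ℝ => (p + s • W).2) W.2 0 := by
  have := ((hasDerivAt_id (0 : ℝ)).smul_const W.2).const_add p.2
  simpa using this

theorem energy_nonneg (h : IsLocalMetric γ U) (hp : p.1 ∈ U) : 0 ≤ energy γ p :=
  div_nonneg (h.nonneg hp _) (by norm_num)

variable [FiniteDimensional ℝ E]

theorem invertible (h : IsLocalMetric γ U) {x : E} (hx : x ∈ U) : (γ x).IsInvertible :=
  isInvertible_of_nondegenerate fun X hX => h.eq_zero hx (hX X)

theorem differentiableAt_christoffel (h : IsLocalMetric γ U) {x : E} (hx : x ∈ U) :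
    DifferentiableAt ℝ (christoffel γ) x :=
  have := FiniteDimensional.complete ℝ E
  AntiKaehler.differentiableAt_christoffel ((h.contDiffAt hx).of_le ENat.LEInfty.out)
    (h.invertible hx)

theorem fderiv_eq (h : IsLocalMetric γ U) {x : E} (hx : x ∈ U) (X Y Z : E) :
    fderiv ℝ γ x X Y Z = γ x (christoffel γ x X Y) Z + γ x Y (christoffel γ x X Z) :=
  fderiv_metric (h.differentiableAt hx) (h.invertible hx) (h.eventually_symm hx) X Y Z

theorem curvature_skew (h : IsLocalMetric γ U) {x : E} (hx : x ∈ U) (X Y Z : E) :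
    γ x (curvature γ x X Y Z) Z = 0 :=
  have := FiniteDimensional.complete ℝ E
  AntiKaehler.curvature_skew ((h.contDiffAt hx).of_le ENat.LEInfty.out)
    (Filter.eventually_of_mem (h.mem_nhds hx) fun _ hq => h.invertible hq)
    (h.eventually_symm hx) X Y Z

theorem curvature_bianchi (h : IsLocalMetric γ U) {x : E} (hx : x ∈ U) (X Y Z : E) :
    curvature γ x X Y Z + curvature γ x Y Z X + curvature γ x Z X Y = 0 :=
  AntiKaehler.curvature_bianchi (h.differentiableAt_christoffel hx)
    (h.eventually_christoffel_comm hx) X Y Z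

theorem liftConn_torsion (h : IsLocalMetric γ U) (hp : p.1 ∈ U) (V W : E × E) :
    liftConn γ p W V - liftConn γ p V W = frame γ p 0 (curvature γ p.1 W.1 V.1 p.2) := by
  have h1 := h.christoffel_comm hp
  have h2 := fderiv_christoffel_symm (h.differentiableAt_christoffel hp)
    (h.eventually_christoffel_comm hp)
  have h3 : ∀ V, verPart γ p V = V.2 + christoffel γ p.1 p.2 V.1 := fun V => rfl
  simp only [liftConn, frame_sub, h3, curvature, map_add]
  rw [h1 V.1 W.1, h2 W.1 p.2, h2 V.1 p.2, h1 W.2 V.1, h1 V.2 W.1, h1 p.2 V.1, h1 p.2 W.1]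
  congr 1 <;> abel

section Derivatives

theorem hasDerivAt_christoffel (h : IsLocalMetric γ U) (hp : p.1 ∈ U) (W : E × E) :
    HasDerivAt (fun s : ℝ => christoffel γ (p + s • W).1) (fderiv ℝ (christoffel γ) p.1 W.1) 0 := by
  have := ((h.differentiableAt_christoffel hp).hasFDerivAt).hasLineDerivAt W.1
  simpa [HasLineDerivAt] using this

/-- The derivative of `γ(ζ, ξ)` in terms of covariant derivatives. -/
theorem hasDerivAt_inner (h : IsLocalMetric γ U) (hp : p.1 ∈ U) {W : E × E} {ζ ξ : ℝ → E}
    {ζ' ξ' : E} (hζ : HasDerivAt ζ ζ' 0) (hξ : HasDerivAt ξ ξ' 0) :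
    HasDerivAt (fun s : ℝ => γ (p + s • W).1 (ζ s) (ξ s))
      (γ p.1 (ζ' + christoffel γ p.1 W.1 (ζ 0)) (ξ 0)
        + γ p.1 (ζ 0) (ξ' + christoffel γ p.1 W.1 (ξ 0))) 0 := by
  have := ((h.hasDerivAt_metric hp W).clm_apply hζ).clm_apply hξ
  refine this.congr_deriv ?_
  simp [h.fderiv_eq hp]
  ring

theorem hasDerivAt_verPart (h : IsLocalMetric γ U) (hp : p.1 ∈ U) (W V : E × E) :
    HasDerivAt (fun s : ℝ => verPart γ (p + s • W) V)
      (fderiv ℝ (christoffel γ) p.1 W.1 p.2 V.1 + christoffel γ p.1 W.2 V.1) 0 := by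
  have := (((h.hasDerivAt_christoffel hp W).clm_apply (hasDerivAt_fibre p W)).clm_apply
    (hasDerivAt_const 0 V.1)).const_add V.2
  refine this.congr_deriv ?_
  simp

theorem hasDerivAt_energy (h : IsLocalMetric γ U) (hp : p.1 ∈ U) (W : E × E) :
    HasDerivAt (fun s : ℝ => energy γ (p + s • W)) (γ p.1 p.2 (verPart γ p W)) 0 := by
  have := (h.hasDerivAt_inner hp (W := W) (hasDerivAt_fibre p W) (hasDerivAt_fibre p W)).div_const 2
  refine this.congr_deriv ?_
  have h1 : verPart γ p W = W.2 + christoffel γ p.1 p.2 W.1 := rfl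
  simp only [zero_smul, add_zero, h1, h.christoffel_comm hp p.2, h.symm _ hp _ p.2]
  ring

/-- The coefficients are differentiable only within [0, ∞), but the energy stays in that set near
`p`. The composite thus has a two-sided derivative even on the zero section, where t = 0. -/
theorem hasDerivAt_coeff (h : IsLocalMetric γ U) (hp : p.1 ∈ U) (W : E × E) {f : ℝ → ℝ}
    (hf : ContDiffOn ℝ ∞ f (Set.Ici 0)) :
    HasDerivAt (fun s : ℝ => f (energy γ (p + s • W)))
      (dt f (energy γ p) * γ p.1 p.2 (verPart γ p W)) 0 := by
  have h1 : HasDerivWithinAt f (dt f (energy γ p)) (Set.Ici 0) (energy γ (p + (0 : ℝ) • W)) := by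
    rw [zero_smul, add_zero]
    exact ((hf.differentiableOn (by simp)) _ (h.energy_nonneg hp)).hasDerivWithinAt
  have hev : ∀ᶠ s : ℝ in 𝓝 0, energy γ (p + s • W) ∈ Set.Ici 0 := by
    have hc : Tendsto (fun s : ℝ => p + s • W) (𝓝 0) (𝓝 p) := by
      have : Continuous fun s : ℝ => p + s • W := by fun_prop
      simpa using this.tendsto 0
    exact (hc.eventually (h.eventually_base_mem hp)).mono fun s hs => h.energy_nonneg hs
  have h2 := h1.hasFDerivWithinAt.comp_hasFDerivAt (0 : ℝ)
    (h.hasDerivAt_energy hp W).hasFDerivAt hev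
  have h3 := h2.hasDerivAt
  refine h3.congr_deriv ?_
  simp [mul_comm]

end Derivatives

end IsLocalMetric

end Frame

/-! ### Derivatives of the lifted tensors and the Nijenhuis tensor on horizontal vectors. -/

section Lifts

variable {E : Type*} [NormedAddCommGroup E] [NormedSpace ℝ E]

namespace IsLocalMetric

variable {γ : E → E →L[ℝ] E →L[ℝ] ℝ} {U : Set E} {p : E × E}

section Differentiability

theorem differentiableAt_base (h : IsLocalMetric γ U) (hp : p.1 ∈ U) :
    DifferentiableAt ℝ (fun q : E × E => γ q.1) p :=
  DifferentiableAt.comp p (h.differentiableAt hp) differentiableAt_fst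

theorem differentiableAt_energy (h : IsLocalMetric γ U) (hp : p.1 ∈ U) :
    DifferentiableAt ℝ (energy γ) p :=
  (((h.differentiableAt_base hp).clm_apply differentiableAt_snd).clm_apply
    differentiableAt_snd).mul_const (2⁻¹ : ℝ)

theorem differentiableAt_coeff (h : IsLocalMetric γ U) (hp : p.1 ∈ U) {f : ℝ → ℝ}
    (hf : ContDiffOn ℝ ∞ f (Set.Ici 0)) : DifferentiableAt ℝ (fun q => f (energy γ q)) p := by
  have h1 := ((hf.differentiableOn (by simp)) _ (h.energy_nonneg hp)).hasFDerivWithinAt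
  have hev : ∀ᶠ q in 𝓝 p, energy γ q ∈ Set.Ici 0 :=
    (h.eventually_base_mem hp).mono fun q hq => h.energy_nonneg hq
  exact (h1.comp_hasFDerivAt p (h.differentiableAt_energy hp).hasFDerivAt hev).differentiableAt

theorem differentiableAt_inner (h : IsLocalMetric γ U) (hp : p.1 ∈ U) {f k : E × E → E}
    (hf : DifferentiableAt ℝ f p) (hk : DifferentiableAt ℝ k p) :
    DifferentiableAt ℝ (fun q : E × E => γ q.1 (f q) (k q)) p :=
  ((h.differentiableAt_base hp).clm_apply hf).clm_apply hk

variable [FiniteDimensional ℝ E]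

theorem differentiableAt_christoffel_base (h : IsLocalMetric γ U) (hp : p.1 ∈ U) :
    DifferentiableAt ℝ (fun q : E × E => christoffel γ q.1) p :=
  DifferentiableAt.comp (g := christoffel γ) (f := Prod.fst) p (h.differentiableAt_christoffel hp)
    differentiableAt_fst

theorem differentiableAt_verPart (h : IsLocalMetric γ U) (hp : p.1 ∈ U) (V : E × E) :
    DifferentiableAt ℝ (fun q => verPart γ q V) p :=
  (((h.differentiableAt_christoffel_base hp).clm_apply differentiableAt_snd).clm_apply
    (differentiableAt_const V.1)).const_add V.2

theorem differentiableAt_liftEndo (h : IsLocalMetric γ U) (hp : p.1 ∈ U) (A : EndoCoeffs) :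
    DifferentiableAt ℝ (liftEndo A γ) p := by
  refine differentiableAt_clm_of_apply fun V => ?_
  simp only [liftEndo_eq, frame]
  have hv := h.differentiableAt_verPart hp V
  have hy : DifferentiableAt ℝ (fun q : E × E => q.2) p := differentiableAt_snd
  have hc : DifferentiableAt ℝ (fun _ : E × E => V.1) p := differentiableAt_const _
  have e1 := h.differentiableAt_inner hp hy hc
  have e2 := h.differentiableAt_inner hp hy hv
  have hX : DifferentiableAt ℝ (fun q : E × E => A.a₄ (energy γ q) • V.1
      + (A.b₄ (energy γ q) * γ q.1 q.2 V.1) • q.2 - A.a₂ (energy γ q) • verPart γ q V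
      - (A.b₂ (energy γ q) * γ q.1 q.2 (verPart γ q V)) • q.2) p :=
    ((((h.differentiableAt_coeff hp A.smooth_a₄).smul hc).add
      (((h.differentiableAt_coeff hp A.smooth_b₄).mul e1).smul hy)).sub
      ((h.differentiableAt_coeff hp A.smooth_a₂).smul hv)).sub
      (((h.differentiableAt_coeff hp A.smooth_b₂).mul e2).smul hy)
  have hZ : DifferentiableAt ℝ (fun q : E × E => A.a₁ (energy γ q) • V.1
      + (A.b₁ (energy γ q) * γ q.1 q.2 V.1) • q.2 + A.a₃ (energy γ q) • verPart γ q V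
      + (A.b₃ (energy γ q) * γ q.1 q.2 (verPart γ q V)) • q.2) p :=
    ((((h.differentiableAt_coeff hp A.smooth_a₁).smul hc).add
      (((h.differentiableAt_coeff hp A.smooth_b₁).mul e1).smul hy)).add
      ((h.differentiableAt_coeff hp A.smooth_a₃).smul hv)).add
      (((h.differentiableAt_coeff hp A.smooth_b₃).mul e2).smul hy)
  exact hX.prodMk (hZ.sub
    (((h.differentiableAt_christoffel_base hp).clm_apply hy).clm_apply hX))

theorem differentiableAt_liftMetric (h : IsLocalMetric γ U) (hp : p.1 ∈ U) (C : MetricCoeffs) :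
    DifferentiableAt ℝ (liftMetric C γ) p := by
  refine differentiableAt_clm_of_apply fun V => differentiableAt_clm_of_apply fun V' => ?_
  simp only [liftMetric_eq]
  have hv := h.differentiableAt_verPart hp V
  have hv' := h.differentiableAt_verPart hp V'
  have hy : DifferentiableAt ℝ (fun q : E × E => q.2) p := differentiableAt_snd
  have hc : DifferentiableAt ℝ (fun _ : E × E => V.1) p := differentiableAt_const _
  have hc' : DifferentiableAt ℝ (fun _ : E × E => V'.1) p := differentiableAt_const _
  have i := fun {f k : E × E → E} => h.differentiableAt_inner hp (f := f) (k := k)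
  exact (((h.differentiableAt_coeff hp C.smooth_c₁).mul (i hc hc')).add
    ((h.differentiableAt_coeff hp C.smooth_d₁).mul ((i hy hc).mul (i hy hc')))).add
    (((h.differentiableAt_coeff hp C.smooth_c₂).mul (i hv hv')).add
      ((h.differentiableAt_coeff hp C.smooth_d₂).mul ((i hy hv).mul (i hy hv')))) |>.add
    (((h.differentiableAt_coeff hp C.smooth_c₃).mul ((i hv hc').add (i hc hv'))).add
      ((h.differentiableAt_coeff hp C.smooth_d₃).mul
        (((i hy hv).mul (i hy hc')).add ((i hy hc).mul (i hy hv')))))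

end Differentiability

variable [FiniteDimensional ℝ E]

/-- Differentiability being known, the derivative may be read off along the line s ↦ p + sW. -/
theorem fderiv_liftEndo_apply (h : IsLocalMetric γ U) (hp : p.1 ∈ U) (A : EndoCoeffs)
    (W V : E × E) {d : E × E}
    (hd : HasDerivAt (fun s : ℝ => liftEndo A γ (p + s • W) V) d 0) :
    fderiv ℝ (liftEndo A γ) p W V = d := by
  have h1 := ((h.differentiableAt_liftEndo hp A).hasFDerivAt.clm_apply
    (hasFDerivAt_const V p)).hasLineDerivAt W
  have h2 := HasDerivAt.unique h1 hd
  simpa using h2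

theorem fderiv_liftMetric_apply (h : IsLocalMetric γ U) (hp : p.1 ∈ U) (C : MetricCoeffs)
    (W V V' : E × E) {d : ℝ}
    (hd : HasDerivAt (fun s : ℝ => liftMetric C γ (p + s • W) V V') d 0) :
    fderiv ℝ (liftMetric C γ) p W V V' = d := by
  have h1 := (((h.differentiableAt_liftMetric hp C).hasFDerivAt.clm_apply
    (hasFDerivAt_const V p)).clm_apply (hasFDerivAt_const V' p)).hasLineDerivAt W
  have h2 := HasDerivAt.unique h1 hd
  simpa using h2

/-- The derivative of `J` on horizontal vectors: a vertical derivative and a connection term. -/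
theorem fderiv_liftEndo (h : IsLocalMetric γ U) (hp : p.1 ∈ U) (A : EndoCoeffs) (W : E × E)
    (ξ : E) :
    fderiv ℝ (liftEndo A γ) p W (frame γ p ξ 0)
      = frame γ p
          ((dt A.a₄ (energy γ p) * γ p.1 p.2 (verPart γ p W)) • ξ
            + (dt A.b₄ (energy γ p) * γ p.1 p.2 (verPart γ p W) * γ p.1 p.2 ξ
              + A.b₄ (energy γ p) * γ p.1 (verPart γ p W) ξ) • p.2
            + (A.b₄ (energy γ p) * γ p.1 p.2 ξ) • verPart γ p W)
          ((dt A.a₁ (energy γ p) * γ p.1 p.2 (verPart γ p W)) • ξ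
            + (dt A.b₁ (energy γ p) * γ p.1 p.2 (verPart γ p W) * γ p.1 p.2 ξ
              + A.b₁ (energy γ p) * γ p.1 (verPart γ p W) ξ) • p.2
            + (A.b₁ (energy γ p) * γ p.1 p.2 ξ) • verPart γ p W)
        + liftEndo A γ p (liftConn γ p W (frame γ p ξ 0))
        - liftConn γ p W (liftEndo A γ p (frame γ p ξ 0)) := by
  apply h.fderiv_liftEndo_apply hp
  set V := frame γ p ξ 0 with hV
  have hc := fun {f} (hf : ContDiffOn ℝ ∞ f (Set.Ici 0)) => h.hasDerivAt_coeff hp W hf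
  have hv := h.hasDerivAt_verPart hp W V
  have hy := hasDerivAt_fibre p W
  have hk := hasDerivAt_const (0 : ℝ) V.1
  have e1 := h.hasDerivAt_inner hp (W := W) hy hk
  have e2 := h.hasDerivAt_inner hp (W := W) hy hv
  have hv0 : verPart γ p V = 0 := by rw [hV, verPart_frame]
  have hV1 : V.1 = ξ := rfl
  -- Writing the fibre component of `W` through its vertical part turns coordinate derivatives into
  -- covariant ones.
  have hw : W.2 = verPart γ p W - christoffel γ p.1 W.1 p.2 := by
    have h1 : verPart γ p W = W.2 + christoffel γ p.1 p.2 W.1 := rfl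
    rw [h1, h.christoffel_comm hp p.2]
    abel
  simp only [zero_smul, add_zero, hv0, hV1, map_zero, zero_add] at hv e1 e2
  have hX := ((((hc A.smooth_a₄).smul hk).add (((hc A.smooth_b₄).mul e1).smul hy)).sub
      ((hc A.smooth_a₂).smul hv)).sub (((hc A.smooth_b₂).mul e2).smul hy)
  have hZ := ((((hc A.smooth_a₁).smul hk).add (((hc A.smooth_b₁).mul e1).smul hy)).add
      ((hc A.smooth_a₃).smul hv)).add (((hc A.smooth_b₃).mul e2).smul hy)
  have hJ := hX.prodMk (hZ.sub (((h.hasDerivAt_christoffel hp W).clm_apply hy).clm_apply hX))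
  have hfun : (fun s : ℝ => liftEndo A γ (p + s • W) V) = _ :=
    funext fun s => liftEndo_eq A γ (p + s • W) V
  rw [hfun]
  refine hJ.congr_deriv ?_
  clear hJ hX hZ hfun e1 e2 hv hk hy hc
  simp only [liftConn, hV, liftEndo_frame, frame_add, frame_sub, verPart_frame, frame_fst]
  simp only [Pi.add_apply, Pi.sub_apply, Pi.mul_apply, Pi.smul_apply', zero_smul,
    map_zero, smul_zero, add_zero, sub_zero, zero_add, mul_zero, verPart_frame]
  simp only [frame]
  refine Prod.ext ?_ ?_
  · simp only [hw, map_add, map_sub, map_smul, _root_.add_apply, _root_.sub_apply]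
    module
  · simp only [hw, map_add, map_sub, map_smul, _root_.add_apply, _root_.sub_apply]
    module

/-- The derivative of `G` on horizontal vectors: a vertical derivative and connection terms. -/
theorem fderiv_liftMetric (h : IsLocalMetric γ U) (hp : p.1 ∈ U) (C : MetricCoeffs) (W : E × E)
    (ξ η : E) :
    fderiv ℝ (liftMetric C γ) p W (frame γ p ξ 0) (frame γ p η 0)
      = dt C.c₁ (energy γ p) * γ p.1 p.2 (verPart γ p W) * γ p.1 ξ η
        + dt C.d₁ (energy γ p) * γ p.1 p.2 (verPart γ p W) * (γ p.1 p.2 ξ * γ p.1 p.2 η)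
        + C.d₁ (energy γ p) * (γ p.1 (verPart γ p W) ξ * γ p.1 p.2 η
          + γ p.1 p.2 ξ * γ p.1 (verPart γ p W) η)
        + liftMetric C γ p (liftConn γ p W (frame γ p ξ 0)) (frame γ p η 0)
        + liftMetric C γ p (frame γ p ξ 0) (liftConn γ p W (frame γ p η 0)) := by
  apply h.fderiv_liftMetric_apply hp
  set V := frame γ p ξ 0 with hV
  set V' := frame γ p η 0 with hV'
  have hc := fun {f} (hf : ContDiffOn ℝ ∞ f (Set.Ici 0)) => h.hasDerivAt_coeff hp W hf
  have hv := h.hasDerivAt_verPart hp W V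
  have hv' := h.hasDerivAt_verPart hp W V'
  have hy := hasDerivAt_fibre p W
  have hk := hasDerivAt_const (0 : ℝ) V.1
  have hk' := hasDerivAt_const (0 : ℝ) V'.1
  have i := fun {ζ ξ : ℝ → E} {ζ' ξ' : E} (h1 : HasDerivAt ζ ζ' 0) (h2 : HasDerivAt ξ ξ' 0) =>
    h.hasDerivAt_inner hp (W := W) h1 h2
  have hw : W.2 = verPart γ p W - christoffel γ p.1 W.1 p.2 := by
    have h1 : verPart γ p W = W.2 + christoffel γ p.1 p.2 W.1 := rfl
    rw [h1, h.christoffel_comm hp p.2]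
    abel
  have hG := ((((hc C.smooth_c₁).mul (i hk hk')).add
    ((hc C.smooth_d₁).mul ((i hy hk).mul (i hy hk')))).add
    (((hc C.smooth_c₂).mul (i hv hv')).add
      ((hc C.smooth_d₂).mul ((i hy hv).mul (i hy hv'))))).add
    (((hc C.smooth_c₃).mul ((i hv hk').add (i hk hv'))).add
      ((hc C.smooth_d₃).mul (((i hy hv).mul (i hy hk')).add ((i hy hk).mul (i hy hv')))))
  have hfun : (fun s : ℝ => liftMetric C γ (p + s • W) V V') = _ :=
    funext fun s => liftMetric_eq C γ (p + s • W) V V'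
  rw [hfun]
  refine hG.congr_deriv ?_
  clear hG i hfun hv hk hy hc hv' hk'
  have hs := h.symm _ hp
  simp only [liftConn, hV, hV', liftMetric_frame, verPart_frame, frame_fst]
  simp only [Pi.add_apply, Pi.mul_apply, zero_smul,
    map_zero, add_zero, zero_add, mul_zero, zero_mul, verPart_frame, _root_.zero_apply]
  simp only [hw, map_add, map_sub, _root_.add_apply, _root_.sub_apply]
  ring

/-- The Nijenhuis tensor of `J` on horizontal vectors. -/
theorem nijenhuis_horizontal (h : IsLocalMetric γ U) (hp : p.1 ∈ U) (A : EndoCoeffs)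
    (hsq : ∀ V, liftEndo A γ p (liftEndo A γ p V) = -V) {t a₁ a₂ a₃ a₄ b₁ b₂ b₃ b₄ : ℝ}
    (ht : t = energy γ p) (ha₁ : a₁ = A.a₁ t) (ha₂ : a₂ = A.a₂ t) (ha₃ : a₃ = A.a₃ t)
    (ha₄ : a₄ = A.a₄ t) (hb₁ : b₁ = A.b₁ t) (hb₂ : b₂ = A.b₂ t) (hb₃ : b₃ = A.b₃ t)
    (hb₄ : b₄ = A.b₄ t) {X Y X' Y' Q r : E}
    (hX : X' = a₄ • X + (b₄ * γ p.1 p.2 X) • p.2) (hY : Y' = a₄ • Y + (b₄ * γ p.1 p.2 Y) • p.2)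
    (hQ : Q = γ p.1 p.2 X • Y - γ p.1 p.2 Y • X)
    (hr : r = curvature γ p.1 X' Y p.2 + curvature γ p.1 X Y' p.2) :
    nijenhuis (liftEndo A γ) p (frame γ p X 0) (frame γ p Y 0)
      = frame γ p
        (((a₁ + 2 * t * b₁) * dt A.a₄ t - a₁ * b₄) • Q - a₂ • r - (b₂ * γ p.1 p.2 r) • p.2)
        (((a₁ + 2 * t * b₁) * dt A.a₁ t - a₁ * b₁) • Q - curvature γ p.1 X' Y' p.2
          + curvature γ p.1 X Y p.2 + a₃ • r + (b₃ * γ p.1 p.2 r) • p.2) := by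
  have hJX : liftEndo A γ p (frame γ p X 0)
      = frame γ p X' (a₁ • X + (b₁ * γ p.1 p.2 X) • p.2) := by
    rw [liftEndo_frame, hX]
    simp [ha₁, hb₁, ha₄, hb₄, ht]
  have hJY : liftEndo A γ p (frame γ p Y 0)
      = frame γ p Y' (a₁ • Y + (b₁ * γ p.1 p.2 Y) • p.2) := by
    rw [liftEndo_frame, hY]
    simp [ha₁, hb₁, ha₄, hb₄, ht]
  have hs := h.symm _ hp
  have ht2 : γ p.1 p.2 p.2 = 2 * t := by rw [ht, energy]; ring
  have htor := fun V W => h.liftConn_torsion hp (p := p) V W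
  rw [nijenhuis_eq (h.differentiableAt_liftEndo hp A)]
  simp only [h.fderiv_liftEndo hp]
  simp only [verPart_frame, map_zero, _root_.zero_apply, mul_zero, zero_mul, zero_smul, add_zero,
    smul_zero]
  have hz : frame γ p 0 0 = 0 := frame_eq_zero.2 ⟨rfl, rfl⟩
  simp only [hz, zero_add, map_sub, hsq]
  set J := liftEndo A γ p
  set Ω := liftConn γ p
  set x := frame γ p X 0
  set y := frame γ p Y 0
  -- Regrouping so that the connection occurs only in differences Ω(V, W) - Ω(W, V), that is,
  -- through its torsion.
  have key : ∀ v₁ v₂ : E × E, v₁ + J (Ω (J x) y) - Ω (J x) (J y)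
      - (v₂ + J (Ω (J y) x) - Ω (J y) (J x)) + (-Ω y x - J (Ω y (J x))) - (-Ω x y - J (Ω x (J y)))
      = (v₁ - v₂) + (J (Ω (J x) y - Ω y (J x)) + J (Ω x (J y) - Ω (J y) x))
        - (Ω (J x) (J y) - Ω (J y) (J x)) + (Ω x y - Ω y x) := by
    intro v₁ v₂
    simp only [map_sub]
    abel
  rw [key, htor, htor, htor, htor, ← map_add, frame_add, hJX, hJY]
  simp only [verPart_frame, frame_fst, J, x, y, liftEndo_frame, frame_add, frame_sub, add_zero]
  rw [← hr, ← ht, ← ha₁, ← ha₂, ← ha₃, ← hb₁, ← hb₂, ← hb₃, ← hb₄]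
  simp only [map_add, map_smul, _root_.add_apply, _root_.smul_apply, ht2, smul_eq_mul, map_zero,
    smul_zero, mul_zero, zero_smul, zero_add, hQ, hs Y X]
  congr 1 <;> module

end IsLocalMetric

end Lifts

/-! ### Tachibana's operator on horizontal vectors. -/

section Lifts

variable {E : Type*} [NormedAddCommGroup E] [NormedSpace ℝ E]

theorem IsLocalMetric.liftMetric_symm {γ : E → E →L[ℝ] E →L[ℝ] ℝ} {U : Set E} {p : E × E}
    (h : IsLocalMetric γ U) (hp : p.1 ∈ U) (C : MetricCoeffs) (V W : E × E) :
    liftMetric C γ p V W = liftMetric C γ p W V := by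
  have hs := h.symm _ hp
  rw [liftMetric_eq, liftMetric_eq, hs W.1, hs (verPart γ p W), hs (verPart γ p W) V.1,
    hs W.1 (verPart γ p V)]
  ring

/-- Tachibana's operator of `(G, J)` on horizontal vectors over a space form. -/
theorem IsLocalMetric.tachibana_horizontal [FiniteDimensional ℝ E]
    {γ : E → E →L[ℝ] E →L[ℝ] ℝ} {U : Set E} {p : E × E} (h : IsLocalMetric γ U) (hp : p.1 ∈ U)
    (A : EndoCoeffs) (C : MetricCoeffs) {c : ℝ}
    (hc : ∀ X Y Z, curvature γ p.1 X Y Z = c • (γ p.1 Y Z • X - γ p.1 X Z • Y))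
    {B' : E × E → E × E →L[ℝ] E × E →L[ℝ] ℝ}
    (htwin : ∀ V W, B' p V W = liftMetric C γ p (liftEndo A γ p V) W)
    (hsymm : ∀ V W, B' p V W = B' p W V)
    (hB' : ∀ X Y Z, fderiv ℝ B' p (frame γ p X 0) (frame γ p Y 0) (frame γ p Z 0)
      = B' p (liftConn γ p (frame γ p X 0) (frame γ p Y 0)) (frame γ p Z 0)
        + B' p (frame γ p Y 0) (liftConn γ p (frame γ p X 0) (frame γ p Z 0)))
    {e₃ f₃ : ℝ} (he : ∀ X Z, B' p (frame γ p 0 X) (frame γ p Z 0)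
      = e₃ * γ p.1 X Z + f₃ * (γ p.1 p.2 X * γ p.1 p.2 Z))
    {t a₁ a₄ b₁ b₄ : ℝ}
    (ht : t = energy γ p) (ha₁ : a₁ = A.a₁ t)
    (ha₄ : a₄ = A.a₄ t) (hb₁ : b₁ = A.b₁ t) (hb₄ : b₄ = A.b₄ t) (X Y Z : E) :
    tachibana (liftMetric C γ) B' (liftEndo A γ) p (frame γ p X 0) (frame γ p Y 0) (frame γ p Z 0)
      = ((a₁ + 2 * t * b₁) * dt C.c₁ t - 2 * c * (a₄ + 2 * t * b₄) * C.c₃ t + 2 * c * e₃)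
          * (γ p.1 p.2 X * γ p.1 Y Z)
        + (a₁ * C.d₁ t + c * a₄ * C.c₃ t - c * e₃)
          * (γ p.1 X Y * γ p.1 p.2 Z + γ p.1 X Z * γ p.1 p.2 Y)
        + ((a₁ + 2 * t * b₁) * dt C.d₁ t + 2 * b₁ * C.d₁ t + 2 * c * b₄ * C.c₃ t)
          * (γ p.1 p.2 X * γ p.1 p.2 Y * γ p.1 p.2 Z) := by
  have hs := h.symm _ hp
  have ht2 : γ p.1 p.2 p.2 = 2 * t := by rw [ht, energy]; ring
  have htor := fun V W => h.liftConn_torsion hp (p := p) V W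
  have hGs := h.liftMetric_symm hp C
  obtain ⟨X', hX⟩ : ∃ X', X' = a₄ • X + (b₄ * γ p.1 p.2 X) • p.2 := ⟨_, rfl⟩
  have hJX : liftEndo A γ p (frame γ p X 0)
      = frame γ p X' (a₁ • X + (b₁ * γ p.1 p.2 X) • p.2) := by
    rw [liftEndo_frame, hX]
    simp [ha₁, hb₁, ha₄, hb₄, ht]
  have hz : frame γ p 0 0 = 0 := frame_eq_zero.2 ⟨rfl, rfl⟩
  simp only [tachibana, h.fderiv_liftEndo hp, h.fderiv_liftMetric hp, hB']
  simp only [verPart_frame, map_zero, _root_.zero_apply, mul_zero, zero_mul, zero_smul, add_zero,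
    smul_zero, hz, zero_add, map_sub, _root_.sub_apply, ← htwin,
    hGs (frame γ p Y 0), hsymm (frame γ p Y 0)]
  -- The connection terms pair up into four torsions: two measured by the twin `B'`, between
  -- horizontal vectors, and two measured by the metric, between a horizontal vector and JX^H.
  have T1 := congrArg (fun V => B' p V (frame γ p Z 0)) (htor (frame γ p Y 0) (frame γ p X 0))
  have T2 := congrArg (fun V => B' p V (frame γ p Y 0)) (htor (frame γ p Z 0) (frame γ p X 0))
  have T3 := congrArg (fun V => liftMetric C γ p V (frame γ p Z 0))
    (htor (frame γ p Y 0) (liftEndo A γ p (frame γ p X 0)))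
  have T4 := congrArg (fun V => liftMetric C γ p V (frame γ p Y 0))
    (htor (frame γ p Z 0) (liftEndo A γ p (frame γ p X 0)))
  simp only [map_sub, _root_.sub_apply, he, frame_fst, hc, liftMetric_frame, hJX, map_zero,
    _root_.zero_apply, mul_zero, add_zero, zero_add] at T1 T2 T3 T4
  simp only [hJX, verPart_frame]
  simp only [hX, map_add, map_sub, map_smul, _root_.add_apply, _root_.sub_apply,
    _root_.smul_apply, smul_eq_mul, ht2, hs X p.2, hs Y p.2, hs Z p.2, hs Z Y,
    ← ht] at T1 T2 T3 T4 ⊢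
  linear_combination T3 + T4 - T1 - T2

end Lifts

/-! ### Algebraic relations between the coefficients. -/

/-- Two functions continuous on `[0, ∞)` that agree on `(0, ∞)` agree on `[0, ∞)`. -/
theorem eq_of_eq_on_pos {f k : ℝ → ℝ} (hf : ContinuousOn f (Set.Ici 0))
    (hk : ContinuousOn k (Set.Ici 0)) (h : ∀ t, 0 < t → f t = k t) (t : ℝ) (ht : 0 ≤ t) :
    f t = k t := by
  have hcl : Set.Ici (0 : ℝ) ⊆ closure (Set.Ioi 0) := by rw [closure_Ioi]
  exact Set.EqOn.of_subset_closure (s := Set.Ioi (0 : ℝ)) (t := Set.Ici 0)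
    (fun t ht => h t ht) hf hk Set.Ioi_subset_Ici_self hcl ht

theorem continuousOn_dt {f : ℝ → ℝ} (hf : ContDiffOn ℝ ∞ f (Set.Ici 0)) :
    ContinuousOn (dt f) (Set.Ici 0) :=
  hf.continuousOn_derivWithin (uniqueDiffOn_Ici 0) (by simp)

theorem dt_congr {f k : ℝ → ℝ} (h : ∀ t, 0 ≤ t → f t = k t) {t : ℝ} (ht : 0 ≤ t) :
    dt f t = dt k t :=
  derivWithin_congr (fun s hs => h s hs) (h t ht)

theorem hasDerivWithinAt_dt {f : ℝ → ℝ} (hf : ContDiffOn ℝ ∞ f (Set.Ici 0)) {t : ℝ}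
    (ht : 0 ≤ t) : HasDerivWithinAt f (dt f t) (Set.Ici 0) t :=
  (hf.differentiableOn (by simp) t ht).hasDerivWithinAt

theorem dt_eq {f : ℝ → ℝ} {t d : ℝ} (hf : HasDerivWithinAt f d (Set.Ici 0) t) (ht : 0 ≤ t) :
    dt f t = d :=
  hf.derivWithin (uniqueDiffOn_Ici 0 t ht)

/-- The relations between the coefficients of an almost anti-Hermitian structure. -/
structure CoeffRelations (A : EndoCoeffs) (C : MetricCoeffs) : Prop where
  a₄ : ∀ t, 0 ≤ t → A.a₄ t = -A.a₃ t
  b₄ : ∀ t, 0 ≤ t → A.b₄ t = -A.b₃ t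
  a₁₂ : ∀ t, 0 ≤ t → A.a₁ t * A.a₂ t = 1 + A.a₃ t ^ 2
  b₁₂ : ∀ t, 0 ≤ t → A.a₁ t * A.b₂ t + A.a₂ t * A.b₁ t + 2 * t * (A.b₁ t * A.b₂ t)
    = 2 * (A.a₃ t * A.b₃ t) + 2 * t * A.b₃ t ^ 2
  c₂ : ∀ t, 0 ≤ t → A.a₁ t * C.c₂ t = 2 * (A.a₃ t * C.c₃ t) - A.a₂ t * C.c₁ t
  d₂ : ∀ t, 0 ≤ t → A.a₁ t * C.d₂ t + A.b₁ t * C.c₂ t + 2 * t * (A.b₁ t * C.d₂ t)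
    = 2 * (A.a₃ t * C.d₃ t + A.b₃ t * C.c₃ t + 2 * t * (A.b₃ t * C.d₃ t))
      - (A.a₂ t * C.d₁ t + A.b₂ t * C.c₁ t + 2 * t * (A.b₂ t * C.d₁ t))

/-- The pointwise condition that `(G, J)` is an almost anti-Hermitian structure. -/
def AntiHermitianAt {E : Type*} [NormedAddCommGroup E] [NormedSpace ℝ E] (A : EndoCoeffs)
    (C : MetricCoeffs) (γ : E → E →L[ℝ] E →L[ℝ] ℝ) (p : E × E) : Prop :=
  (∀ U, liftEndo A γ p (liftEndo A γ p U) = -U) ∧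
    (∀ U, (∀ V, liftMetric C γ p U V = 0) → U = 0) ∧
    (∀ U V, liftMetric C γ p (liftEndo A γ p U) (liftEndo A γ p V) = -liftMetric C γ p U V)

section

variable {E : Type*} [NormedAddCommGroup E] [NormedSpace ℝ E]
  {γ : E → E →L[ℝ] E →L[ℝ] ℝ} {U : Set E} {x : E}

theorem IsLocalMetric.exists_orthogonal (h : IsLocalMetric γ U) (hx : x ∈ U)
    (hE : 1 < Module.finrank ℝ E) {t : ℝ} (ht : 0 < t) :
    ∃ y ξ, energy γ (x, y) = t ∧ γ x y ξ = 0 ∧ y ≠ 0 ∧ ξ ≠ 0 := by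
  have : Nontrivial E := Module.nontrivial_of_finrank_pos (R := ℝ) (by omega)
  obtain ⟨v, hv⟩ := exists_ne (0 : E)
  obtain ⟨w, hw⟩ := exists_linearIndependent_pair_of_one_lt_finrank hE hv
  have hpos := h.pos x hx v hv
  have hs : 0 < 2 * t / γ x v v := by positivity
  refine ⟨√(2 * t / γ x v v) • v, w - (γ x v w / γ x v v) • v, ?_, ?_, ?_, ?_⟩
  · simp only [energy, map_smul, _root_.smul_apply, smul_eq_mul]
    rw [← mul_assoc, Real.mul_self_sqrt hs.le]
    field_simp
  · simp only [map_smul, _root_.smul_apply, smul_eq_mul, map_sub]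
    field_simp
    ring
  · exact smul_ne_zero (Real.sqrt_pos.2 hs).ne' hv
  · intro h0
    have := LinearIndependent.pair_iff.1 hw (-(γ x v w / γ x v v)) 1
      (by rw [← h0]; module)
    exact one_ne_zero this.2

/-- The fibre over a single point attains every t ≥ 0. For t > 0 the structure preserves the planes
spanned by the two lifts of ξ orthogonal to y, and of y itself, and the relations are those of a 2 ×
2 anti-Hermitian block. The value t = 0 follows by continuity. -/
theorem IsLocalMetric.coeffRelations (h : IsLocalMetric γ U) (hx : x ∈ U)
    (hE : 1 < Module.finrank ℝ E) {A : EndoCoeffs} {C : MetricCoeffs}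
    (hAH : ∀ y, AntiHermitianAt A C γ (x, y)) : CoeffRelations A C := by
  have key : ∀ t, 0 < t → (A.a₄ t = -A.a₃ t ∧ A.a₁ t * A.a₂ t = 1 + A.a₃ t ^ 2
      ∧ A.a₁ t * C.c₂ t = 2 * (A.a₃ t * C.c₃ t) - A.a₂ t * C.c₁ t) ∧
      (A.a₄ t + 2 * t * A.b₄ t = -(A.a₃ t + 2 * t * A.b₃ t)
      ∧ (A.a₁ t + 2 * t * A.b₁ t) * (A.a₂ t + 2 * t * A.b₂ t)
        = 1 + (A.a₃ t + 2 * t * A.b₃ t) ^ 2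
      ∧ (A.a₁ t + 2 * t * A.b₁ t) * (C.c₂ t + 2 * t * C.d₂ t)
        = 2 * ((A.a₃ t + 2 * t * A.b₃ t) * (C.c₃ t + 2 * t * C.d₃ t))
          - (A.a₂ t + 2 * t * A.b₂ t) * (C.c₁ t + 2 * t * C.d₁ t)) := by
    intro t ht
    obtain ⟨y, ξ, hen, horth, hy, hξ⟩ := h.exists_orthogonal hx hE ht
    have hyy : γ x y y = 2 * t := by
      have : γ x y y / 2 = t := hen
      linarith
    have hξξ := (h.pos x hx ξ hξ).ne'
    obtain ⟨hsq, -, hG⟩ := hAH y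
    -- One block computation for both directions: with e = ξ the parameters are a_i, c_i; with e = y
    -- they are a_i + 2t b_i, c_i + 2t d_i.
    have abstract : ∀ (e : E) (a₁ a₂ a₃ a₄ c₁ c₂ c₃ : ℝ), e ≠ 0 → γ x e e ≠ 0 →
        (∀ u v : ℝ, liftEndo A γ (x, y) (frame γ (x, y) (u • e) (v • e))
          = frame γ (x, y) ((a₄ * u - a₂ * v) • e) ((a₁ * u + a₃ * v) • e)) →
        (∀ u v u' v' : ℝ, liftMetric C γ (x, y) (frame γ (x, y) (u • e) (v • e))
          (frame γ (x, y) (u' • e) (v' • e))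
          = (c₁ * (u * u') + c₂ * (v * v') + c₃ * (v * u' + u * v')) * γ x e e) →
        a₄ = -a₃ ∧ a₁ * a₂ = 1 + a₃ ^ 2 ∧ a₁ * c₂ = 2 * (a₃ * c₃) - a₂ * c₁ := by
      intro e a₁ a₂ a₃ a₄ c₁ c₂ c₃ he hee hJ hM
      have h1 := hsq (frame γ (x, y) ((1 : ℝ) • e) ((0 : ℝ) • e))
      have h2 := hsq (frame γ (x, y) ((0 : ℝ) • e) ((1 : ℝ) • e))
      have h3 := hG (frame γ (x, y) ((1 : ℝ) • e) ((0 : ℝ) • e))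
        (frame γ (x, y) ((0 : ℝ) • e) ((1 : ℝ) • e))
      have h4 := hG (frame γ (x, y) ((1 : ℝ) • e) ((0 : ℝ) • e))
        (frame γ (x, y) ((1 : ℝ) • e) ((0 : ℝ) • e))
      have hinj : ∀ u v u' v' : ℝ, frame γ (x, y) (u • e) (v • e)
          = -frame γ (x, y) (u' • e) (v' • e) → u = -u' ∧ v = -v' := by
        intro u v u' v' h0
        rw [eq_neg_iff_add_eq_zero, frame_add, frame_eq_zero, ← add_smul, ← add_smul,
          smul_eq_zero_iff_left he, smul_eq_zero_iff_left he] at h0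
        exact ⟨by linarith [h0.1], by linarith [h0.2]⟩
      rw [hJ, hJ] at h1 h2
      obtain ⟨p1, p2⟩ := hinj _ _ _ _ h1
      obtain ⟨q1, q2⟩ := hinj _ _ _ _ h2
      rw [hJ, hJ, hM, hM, ← neg_mul] at h3
      have r3 := mul_right_cancel₀ hee h3
      rw [hJ, hM, hM, ← neg_mul] at h4
      have r4 := mul_right_cancel₀ hee h4
      -- If a₁ were zero, J² = -1 would give a₄² = -1.
      have ha4 : a₄ = -a₃ := by
        have s1 : a₁ * (a₄ + a₃) = 0 := by linear_combination p2
        rcases mul_eq_zero.1 s1 with h0 | h0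
        · rw [h0] at p1
          nlinarith
        · linarith
      subst ha4
      have s2 : a₁ * a₂ = 1 + a₃ ^ 2 := by linear_combination -p1
      refine ⟨rfl, s2, ?_⟩
      have ha1 : a₁ ≠ 0 := by
        rintro rfl
        nlinarith
      have s5 : a₁ * (a₁ * c₂ - (2 * (a₃ * c₃) - a₂ * c₁)) = 0 := by
        linear_combination r4 + c₁ * s2
      rcases mul_eq_zero.1 s5 with h0 | h0
      · exact absurd h0 ha1
      · linarith
    constructor
    · refine abstract ξ _ _ _ _ _ _ _ hξ hξξ (fun u v => ?_) (fun u v u' v' => ?_)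
      · rw [liftEndo_frame, hen]
        simp only [map_smul, horth, smul_zero, mul_zero, zero_smul, add_zero, sub_zero, smul_smul,
          ← sub_smul, ← add_smul]
      · rw [liftMetric_frame, hen]
        simp only [map_smul, _root_.smul_apply, horth, smul_eq_mul]
        ring
    · have hyy' : γ x y y ≠ 0 := by rw [hyy]; positivity
      refine abstract y _ _ _ _ _ _ _ hy hyy' (fun u v => ?_) (fun u v u' v' => ?_)
      · rw [liftEndo_frame, hen]
        simp only [map_smul, hyy, smul_eq_mul]
        congr 1 <;> module
      · rw [liftMetric_frame, hen]
        simp only [map_smul, _root_.smul_apply, smul_eq_mul, hyy]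
        ring
  have k1 := A.smooth_a₁.continuousOn
  have k2 := A.smooth_a₂.continuousOn
  have k3 := A.smooth_a₃.continuousOn
  have k4 := A.smooth_a₄.continuousOn
  have l1 := A.smooth_b₁.continuousOn
  have l2 := A.smooth_b₂.continuousOn
  have l3 := A.smooth_b₃.continuousOn
  have l4 := A.smooth_b₄.continuousOn
  have m1 := C.smooth_c₁.continuousOn
  have m2 := C.smooth_c₂.continuousOn
  have m3 := C.smooth_c₃.continuousOn
  have n1 := C.smooth_d₁.continuousOn
  have n2 := C.smooth_d₂.continuousOn
  have n3 := C.smooth_d₃.continuousOn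
  refine ⟨?_, ?_, ?_, ?_, ?_, ?_⟩
  · exact eq_of_eq_on_pos (by fun_prop) (by fun_prop) fun t ht => (key t ht).1.1
  · refine eq_of_eq_on_pos (by fun_prop) (by fun_prop) fun t ht => ?_
    obtain ⟨⟨e1, e2, e3⟩, f1, f2, f3⟩ := key t ht
    have : 2 * t * (A.b₄ t + A.b₃ t) = 0 := by linear_combination f1 - e1
    rcases mul_eq_zero.1 this with h0 | h0 <;> linarith
  · exact eq_of_eq_on_pos (by fun_prop) (by fun_prop) fun t ht => (key t ht).1.2.1
  · refine eq_of_eq_on_pos (by fun_prop) (by fun_prop) fun t ht => ?_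
    obtain ⟨⟨e1, e2, e3⟩, f1, f2, f3⟩ := key t ht
    -- The difference of the two block relations is 2t times the desired one.
    refine mul_left_cancel₀ (by positivity : 2 * t ≠ 0) ?_
    linear_combination f2 - e2
  · exact eq_of_eq_on_pos (by fun_prop) (by fun_prop) fun t ht => (key t ht).1.2.2
  · refine eq_of_eq_on_pos (by fun_prop) (by fun_prop) fun t ht => ?_
    obtain ⟨⟨e1, e2, e3⟩, f1, f2, f3⟩ := key t ht
    refine mul_left_cancel₀ (by positivity : 2 * t ≠ 0) ?_
    linear_combination f3 - e3

namespace CoeffRelations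

variable {A : EndoCoeffs} {C : MetricCoeffs} {t : ℝ}

theorem a₁_ne (h : CoeffRelations A C) (ht : 0 ≤ t) : A.a₁ t ≠ 0 := by
  intro h0
  have := h.a₁₂ t ht
  rw [h0] at this
  nlinarith

theorem ab₁₂ (h : CoeffRelations A C) (ht : 0 ≤ t) : (A.a₁ t + 2 * t * A.b₁ t) * (A.a₂ t + 2 * t * A.b₂ t)
    = 1 + (A.a₃ t + 2 * t * A.b₃ t) ^ 2 := by
  linear_combination h.a₁₂ t ht + 2 * t * h.b₁₂ t ht

theorem ab₁_ne (h : CoeffRelations A C) (ht : 0 ≤ t) : A.a₁ t + 2 * t * A.b₁ t ≠ 0 := by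
  intro h0
  have := h.ab₁₂ ht
  rw [h0] at this
  nlinarith

end CoeffRelations

end

/-- The twin metric `G(J·, ·)` of a general natural anti-Hermitian structure. -/
def twinCoeffs (A : EndoCoeffs) (C : MetricCoeffs) : MetricCoeffs where
  c₁ := fun t => A.a₄ t * C.c₁ t + A.a₁ t * C.c₃ t
  c₂ := fun t => A.a₃ t * C.c₂ t - A.a₂ t * C.c₃ t
  c₃ := fun t => A.a₃ t * C.c₃ t - A.a₂ t * C.c₁ t
  d₁ := fun t => A.b₄ t * C.c₁ t + (A.a₄ t + 2 * t * A.b₄ t) * C.d₁ t + A.b₁ t * C.c₃ t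
    + (A.a₁ t + 2 * t * A.b₁ t) * C.d₃ t
  d₂ := fun t => A.b₃ t * C.c₂ t + (A.a₃ t + 2 * t * A.b₃ t) * C.d₂ t - A.b₂ t * C.c₃ t
    - (A.a₂ t + 2 * t * A.b₂ t) * C.d₃ t
  d₃ := fun t => A.b₃ t * C.c₃ t + (A.a₃ t + 2 * t * A.b₃ t) * C.d₃ t - A.b₂ t * C.c₁ t
    - (A.a₂ t + 2 * t * A.b₂ t) * C.d₁ t
  smooth_c₁ := (A.smooth_a₄.mul C.smooth_c₁).add (A.smooth_a₁.mul C.smooth_c₃)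
  smooth_c₂ := (A.smooth_a₃.mul C.smooth_c₂).sub (A.smooth_a₂.mul C.smooth_c₃)
  smooth_c₃ := (A.smooth_a₃.mul C.smooth_c₃).sub (A.smooth_a₂.mul C.smooth_c₁)
  smooth_d₁ := (((A.smooth_b₄.mul C.smooth_c₁).add ((A.smooth_a₄.add
    ((contDiffOn_const.mul contDiffOn_id).mul A.smooth_b₄)).mul C.smooth_d₁)).add
    (A.smooth_b₁.mul C.smooth_c₃)).add ((A.smooth_a₁.add
    ((contDiffOn_const.mul contDiffOn_id).mul A.smooth_b₁)).mul C.smooth_d₃)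
  smooth_d₂ := (((A.smooth_b₃.mul C.smooth_c₂).add ((A.smooth_a₃.add
    ((contDiffOn_const.mul contDiffOn_id).mul A.smooth_b₃)).mul C.smooth_d₂)).sub
    (A.smooth_b₂.mul C.smooth_c₃)).sub ((A.smooth_a₂.add
    ((contDiffOn_const.mul contDiffOn_id).mul A.smooth_b₂)).mul C.smooth_d₃)
  smooth_d₃ := (((A.smooth_b₃.mul C.smooth_c₃).add ((A.smooth_a₃.add
    ((contDiffOn_const.mul contDiffOn_id).mul A.smooth_b₃)).mul C.smooth_d₃)).sub
    (A.smooth_b₂.mul C.smooth_c₁)).sub ((A.smooth_a₂.add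
    ((contDiffOn_const.mul contDiffOn_id).mul A.smooth_b₂)).mul C.smooth_d₁)

section

variable {E : Type*} [NormedAddCommGroup E] [NormedSpace ℝ E]
  {γ : E → E →L[ℝ] E →L[ℝ] ℝ} {U : Set E} {p : E × E} {A : EndoCoeffs} {C : MetricCoeffs}

/-- The relations for c₂ and d₂ say that G(J·,·) has the same mixed coefficients in both orders,
hence is again a symmetric natural lift. -/
theorem IsLocalMetric.liftMetric_twin (h : IsLocalMetric γ U) (hp : p.1 ∈ U)
    (hr : CoeffRelations A C) (V W : E × E) :
    liftMetric (twinCoeffs A C) γ p V W = liftMetric C γ p (liftEndo A γ p V) W := by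
  have ht := h.energy_nonneg hp
  have ht2 : γ p.1 p.2 p.2 = 2 * energy γ p := by rw [energy]; ring
  rw [← frame_parts γ p V, ← frame_parts γ p W, liftEndo_frame, liftMetric_frame,
    liftMetric_frame]
  simp only [twinCoeffs, map_add, map_sub, map_smul, _root_.add_apply, _root_.sub_apply,
    _root_.smul_apply, smul_eq_mul, ht2, hr.a₄ _ ht, hr.b₄ _ ht]
  linear_combination (-γ p.1 V.1 (verPart γ p W)) * hr.c₂ _ ht
    - (γ p.1 p.2 V.1 * γ p.1 p.2 (verPart γ p W)) * hr.d₂ _ ht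

theorem IsLocalMetric.exists_frame_add (h : IsLocalMetric γ U) (hp : p.1 ∈ U)
    (hr : CoeffRelations A C) (V : E × E) :
    ∃ X Y, V = frame γ p X 0 + liftEndo A γ p (frame γ p Y 0) := by
  have ht := h.energy_nonneg hp
  have ht2 : γ p.1 p.2 p.2 = 2 * energy γ p := by rw [energy]; ring
  set t := energy γ p with htdef
  have h1 := hr.a₁_ne ht
  have h2 := hr.ab₁_ne ht
  set ζ := verPart γ p V with hζ
  -- The Sherman–Morrison inverse of the rank-one perturbation Y ↦ a₁Y + b₁g(y,Y)y, which is the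
  -- vertical part of JY^H.
  set Y := (A.a₁ t)⁻¹ • ζ - (A.b₁ t * γ p.1 p.2 ζ / (A.a₁ t * (A.a₁ t + 2 * t * A.b₁ t))) • p.2
    with hY
  have hYζ : A.a₁ t • Y + (A.b₁ t * γ p.1 p.2 Y) • p.2 = ζ := by
    have h3 : γ p.1 p.2 Y = γ p.1 p.2 ζ / (A.a₁ t + 2 * t * A.b₁ t) := by
      rw [hY, map_sub, map_smul, map_smul, ht2, smul_eq_mul, smul_eq_mul]
      obtain ⟨D, hD⟩ : ∃ D, D = A.a₁ t + 2 * t * A.b₁ t := ⟨_, rfl⟩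
      rw [← hD] at h2 ⊢
      field_simp
      linear_combination γ p.1 p.2 ζ * hD
    rw [h3, hY, smul_sub, smul_smul, smul_smul, mul_inv_cancel₀ h1, one_smul]
    have : A.a₁ t * (A.b₁ t * γ p.1 p.2 ζ / (A.a₁ t * (A.a₁ t + 2 * t * A.b₁ t)))
        = A.b₁ t * (γ p.1 p.2 ζ / (A.a₁ t + 2 * t * A.b₁ t)) := by
      field_simp
    rw [this, sub_add_cancel]
  refine ⟨V.1 - (A.a₄ t • Y + (A.b₄ t * γ p.1 p.2 Y) • p.2), Y, ?_⟩
  rw [liftEndo_frame, frame_add, ← htdef]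
  simp only [map_zero, mul_zero, smul_zero, zero_smul, sub_zero, add_zero, sub_add_cancel, zero_add]
  rw [hYζ, hζ, frame_parts]

variable [FiniteDimensional ℝ E]

theorem IsLocalMetric.antiHermitianNear (h : IsLocalMetric γ U) (hp : p.1 ∈ U)
    (hAH : ∀ x ∈ U, ∀ y, AntiHermitianAt A C γ (x, y)) :
    AntiHermitianNear (liftMetric C γ) (liftEndo A γ) p where
  diff_metric := h.differentiableAt_liftMetric hp C
  diff_endo := h.differentiableAt_liftEndo hp A
  invertible := isInvertible_of_nondegenerate (hAH p.1 hp p.2).2.1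
  symm := (h.eventually_base_mem hp).mono fun _ hq => h.liftMetric_symm hq C
  sq := (h.eventually_base_mem hp).mono fun q hq => (hAH q.1 hq q.2).1
  adj := (h.eventually_base_mem hp).mono fun q hq V W => by
    have := (hAH q.1 hq q.2).2.2 V (liftEndo A γ q W)
    rw [(hAH q.1 hq q.2).1 W, map_neg] at this
    linarith

/-- `γ` has constant curvature `c` on `U`. -/
def ConstantCurvatureOn (γ : E → E →L[ℝ] E →L[ℝ] ℝ) (U : Set E) (c : ℝ) : Prop :=
  ∀ x ∈ U, ∀ X Y Z, curvature γ x X Y Z = c • (γ x Y Z • X - γ x X Z • Y)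

/-- The equations for `a₁'` and `a₃'` equivalent to the vanishing of the Nijenhuis tensor over a
space form of curvature `c`. -/
def NijenhuisEqs (A : EndoCoeffs) (c t : ℝ) : Prop :=
  (A.a₁ t + 2 * t * A.b₁ t) * dt A.a₁ t - A.a₁ t * A.b₁ t
      = c * (1 - A.a₃ t ^ 2 - 2 * A.a₃ t * (A.a₃ t + 2 * t * A.b₃ t)) ∧
    (A.a₁ t + 2 * t * A.b₁ t) * dt A.a₃ t - A.a₁ t * A.b₃ t
      = -c * A.a₂ t * (2 * A.a₃ t + 2 * t * A.b₃ t)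

theorem CoeffRelations.dt_a₄ {A : EndoCoeffs} {C : MetricCoeffs} (h : CoeffRelations A C) {t : ℝ}
    (ht : 0 ≤ t) : dt A.a₄ t = -dt A.a₃ t := by
  rw [dt_congr h.a₄ ht]
  exact derivWithin.fun_neg

theorem IsLocalMetric.nijenhuis_eq_zero (h : IsLocalMetric γ U) (hp : p.1 ∈ U)
    (hAH : ∀ x ∈ U, ∀ y, AntiHermitianAt A C γ (x, y)) (hr : CoeffRelations A C) {c : ℝ}
    (hc : ConstantCurvatureOn γ U c) (hN : NijenhuisEqs A c (energy γ p)) (V W : E × E) :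
    nijenhuis (liftEndo A γ) p V W = 0 := by
  have ht := h.energy_nonneg hp
  have ht2 : γ p.1 p.2 p.2 = 2 * energy γ p := by rw [energy]; ring
  have hs := h.symm _ hp
  refine (h.antiHermitianNear hp hAH).nijenhuis_eq_zero (h.exists_frame_add hp hr)
    (fun X Y => ?_) V W
  rw [h.nijenhuis_horizontal hp A (hAH p.1 hp p.2).1 rfl rfl rfl rfl rfl rfl rfl rfl rfl rfl rfl
    rfl rfl, frame_eq_zero]
  set t := energy γ p
  obtain ⟨e1, e2⟩ := hN
  simp only [hc _ hp, hr.a₄ t ht, hr.b₄ t ht, hr.dt_a₄ ht, map_add, map_sub, map_smul,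
    _root_.add_apply, _root_.smul_apply, smul_eq_mul, hs Y p.2, hs X p.2, ht2]
  have e1' := congrArg (fun s => s • (γ p.1 p.2 X • Y - γ p.1 p.2 Y • X)) e1
  have e2' := congrArg (fun s => s • (γ p.1 p.2 X • Y - γ p.1 p.2 Y • X)) e2
  constructor
  · rw [← sub_eq_zero] at e2'
    rw [← neg_eq_zero, ← e2']
    module
  · rw [← sub_eq_zero] at e1'
    rw [← e1']
    module

/-- The curvature that an integrable `J` forces on the base. -/
noncomputable def forcedCurvature (A : EndoCoeffs) (t : ℝ) : ℝ :=
  let u := (A.a₁ t + 2 * t * A.b₁ t) * dt A.a₃ t - A.a₁ t * A.b₃ t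
  let v := (A.a₁ t + 2 * t * A.b₁ t) * dt A.a₁ t - A.a₁ t * A.b₁ t
  let m := A.a₂ t * (2 * A.a₃ t + 2 * t * A.b₃ t)
  let k := 1 - A.a₃ t ^ 2 - 2 * A.a₃ t * (A.a₃ t + 2 * t * A.b₃ t)
  (k * v - m * u) / (m ^ 2 + k ^ 2)

/-- The factor a₂ is nonzero because a₁a₂ = 1 + a₃². If the first square vanishes, then a₃ + 2t b₃ =
-a₃, and the second becomes (1 + a₃²)² > 0. -/
theorem CoeffRelations.aux_ne (hr : CoeffRelations A C) {t : ℝ} (ht : 0 ≤ t) :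
    (A.a₂ t * (2 * A.a₃ t + 2 * t * A.b₃ t)) ^ 2
      + (1 - A.a₃ t ^ 2 - 2 * A.a₃ t * (A.a₃ t + 2 * t * A.b₃ t)) ^ 2 ≠ 0 := by
  intro h0
  have h1 : A.a₂ t * (2 * A.a₃ t + 2 * t * A.b₃ t) = 0 := by nlinarith
  have h2 : 1 - A.a₃ t ^ 2 - 2 * A.a₃ t * (A.a₃ t + 2 * t * A.b₃ t) = 0 := by nlinarith
  have h3 := hr.a₁₂ t ht
  rcases mul_eq_zero.1 h1 with h4 | h4
  · rw [h4] at h3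
    nlinarith
  · have : A.a₃ t + 2 * t * A.b₃ t = -A.a₃ t := by linarith
    rw [this] at h2
    nlinarith

/-- Integrability at `(x, y)`, evaluated on `y^H` and on `ξ^H` with `ξ` orthogonal to `y`. -/
theorem IsLocalMetric.equations_of_nijenhuis (h : IsLocalMetric γ U) (hp : p.1 ∈ U)
    (hAH : ∀ x ∈ U, ∀ y, AntiHermitianAt A C γ (x, y)) (hr : CoeffRelations A C)
    (hN : ∀ V W, nijenhuis (liftEndo A γ) p V W = 0) {t : ℝ} (ht : t = energy γ p) {ξ : E}
    (hξ : γ p.1 p.2 ξ = 0) :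
    (A.a₂ t * (2 * A.a₃ t + 2 * t * A.b₃ t)) • curvature γ p.1 p.2 ξ p.2
        = (2 * t * ((A.a₁ t + 2 * t * A.b₁ t) * dt A.a₃ t - A.a₁ t * A.b₃ t)) • ξ ∧
      (1 - A.a₃ t ^ 2 - 2 * A.a₃ t * (A.a₃ t + 2 * t * A.b₃ t)) • curvature γ p.1 p.2 ξ p.2
        = -(2 * t * ((A.a₁ t + 2 * t * A.b₁ t) * dt A.a₁ t - A.a₁ t * A.b₁ t)) • ξ := by
  have ht0 : 0 ≤ t := ht ▸ h.energy_nonneg hp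
  have ht2 : γ p.1 p.2 p.2 = 2 * t := by rw [ht, energy]; ring
  have hs := h.symm _ hp
  -- By skew-symmetry R(y,ξ)y is orthogonal to y, which removes the b₂ and b₃ terms along y.
  have hρ : γ p.1 p.2 (curvature γ p.1 p.2 ξ p.2) = 0 := by
    rw [hs]
    exact h.curvature_skew hp _ _ _
  set ρ := curvature γ p.1 p.2 ξ p.2 with hρdef
  have hcurv : ∀ u v : ℝ, curvature γ p.1 (u • p.2) (v • ξ) p.2 = (u * v) • ρ := by
    intro u v
    simp only [hρdef, curvature, map_smul, _root_.smul_apply]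
    module
  have hX : (A.a₄ t + 2 * t * A.b₄ t) • p.2 = A.a₄ t • p.2 + (A.b₄ t * γ p.1 p.2 p.2) • p.2 := by
    rw [ht2]
    module
  have hY : A.a₄ t • ξ = A.a₄ t • ξ + (A.b₄ t * γ p.1 p.2 ξ) • p.2 := by
    rw [hξ]
    module
  have hr' : ((A.a₄ t + 2 * t * A.b₄ t) + A.a₄ t) • ρ
      = curvature γ p.1 ((A.a₄ t + 2 * t * A.b₄ t) • p.2) ξ p.2
        + curvature γ p.1 p.2 (A.a₄ t • ξ) p.2 := by
    have h1 := hcurv (A.a₄ t + 2 * t * A.b₄ t) 1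
    have h2 := hcurv 1 (A.a₄ t)
    rw [one_smul] at h1 h2
    rw [h1, h2]
    module
  have hQ : (2 * t) • ξ = γ p.1 p.2 p.2 • ξ - γ p.1 p.2 ξ • p.2 := by
    rw [hξ, ht2]
    module
  have key := h.nijenhuis_horizontal hp A (hAH p.1 hp p.2).1 ht rfl rfl rfl rfl rfl rfl rfl rfl
    hX hY hQ hr'
  rw [hN, eq_comm, frame_eq_zero] at key
  simp only [hcurv, map_smul, hρ, smul_zero, mul_zero, zero_smul, sub_zero, add_zero,
    hr.a₄ t ht0, hr.b₄ t ht0, hr.dt_a₄ ht0] at key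
  obtain ⟨k1, k2⟩ := key
  constructor
  · rw [← sub_eq_zero, ← k1]
    module
  · rw [← sub_eq_zero, ← k2]
    module

/-- The two equations m R(y,ξ)y = 2tuξ and k R(y,ξ)y = -2tvξ are combined with weights m and k; m² +
k² ≠ 0 allows division. -/
theorem IsLocalMetric.curvature_of_nijenhuis (h : IsLocalMetric γ U) (hp : p.1 ∈ U)
    (hAH : ∀ x ∈ U, ∀ y, AntiHermitianAt A C γ (x, y)) (hr : CoeffRelations A C)
    (hN : ∀ V W, nijenhuis (liftEndo A γ) p V W = 0) {t : ℝ} (ht : t = energy γ p) {ξ : E}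
    (hξ : γ p.1 p.2 ξ = 0) :
    curvature γ p.1 p.2 ξ p.2 = -(2 * t * forcedCurvature A t) • ξ := by
  have ht0 : 0 ≤ t := ht ▸ h.energy_nonneg hp
  obtain ⟨k1, k2⟩ := h.equations_of_nijenhuis hp hAH hr hN ht hξ
  have hne := hr.aux_ne ht0
  simp only [forcedCurvature]
  set m := A.a₂ t * (2 * A.a₃ t + 2 * t * A.b₃ t)
  set k := 1 - A.a₃ t ^ 2 - 2 * A.a₃ t * (A.a₃ t + 2 * t * A.b₃ t)
  set ρ := curvature γ p.1 p.2 ξ p.2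
  refine smul_right_injective E hne ?_
  have e1 : (m ^ 2 + k ^ 2) • ρ = m • (m • ρ) + k • (k • ρ) := by module
  simp only
  rw [e1, k1, k2, smul_smul, smul_smul, smul_smul, ← add_smul]
  congr 1
  field_simp
  ring

/-- Rescaling y to unit length, where t = 1/2, gives a factor depending neither on the point nor on
the chart. The component of Y orthogonal to y supplies ξ, and the values R(y,Y)y determine the
curvature tensor. -/
theorem IsLocalMetric.constantCurvatureOn (h : IsLocalMetric γ U)
    (hAH : ∀ x ∈ U, ∀ y, AntiHermitianAt A C γ (x, y)) (hr : CoeffRelations A C)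
    (hN : ∀ x ∈ U, ∀ y V W, nijenhuis (liftEndo A γ) (x, y) V W = 0) :
    ConstantCurvatureOn γ U (forcedCurvature A (1 / 2)) := by
  intro x hx
  refine eq_constantCurvature_of_sectional (b := fun u v => γ x u v) (R := curvature γ x)
    (fun u v w => by simp) (h.symm x hx) (fun X X' Y Z => ?_) (fun X Y Z Z' => ?_)
    curvature_antisymm (h.curvature_bianchi hx) (fun y Y => ?_)
  · simp only [curvature, map_add, _root_.add_apply]
    abel
  · simp only [curvature, map_add]
    abel
  · by_cases hy : y = 0
    · subst hy
      simp [curvature]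
    · have hpos := h.pos x hx y hy
      set s := √(γ x y y) with hsdef
      have hs : s ≠ 0 := (Real.sqrt_pos.2 hpos).ne'
      have hs2 : s * s = γ x y y := Real.mul_self_sqrt hpos.le
      set c := forcedCurvature A (1 / 2)
      have hen : 1 / 2 = energy γ (x, s⁻¹ • y) := by
        simp only [energy, map_smul, _root_.smul_apply, smul_eq_mul, ← hs2]
        field_simp
      have horth : γ x (s⁻¹ • y) (Y - (γ x y Y / γ x y y) • y) = 0 := by
        simp only [map_smul, _root_.smul_apply, smul_eq_mul, map_sub]
        field_simp
        ring
      have h1 := h.curvature_of_nijenhuis (p := (x, s⁻¹ • y)) hx hAH hr (hN x hx _) hen horth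
      have h2 : curvature γ x (s⁻¹ • y) (Y - (γ x y Y / γ x y y) • y) (s⁻¹ • y)
          = (s⁻¹ * s⁻¹) • curvature γ x y Y y := by
        simp only [curvature, map_smul, _root_.smul_apply, map_sub, _root_.sub_apply]
        module
      simp only [h2] at h1
      have h3 : curvature γ x y Y y = (s * s) • ((s⁻¹ * s⁻¹) • curvature γ x y Y y) := by
        rw [smul_smul]
        have : s * s * (s⁻¹ * s⁻¹) = 1 := by field_simp
        rw [this, one_smul]
      rw [h3, h1, hs2, smul_smul, smul_sub, smul_smul]
      have h4 : γ x y y * -(2 * (1 / 2) * c) * (γ x y Y / γ x y y) = -c * γ x y Y := by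
        field_simp
      rw [h4, h.symm x hx Y y]
      module

theorem IsLocalMetric.nijenhuisEqs (h : IsLocalMetric γ U) {x : E} (hx : x ∈ U)
    (hE : 1 < Module.finrank ℝ E)
    (hAH : ∀ x ∈ U, ∀ y, AntiHermitianAt A C γ (x, y)) (hr : CoeffRelations A C)
    (hN : ∀ y V W, nijenhuis (liftEndo A γ) (x, y) V W = 0) {c : ℝ}
    (hc : ConstantCurvatureOn γ U c) (t : ℝ) (ht : 0 ≤ t) : NijenhuisEqs A c t := by
  have key : ∀ t, 0 < t → NijenhuisEqs A c t := by
    intro t ht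
    obtain ⟨y, ξ, hen, horth, hy, hξ⟩ := h.exists_orthogonal hx hE ht
    obtain ⟨k1, k2⟩ := h.equations_of_nijenhuis (p := (x, y)) hx hAH hr (hN y) hen.symm horth
    have hyy : γ x y y = 2 * t := by
      have : γ x y y / 2 = t := hen
      linarith
    have hξy : γ x ξ y = 0 := by rw [h.symm x hx, horth]
    simp only [hc x hx, hξy, hyy, zero_smul, zero_sub, smul_smul, ← neg_smul] at k1 k2
    have l1 := smul_left_injective ℝ hξ k1
    have l2 := smul_left_injective ℝ hξ k2
    have h2t : 2 * t ≠ 0 := by positivity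
    constructor
    · refine mul_left_cancel₀ h2t ?_
      linear_combination l2
    · refine mul_left_cancel₀ h2t ?_
      linear_combination -l1
  have k1 := A.smooth_a₁.continuousOn
  have k2 := A.smooth_a₂.continuousOn
  have k3 := A.smooth_a₃.continuousOn
  have l1 := A.smooth_b₁.continuousOn
  have l3 := A.smooth_b₃.continuousOn
  have m1 := continuousOn_dt A.smooth_a₁
  have m3 := continuousOn_dt A.smooth_a₃
  exact ⟨eq_of_eq_on_pos (by fun_prop) (by fun_prop) (fun t ht => (key t ht).1) t ht,
    eq_of_eq_on_pos (by fun_prop) (by fun_prop) (fun t ht => (key t ht).2) t ht⟩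

end

/-- A solution of a homogeneous linear differential equation on `[0, ∞)` with nonzero initial
value vanishes nowhere. -/
theorem ne_zero_of_linear_ode {D f : ℝ → ℝ} (hf : ContinuousOn f (Set.Ici 0))
    (hD : ∀ t, 0 ≤ t → HasDerivWithinAt D (f t * D t) (Set.Ici 0) t) (h0 : D 0 ≠ 0) (t : ℝ)
    (ht : 0 ≤ t) : D t ≠ 0 := by
  -- Extending `f` by its value at 0 makes the primitive Φ differentiable on the whole line;
  -- D·exp(-Φ) is then constant on [0, ∞).
  have hfc : Continuous fun t => f (max t 0) :=
    hf.comp_continuous (by fun_prop) fun t => le_max_right t 0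
  set Φ : ℝ → ℝ := fun t => ∫ s in (0 : ℝ)..t, f (max s 0)
  have hΦ : ∀ t, HasDerivAt Φ (f (max t 0)) t := fun t =>
    intervalIntegral.integral_hasDerivAt_right (hfc.intervalIntegrable _ _)
      (hfc.stronglyMeasurableAtFilter _ _) hfc.continuousAt
  have hder : ∀ s, 0 ≤ s →
      HasDerivWithinAt (fun s => D s * Real.exp (-Φ s)) 0 (Set.Ici 0) s := by
    intro s hs
    refine ((hD s hs).mul (hΦ s).neg.exp.hasDerivWithinAt).congr_deriv ?_
    simp only [Pi.neg_apply, max_eq_left hs]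
    ring
  have hconst := constant_of_has_deriv_right_zero (f := fun s => D s * Real.exp (-Φ s))
    (a := 0) (b := t) (fun s hs => ((hder s hs.1).continuousWithinAt).mono Set.Icc_subset_Ici_self)
    (fun s hs => (hder s hs.1).mono (Set.Ici_subset_Ici.2 hs.1)) t ⟨ht, le_rfl⟩
  intro h1
  simp only [h1, zero_mul] at hconst
  exact mul_ne_zero h0 (Real.exp_ne_zero _) hconst.symm

/-! ### The denominators and the solved integrability equations. -/

section Scalar

variable {A : EndoCoeffs} {C : MetricCoeffs} {c : ℝ}

theorem CoeffRelations.dt_a₁₂ (hr : CoeffRelations A C) {t : ℝ} (ht : 0 ≤ t) :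
    dt A.a₁ t * A.a₂ t + A.a₁ t * dt A.a₂ t = 2 * A.a₃ t * dt A.a₃ t := by
  have h1 := dt_eq ((hasDerivWithinAt_dt A.smooth_a₁ ht).mul (hasDerivWithinAt_dt A.smooth_a₂ ht)) ht
  have h2 := dt_eq (((hasDerivWithinAt_dt A.smooth_a₃ ht).pow 2).const_add 1) ht
  have h3 : dt (A.a₁ * A.a₂) t = dt (fun x => 1 + (A.a₃ ^ 2) x) t :=
    dt_congr (fun s hs => hr.a₁₂ s hs) ht
  rw [h3, h2] at h1
  rw [← h1]
  norm_num

/-- `NijenhuisEqs` express a₁' and a₃' through the other coefficients; substituting them into D'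
yields a multiple of D. The sign of `c` plays no role. -/
theorem CoeffRelations.denom_ne (hr : CoeffRelations A C)
    (hN : ∀ t, 0 ≤ t → NijenhuisEqs A c t) (t : ℝ) (ht : 0 ≤ t) : denom A c t ≠ 0 := by
  have k1 := A.smooth_a₁.continuousOn
  have k3 := A.smooth_a₃.continuousOn
  have l1 := A.smooth_b₁.continuousOn
  have l3 := A.smooth_b₃.continuousOn
  refine ne_zero_of_linear_ode (f := fun t =>
    4 * (A.a₁ t * A.b₁ t - c * A.a₃ t * (2 * A.a₃ t + 2 * t * A.b₃ t))
      / (A.a₁ t * (A.a₁ t + 2 * t * A.b₁ t))) ?_ (fun t ht => ?_) ?_ t ht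
  · refine ContinuousOn.div (by fun_prop) (by fun_prop) fun t ht =>
      mul_ne_zero (hr.a₁_ne ht) (hr.ab₁_ne ht)
  · have h1 := hasDerivWithinAt_dt A.smooth_a₁ ht
    have h3 := hasDerivWithinAt_dt A.smooth_a₃ ht
    have hid := hasDerivWithinAt_id t (Set.Ici (0 : ℝ))
    have hD := (((h1.pow 4).add (((((h1.pow 2).const_mul 4).mul ((h3.pow 2).sub_const 1)).mul_const
      c).mul hid)).add (((((h3.pow 2).const_add 1).pow 2).const_mul 4).mul_const (c ^ 2) |>.mul
      (hid.pow 2)))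
    refine hD.congr_deriv ?_
    obtain ⟨e1, e3⟩ := hN t ht
    have e2 := hr.a₁₂ t ht
    have n1 := hr.a₁_ne ht
    have n2 := hr.ab₁_ne ht
    rw [div_mul_eq_mul_div, eq_div_iff (mul_ne_zero n1 n2), denom]
    simp only [Pi.pow_apply, id, Pi.mul_apply]
    push_cast
    linear_combination
      A.a₁ t * (4 * A.a₁ t ^ 3 + 8 * A.a₁ t * (A.a₃ t ^ 2 - 1) * c * t) * e1
      + A.a₁ t * (8 * A.a₁ t ^ 2 * A.a₃ t * c * t
        + 16 * (1 + A.a₃ t ^ 2) * A.a₃ t * c ^ 2 * t ^ 2) * e3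
      - c * (2 * A.a₃ t + 2 * t * A.b₃ t) * (8 * A.a₁ t ^ 2 * A.a₃ t * c * t
        + 16 * (1 + A.a₃ t ^ 2) * A.a₃ t * c ^ 2 * t ^ 2) * e2
  · simpa [denom] using hr.a₁_ne le_rfl

/-- Cramer's rule for the linear system `eq1`, `eq3` in b₁, b₃. Its determinant is a₁E, by the
derivative of a₁a₂ = 1 + a₃². -/
theorem CoeffRelations.integrabilityEqs (hr : CoeffRelations A C) {t : ℝ} (ht : 0 ≤ t)
    (hN : NijenhuisEqs A c t) (hD : denom A c t ≠ 0) : IntegrabilityEqs A c t := by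
  obtain ⟨e1, e3⟩ := hN
  have h12 := hr.a₁₂ t ht
  have d12 := hr.dt_a₁₂ ht
  have b12 := hr.b₁₂ t ht
  have n1 := hr.a₁_ne ht
  have n2 := hr.ab₁_ne ht
  simp only [denom] at hD
  simp only [IntegrabilityEqs]
  generalize A.a₁ t = a₁, A.a₂ t = a₂, A.a₃ t = a₃, A.b₁ t = b₁, A.b₂ t = b₂, A.b₃ t = b₃,
    dt A.a₁ t = a₁', dt A.a₂ t = a₂', dt A.a₃ t = a₃' at *
  have eq1 : b₁ * (2 * t * a₁' - a₁) + 4 * t * c * a₃ * b₃ = c * (1 - 3 * a₃ ^ 2) - a₁ * a₁' := by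
    linear_combination e1
  have eq3 : b₁ * (2 * t * a₃') + b₃ * (2 * t * c * a₂ - a₁) = -2 * c * a₂ * a₃ - a₁ * a₃' := by
    linear_combination e3
  -- From a₁²(a₁ + 2t b₁)E = D.
  have hE : a₁ - 2 * t * a₁' - 2 * c * t * a₂ - 4 * c * t ^ 2 * a₂' ≠ 0 := by
    intro h0
    apply hD
    linear_combination a₁ ^ 2 * (a₁ + 2 * t * b₁) * h0
      + 4 * c * t ^ 2 * a₁ * (a₁ + 2 * t * b₁) * d12
      - 2 * t * a₁ * ((2 * t * c * a₂ - a₁) * eq1 - 4 * t * c * a₃ * eq3)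
      - ((2 * t * c * (1 - a₃ ^ 2) - a₁ ^ 2) * (2 * t * c) + 8 * t ^ 2 * c ^ 2 * a₃ ^ 2) * h12
  have h1 : b₁ * (a₁ - 2 * t * a₁' - 2 * c * t * a₂ - 4 * c * t ^ 2 * a₂')
      = 2 * c ^ 2 * t * a₂ ^ 2 + 2 * c * t * a₁ * a₂' + a₁ * a₁' - c + 3 * c * a₃ ^ 2 := by
    refine mul_left_cancel₀ n1 ?_
    linear_combination (-4 * c * t ^ 2 * b₁ - 2 * c * t * a₁) * d12
      + (2 * t * c * a₂ - a₁) * eq1 - 4 * t * c * a₃ * eq3 - 2 * c ^ 2 * t * a₂ * h12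
  have h3 : b₃ * (a₁ - 2 * t * a₁' - 2 * c * t * a₂ - 4 * c * t ^ 2 * a₂')
      = a₁ * a₃' + 2 * c * a₂ * a₃ + 4 * c * t * a₂' * a₃ - 2 * c * t * a₂ * a₃' := by
    refine mul_left_cancel₀ n1 ?_
    linear_combination (-4 * c * t ^ 2 * b₃ - 4 * c * t * a₃) * d12
      + (2 * t * a₁' - a₁) * eq3 - 2 * t * a₃' * eq1 + 2 * c * t * a₃' * h12
  refine ⟨hE, (eq_div_iff hE).2 h1, ?_, (eq_div_iff hE).2 h3⟩
  rw [eq_div_iff hE]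
  refine mul_left_cancel₀ (mul_ne_zero hE n2) ?_
  -- The relation for b₂ from J² = -1, multiplied by E², with the claimed numerators inserted: it
  -- becomes an identity in a₁, a₃, a₁', a₃', c and t.
  have key : (a₁ * (a₁ - 2 * t * a₁' - 2 * c * t * a₂ - 4 * c * t ^ 2 * a₂') + 2 * t *
      (2 * c ^ 2 * t * a₂ ^ 2 + 2 * c * t * a₁ * a₂' + a₁ * a₁' - c + 3 * c * a₃ ^ 2))
        * (2 * t * a₃' ^ 2 - 2 * t * a₁' * a₂' + c * a₂ ^ 2 + 2 * c * t * a₂ * a₂' + a₁ * a₂')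
      = 2 * a₃ * (a₁ * a₃' + 2 * c * a₂ * a₃ + 4 * c * t * a₂' * a₃ - 2 * c * t * a₂ * a₃')
          * (a₁ - 2 * t * a₁' - 2 * c * t * a₂ - 4 * c * t ^ 2 * a₂')
        + 2 * t * (a₁ * a₃' + 2 * c * a₂ * a₃ + 4 * c * t * a₂' * a₃ - 2 * c * t * a₂ * a₃') ^ 2
        - a₂ * (2 * c ^ 2 * t * a₂ ^ 2 + 2 * c * t * a₁ * a₂' + a₁ * a₁' - c + 3 * c * a₃ ^ 2)
          * (a₁ - 2 * t * a₁' - 2 * c * t * a₂ - 4 * c * t ^ 2 * a₂') := by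
    obtain rfl : a₂ = (1 + a₃ ^ 2) / a₁ := by
      rw [eq_div_iff n1]
      linear_combination h12
    obtain rfl : a₂' = (2 * a₃ * a₃' - a₁' * ((1 + a₃ ^ 2) / a₁)) / a₁ := by
      rw [eq_div_iff n1]
      linear_combination d12
    field_simp
    ring
  rw [← h1, ← h3] at key
  linear_combination (a₁ - 2 * t * a₁' - 2 * c * t * a₂ - 4 * c * t ^ 2 * a₂') ^ 2 * b12 - key

theorem CoeffRelations.nijenhuisEqs (hr : CoeffRelations A C) {t : ℝ} (ht : 0 ≤ t)
    (hI : IntegrabilityEqs A c t) : NijenhuisEqs A c t := by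
  have h12 := hr.a₁₂ t ht
  have d12 := hr.dt_a₁₂ ht
  have n1 := hr.a₁_ne ht
  simp only [IntegrabilityEqs] at hI
  obtain ⟨hE, hb1, -, hb3⟩ := hI
  simp only [NijenhuisEqs]
  generalize A.a₁ t = a₁, A.a₂ t = a₂, A.a₃ t = a₃, A.b₁ t = b₁, A.b₂ t = b₂, A.b₃ t = b₃,
    dt A.a₁ t = a₁', dt A.a₂ t = a₂', dt A.a₃ t = a₃' at *
  rw [eq_div_iff hE] at hb1 hb3
  obtain rfl : a₂ = (1 + a₃ ^ 2) / a₁ := by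
    rw [eq_div_iff n1]
    linear_combination h12
  obtain rfl : a₂' = (2 * a₃ * a₃' - a₁' * ((1 + a₃ ^ 2) / a₁)) / a₁ := by
    rw [eq_div_iff n1]
    linear_combination d12
  constructor
  · refine mul_left_cancel₀ hE ?_
    rw [← sub_eq_zero]
    -- The middle term is E times the equation, with Eb₁ and Eb₃ replaced by their numerators.
    trans (2 * t * a₁' - a₁) * (2 * c ^ 2 * t * ((1 + a₃ ^ 2) / a₁) ^ 2 + 2 * c * t * a₁ *
      ((2 * a₃ * a₃' - a₁' * ((1 + a₃ ^ 2) / a₁)) / a₁) + a₁ * a₁' - c + 3 * c * a₃ ^ 2)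
      + 4 * t * c * a₃ * (a₁ * a₃' + 2 * c * ((1 + a₃ ^ 2) / a₁) * a₃ + 4 * c * t *
      ((2 * a₃ * a₃' - a₁' * ((1 + a₃ ^ 2) / a₁)) / a₁) * a₃ - 2 * c * t * ((1 + a₃ ^ 2) / a₁) * a₃')
      - (a₁ - 2 * t * a₁' - 2 * c * t * ((1 + a₃ ^ 2) / a₁) - 4 * c * t ^ 2 *
        ((2 * a₃ * a₃' - a₁' * ((1 + a₃ ^ 2) / a₁)) / a₁)) * (c * (1 - 3 * a₃ ^ 2) - a₁ * a₁')
    · rw [← hb1, ← hb3]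
      ring
    · field_simp
      ring
  · refine mul_left_cancel₀ hE ?_
    rw [← sub_eq_zero]
    trans (2 * t * a₃') * (2 * c ^ 2 * t * ((1 + a₃ ^ 2) / a₁) ^ 2 + 2 * c * t * a₁ *
      ((2 * a₃ * a₃' - a₁' * ((1 + a₃ ^ 2) / a₁)) / a₁) + a₁ * a₁' - c + 3 * c * a₃ ^ 2)
      + (2 * t * c * ((1 + a₃ ^ 2) / a₁) - a₁) * (a₁ * a₃' + 2 * c * ((1 + a₃ ^ 2) / a₁) * a₃
      + 4 * c * t * ((2 * a₃ * a₃' - a₁' * ((1 + a₃ ^ 2) / a₁)) / a₁) * a₃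
      - 2 * c * t * ((1 + a₃ ^ 2) / a₁) * a₃')
      - (a₁ - 2 * t * a₁' - 2 * c * t * ((1 + a₃ ^ 2) / a₁) - 4 * c * t ^ 2 *
        ((2 * a₃ * a₃' - a₁' * ((1 + a₃ ^ 2) / a₁)) / a₁))
        * (-2 * c * ((1 + a₃ ^ 2) / a₁) * a₃ - a₁ * a₃')
    · rw [← hb1, ← hb3]
      ring
    · field_simp
      ring

end Scalar

/-! ### The differential equations for the coefficients of the metric. -/

section Scalar

variable {A : EndoCoeffs} {C : MetricCoeffs} {c t : ℝ}

/-- The equations for the coefficients of `G` equivalent to the vanishing of Tachibana's operator of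
`(G, J)` on horizontal vectors over a space form of curvature `c`; here `e` is the coefficient of
`g(X, Y)` in `G(J X^V, Y^H)`. -/
def TachibanaEqs (A : EndoCoeffs) (C : MetricCoeffs) (e : ℝ → ℝ) (c t : ℝ) : Prop :=
  A.a₁ t * C.d₁ t = c * (A.a₃ t * C.c₃ t + e t) ∧
    (A.a₁ t + 2 * t * A.b₁ t) * dt C.c₁ t
      + 2 * c * ((A.a₃ t + 2 * t * A.b₃ t) * C.c₃ t + e t) = 0

/-- Multiplied by `c`, this is the third coefficient of Tachibana's operator once d₁ = c c₂. It is
stated for free variables so that it serves both the metric and its twin. -/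
theorem dt_c₂_identity {a₁ a₂ a₃ b₁ b₃ a₁' a₂' a₃' c t c₁ c₂ c₃ e₃ c₁' c₂' c₃' e₁' : ℝ}
    (n1 : a₁ ≠ 0) (h12 : a₁ * a₂ = 1 + a₃ ^ 2) (d12 : a₁' * a₂ + a₁ * a₂' = 2 * a₃ * a₃')
    (N1 : (a₁ + 2 * t * b₁) * a₁' - a₁ * b₁ = c * (1 - a₃ ^ 2 - 2 * a₃ * (a₃ + 2 * t * b₃)))
    (N3 : (a₁ + 2 * t * b₁) * a₃' - a₁ * b₃ = -c * a₂ * (2 * a₃ + 2 * t * b₃))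
    (hc2 : a₁ * c₂ = 2 * (a₃ * c₃) - a₂ * c₁)
    (dc2 : a₁' * c₂ + a₁ * c₂' = 2 * (a₃' * c₃ + a₃ * c₃') - (a₂' * c₁ + a₂ * c₁'))
    (de1 : e₁' = a₁' * c₃ + a₁ * c₃' - (a₃' * c₁ + a₃ * c₁'))
    (he3 : e₃ = a₃ * c₃ - a₂ * c₁)
    (M2 : (a₁ + 2 * t * b₁) * c₁' + 2 * c * ((a₃ + 2 * t * b₃) * c₃ + e₃) = 0)
    (M2' : (a₁ + 2 * t * b₁) * e₁' + 2 * c * ((a₃ + 2 * t * b₃) * e₃ - c₃) = 0) :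
    (a₁ + 2 * t * b₁) * c₂' + 2 * b₁ * c₂ - 2 * b₃ * c₃ = 0 := by
  have key : a₁ ^ 2 * ((a₁ + 2 * t * b₁) * c₂' + 2 * b₁ * c₂ - 2 * b₃ * c₃)
      = 2 * a₁ * c₃ * (a₁ * b₃ - c * a₂ * (2 * a₃ + 2 * t * b₃))
        - 2 * a₃ * (2 * c * ((a₃ + 2 * t * b₃) * e₃ - c₃))
        - (2 * a₃ ^ 2 - a₁ * a₂) * (2 * c * ((a₃ + 2 * t * b₃) * c₃ + e₃))
        + (a₂ * c₁ - 2 * a₃ * c₃ - a₁ * c₂)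
          * (a₁ * b₁ + c * (1 - a₃ ^ 2 - 2 * a₃ * (a₃ + 2 * t * b₃)))
        + 2 * a₁ ^ 2 * (b₁ * c₂ - b₃ * c₃) := by
    linear_combination (a₁ + 2 * t * b₁) * (a₁ * dc2 - c₁ * d12 - 2 * a₃ * de1)
      + 2 * a₁ * c₃ * N3 + 2 * a₃ * M2' + (2 * a₃ ^ 2 - a₁ * a₂) * M2
      + (a₂ * c₁ - 2 * a₃ * c₃ - a₁ * c₂) * N1
  refine mul_left_cancel₀ (pow_ne_zero 2 n1) ?_
  rw [key, mul_zero]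
  obtain rfl : a₂ = (1 + a₃ ^ 2) / a₁ := by
    rw [eq_div_iff n1]
    linear_combination h12
  obtain rfl : c₂ = (2 * (a₃ * c₃) - (1 + a₃ ^ 2) / a₁ * c₁) / a₁ := by
    rw [eq_div_iff n1]
    linear_combination hc2
  subst he3
  field_simp
  ring

theorem denom_identity {a₁ a₂ a₃ b₁ a₁' a₂' a₃' c t : ℝ}
    (n1 : a₁ ≠ 0) (h12 : a₁ * a₂ = 1 + a₃ ^ 2) (d12 : a₁' * a₂ + a₁ * a₂' = 2 * a₃ * a₃')
    (hb1 : b₁ * (a₁ - 2 * t * a₁' - 2 * c * t * a₂ - 4 * c * t ^ 2 * a₂')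
      = 2 * c ^ 2 * t * a₂ ^ 2 + 2 * c * t * a₁ * a₂' + a₁ * a₁' - c + 3 * c * a₃ ^ 2) :
    a₁ ^ 2 * (a₁ + 2 * t * b₁) * (a₁ - 2 * t * a₁' - 2 * c * t * a₂ - 4 * c * t ^ 2 * a₂')
      = a₁ ^ 4 + 4 * a₁ ^ 2 * (a₃ ^ 2 - 1) * c * t + 4 * (1 + a₃ ^ 2) ^ 2 * c ^ 2 * t ^ 2 := by
  obtain rfl : a₂ = (1 + a₃ ^ 2) / a₁ := by
    rw [eq_div_iff n1]
    linear_combination h12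
  obtain rfl : a₂' = (2 * a₃ * a₃' - a₁' * ((1 + a₃ ^ 2) / a₁)) / a₁ := by
    rw [eq_div_iff n1]
    linear_combination d12
  have : a₁ ^ 2 * (a₁ + 2 * t * b₁) = a₁ ^ 3 + 2 * t * a₁ ^ 2 * b₁ := by ring
  rw [this, add_mul, mul_assoc (2 * t * a₁ ^ 2), hb1]
  field_simp
  ring

/-- Multiplication by a₁³E clears b₃ and turns the factor of c₁' into a₁D, so the Tachibana equation
and the explicit formula differ by nonzero factors. -/
theorem dt_c₁_identity {a₁ a₂ a₃ b₁ b₃ a₁' a₂' a₃' c t c₁ c₃ e₃ c₁' E D : ℝ}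
    (n1 : a₁ ≠ 0) (nD : D ≠ 0) (h12 : a₁ * a₂ = 1 + a₃ ^ 2)
    (d12 : a₁' * a₂ + a₁ * a₂' = 2 * a₃ * a₃')
    (hE : E = a₁ - 2 * t * a₁' - 2 * c * t * a₂ - 4 * c * t ^ 2 * a₂')
    (hb3 : b₃ * E = a₁ * a₃' + 2 * c * a₂ * a₃ + 4 * c * t * a₂' * a₃ - 2 * c * t * a₂ * a₃')
    (hD : a₁ ^ 2 * (a₁ + 2 * t * b₁) * E = D) (he3 : e₃ = a₃ * c₃ - a₂ * c₁) :
    a₁ ^ 3 * E * ((a₁ + 2 * t * b₁) * c₁' + 2 * c * ((a₃ + 2 * t * b₃) * c₃ + e₃))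
      = a₁ * D * (c₁' - (-2 * c * a₁ ^ 2 *
        ((2 * c₃ * (a₁ * (a₃ + a₃' * t) - 2 * a₁' * a₃ * t) - c₁ * (1 + a₃ ^ 2)) / D)
      - 2 * c * (1 + a₃ ^ 2) *
        ((c * c₁ * t * (2 * a₁ * (1 + a₃ ^ 2 + 4 * a₃ * a₃' * t) - 4 * a₁' * (1 + a₃ ^ 2) * t)
          + 2 * a₁ ^ 2 * t * (a₁' * c₁ - 2 * a₃' * c * c₃ * t)) / (a₁ * D)))) := by
  have e1 : a₁ ^ 3 * E * ((a₁ + 2 * t * b₁) * c₁' + 2 * c * ((a₃ + 2 * t * b₃) * c₃ + e₃))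
      = a₁ * D * c₁' + 2 * c * a₁ ^ 3 * ((a₃ * E + 2 * t * (a₁ * a₃' + 2 * c * a₂ * a₃
        + 4 * c * t * a₂' * a₃ - 2 * c * t * a₂ * a₃')) * c₃ + E * e₃) := by
    linear_combination a₁ * c₁' * hD + 4 * c * a₁ ^ 3 * t * c₃ * hb3
  rw [e1]
  obtain rfl : a₂ = (1 + a₃ ^ 2) / a₁ := by
    rw [eq_div_iff n1]
    linear_combination h12
  obtain rfl : a₂' = (2 * a₃ * a₃' - a₁' * ((1 + a₃ ^ 2) / a₁)) / a₁ := by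
    rw [eq_div_iff n1]
    linear_combination d12
  subst hE he3
  clear hD hb3 e1 h12 d12
  field_simp
  ring

/-- The twin's first coefficient is a₁c₃ - a₃c₁; adding a₃ times the equation for c₁' eliminates c₁'
and leaves c₃'. -/
theorem dt_c₃_identity {a₁ a₂ a₃ b₁ b₃ a₁' a₂' a₃' c t c₁ c₃ e₃ c₁' c₃' e₁' E D : ℝ}
    (n1 : a₁ ≠ 0) (nD : D ≠ 0) (h12 : a₁ * a₂ = 1 + a₃ ^ 2)
    (d12 : a₁' * a₂ + a₁ * a₂' = 2 * a₃ * a₃')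
    (hE : E = a₁ - 2 * t * a₁' - 2 * c * t * a₂ - 4 * c * t ^ 2 * a₂')
    (hb3 : b₃ * E = a₁ * a₃' + 2 * c * a₂ * a₃ + 4 * c * t * a₂' * a₃ - 2 * c * t * a₂ * a₃')
    (hD : a₁ ^ 2 * (a₁ + 2 * t * b₁) * E = D)
    (hD' : D = a₁ ^ 4 + 4 * a₁ ^ 2 * (a₃ ^ 2 - 1) * c * t + 4 * (1 + a₃ ^ 2) ^ 2 * c ^ 2 * t ^ 2)
    (he3 : e₃ = a₃ * c₃ - a₂ * c₁)
    (de1 : e₁' = a₁' * c₃ + a₁ * c₃' - (a₃' * c₁ + a₃ * c₁')) :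
    a₁ ^ 2 * E * ((a₁ + 2 * t * b₁) * e₁' + 2 * c * ((a₃ + 2 * t * b₃) * e₃ - c₃))
        + a₃ * (a₁ ^ 2 * E * ((a₁ + 2 * t * b₁) * c₁' + 2 * c * ((a₃ + 2 * t * b₃) * c₃ + e₃)))
      = a₁ * D * (c₃' - (2 * c * a₁ *
      ((c₃ * (a₁ + a₃ * (4 * t * (a₁' * a₃ - a₁ * a₃') - 3 * a₁ * a₃))
        + 2 * a₃ * c₁ * (1 + a₃ ^ 2 + 2 * a₃ * a₃' * t)) / D)
    + ((a₃' * c₁ - a₁' * c₃) * (a₁ ^ 4 - 4 * (1 + a₃ ^ 2) ^ 2 * c ^ 2 * t ^ 2)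
        - 4 * a₁ * (1 + a₃ ^ 2) * c * (2 * a₁' * a₃ * c₁ + (1 + a₃ ^ 2) * c * c₃) * t)
      / (a₁ * D))) := by
  have e1 : a₁ ^ 2 * E * ((a₁ + 2 * t * b₁) * e₁' + 2 * c * ((a₃ + 2 * t * b₃) * e₃ - c₃))
        + a₃ * (a₁ ^ 2 * E * ((a₁ + 2 * t * b₁) * c₁' + 2 * c * ((a₃ + 2 * t * b₃) * c₃ + e₃)))
      = a₁ * D * c₃' + (a₁ ^ 4 + 4 * a₁ ^ 2 * (a₃ ^ 2 - 1) * c * t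
          + 4 * (1 + a₃ ^ 2) ^ 2 * c ^ 2 * t ^ 2) * (a₁' * c₃ - a₃' * c₁)
        + 2 * c * a₁ ^ 2 * ((a₃ * E + 2 * t * (a₁ * a₃' + 2 * c * a₂ * a₃
        + 4 * c * t * a₂' * a₃ - 2 * c * t * a₂ * a₃')) * (e₃ + a₃ * c₃) - E * c₃
          + a₃ * E * e₃) := by
    rw [← hD', ← hb3, ← hD, de1]
    ring
  rw [e1]
  obtain rfl : a₂ = (1 + a₃ ^ 2) / a₁ := by
    rw [eq_div_iff n1]
    linear_combination h12
  obtain rfl : a₂' = (2 * a₃ * a₃' - a₁' * ((1 + a₃ ^ 2) / a₁)) / a₁ := by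
    rw [eq_div_iff n1]
    linear_combination d12
  subst hE he3
  clear hD hb3 e1 h12 d12 hD' de1
  field_simp
  ring

theorem CoeffRelations.dt_twin_c₁ (hr : CoeffRelations A C) (ht : 0 ≤ t) :
    dt (twinCoeffs A C).c₁ t = dt A.a₁ t * C.c₃ t + A.a₁ t * dt C.c₃ t
      - (dt A.a₃ t * C.c₁ t + A.a₃ t * dt C.c₁ t) := by
  have h := dt_eq (((hasDerivWithinAt_dt A.smooth_a₄ ht).mul (hasDerivWithinAt_dt C.smooth_c₁ ht)).add
    ((hasDerivWithinAt_dt A.smooth_a₁ ht).mul (hasDerivWithinAt_dt C.smooth_c₃ ht))) ht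
  have e : (twinCoeffs A C).c₁ = A.a₄ * C.c₁ + A.a₁ * C.c₃ := rfl
  rw [e, h, hr.dt_a₄ ht, hr.a₄ t ht]
  ring

theorem CoeffRelations.dt_c₂ (hr : CoeffRelations A C) (ht : 0 ≤ t) :
    dt A.a₁ t * C.c₂ t + A.a₁ t * dt C.c₂ t
      = 2 * (dt A.a₃ t * C.c₃ t + A.a₃ t * dt C.c₃ t)
        - (dt A.a₂ t * C.c₁ t + A.a₂ t * dt C.c₁ t) := by
  have h1 := dt_eq ((hasDerivWithinAt_dt A.smooth_a₁ ht).mul (hasDerivWithinAt_dt C.smooth_c₂ ht)) ht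
  have h2 := dt_eq ((((hasDerivWithinAt_dt A.smooth_a₃ ht).mul
    (hasDerivWithinAt_dt C.smooth_c₃ ht)).const_mul 2).sub
    ((hasDerivWithinAt_dt A.smooth_a₂ ht).mul (hasDerivWithinAt_dt C.smooth_c₁ ht))) ht
  rw [← h1, ← h2]
  exact dt_congr hr.c₂ ht

theorem CoeffRelations.twin_c₁ (hr : CoeffRelations A C) (ht : 0 ≤ t) :
    (twinCoeffs A C).c₁ t = A.a₁ t * C.c₃ t - A.a₃ t * C.c₁ t := by
  simp only [twinCoeffs, hr.a₄ t ht]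
  ring

/-- The twin metric is again anti-Hermitian, and its twin is `-G`. -/
theorem CoeffRelations.twin_c₂ (hr : CoeffRelations A C) (ht : 0 ≤ t) :
    A.a₁ t * (twinCoeffs A C).c₂ t = 2 * (A.a₃ t * (twinCoeffs A C).c₃ t)
      - A.a₂ t * (twinCoeffs A C).c₁ t := by
  rw [hr.twin_c₁ ht]
  simp only [twinCoeffs]
  linear_combination A.a₃ t * hr.c₂ t ht

theorem CoeffRelations.twin_twin_c₃ (hr : CoeffRelations A C) (ht : 0 ≤ t) :
    -C.c₃ t = A.a₃ t * (twinCoeffs A C).c₃ t - A.a₂ t * (twinCoeffs A C).c₁ t := by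
  rw [hr.twin_c₁ ht]
  simp only [twinCoeffs]
  linear_combination C.c₃ t * hr.a₁₂ t ht

theorem CoeffRelations.metricEqs_iff (hr : CoeffRelations A C) (ht : 0 ≤ t)
    (hN : NijenhuisEqs A c t) (hD : denom A c t ≠ 0) :
    MetricEqs A C c t ↔ TachibanaEqs A C (twinCoeffs A C).c₃ c t ∧
      TachibanaEqs A (twinCoeffs A C) (fun s => -C.c₃ s) c t := by
  have h12 := hr.a₁₂ t ht
  have d12 := hr.dt_a₁₂ ht
  have hc2 := hr.c₂ t ht
  have n1 := hr.a₁_ne ht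
  have n2 := hr.ab₁_ne ht
  obtain ⟨hE, hb1, -, hb3⟩ := hr.integrabilityEqs ht hN hD
  rw [eq_div_iff hE] at hb1 hb3
  have hDE := denom_identity n1 h12 d12 hb1
  have I1 := dt_c₁_identity (c₁' := dt C.c₁ t) (c₁ := C.c₁ t) (c₃ := C.c₃ t) n1 hD h12 d12 rfl hb3
    hDE rfl
  have I3 := dt_c₃_identity (c₁' := dt C.c₁ t) (c₁ := C.c₁ t) (c₃ := C.c₃ t) n1 hD h12 d12 rfl hb3
    hDE rfl rfl (hr.dt_twin_c₁ ht)
  obtain ⟨N1, N3⟩ := hN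
  have hd₁ : A.a₁ t * C.d₁ t = c * (A.a₃ t * C.c₃ t + (twinCoeffs A C).c₃ t)
      ↔ C.d₁ t = c * C.c₂ t := by
    have : c * (A.a₃ t * C.c₃ t + (twinCoeffs A C).c₃ t) = A.a₁ t * (c * C.c₂ t) := by
      simp only [twinCoeffs]
      linear_combination -c * hc2
    rw [this, mul_right_inj' n1]
  -- Modulo d₁ = c c₂ and `NijenhuisEqs`, the twin's equation is (a₁ + 2t b₁) times the formula for
  -- d₃.
  have hd₃ : C.d₁ t = c * C.c₂ t →
      (A.a₁ t * (twinCoeffs A C).d₁ t = c * (A.a₃ t * (twinCoeffs A C).c₃ t + -C.c₃ t)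
        ↔ C.d₃ t = (dt A.a₃ t * C.c₁ t - dt A.a₁ t * C.c₃ t) / A.a₁ t) := by
    intro h
    rw [← sub_eq_zero, eq_div_iff n1, ← sub_eq_zero (a := C.d₃ t * A.a₁ t)]
    have : A.a₁ t * (twinCoeffs A C).d₁ t - c * (A.a₃ t * (twinCoeffs A C).c₃ t + -C.c₃ t)
        = (A.a₁ t + 2 * t * A.b₁ t)
          * (C.d₃ t * A.a₁ t - (dt A.a₃ t * C.c₁ t - dt A.a₁ t * C.c₃ t)) := by
      simp only [twinCoeffs, hr.a₄ t ht, hr.b₄ t ht, h]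
      linear_combination C.c₁ t * N3 - C.c₃ t * N1
        - c * (A.a₃ t + 2 * t * A.b₃ t) * hc2
    rw [this, mul_eq_zero, or_iff_right n2]
  simp only [TachibanaEqs, MetricEqs]
  constructor
  · rintro ⟨m1, m2, m3, m4⟩
    rw [← sub_eq_zero] at m3 m4
    rw [m3, mul_zero, mul_eq_zero, or_iff_right (mul_ne_zero (pow_ne_zero 3 n1) hE)] at I1
    have I1' : (A.a₁ t + 2 * t * A.b₁ t) * dt C.c₁ t
      + 2 * c * ((A.a₃ t + 2 * t * A.b₃ t) * C.c₃ t + (twinCoeffs A C).c₃ t) = 0 := I1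
    rw [m4, I1, mul_zero, mul_zero, mul_zero, add_zero, mul_eq_zero,
      or_iff_right (mul_ne_zero (pow_ne_zero 2 n1) hE)] at I3
    exact ⟨⟨hd₁.2 m1, I1'⟩, (hd₃ m1).2 m2, I3⟩
  · rintro ⟨⟨k1, k2⟩, k3, k4⟩
    have m1 := hd₁.1 k1
    have k2' : (A.a₁ t + 2 * t * A.b₁ t) * dt C.c₁ t
      + 2 * c * ((A.a₃ t + 2 * t * A.b₃ t) * C.c₃ t
        + (A.a₃ t * C.c₃ t - A.a₂ t * C.c₁ t)) = 0 := k2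
    have k4' : (A.a₁ t + 2 * t * A.b₁ t) * dt (twinCoeffs A C).c₁ t
      + 2 * c * ((A.a₃ t + 2 * t * A.b₃ t) * (A.a₃ t * C.c₃ t - A.a₂ t * C.c₁ t) - C.c₃ t)
        = 0 := k4
    rw [k2', mul_zero, zero_eq_mul, or_iff_right (mul_ne_zero n1 hD)] at I1
    rw [k2', k4', mul_zero, mul_zero, add_zero, zero_eq_mul,
      or_iff_right (mul_ne_zero n1 hD)] at I3
    exact ⟨m1, (hd₃ m1).1 k3, sub_eq_zero.1 I1, sub_eq_zero.1 I3⟩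

/-- The third coefficient of Tachibana's operator vanishes when the other two do. -/
theorem CoeffRelations.dt_d₁ (hr : CoeffRelations A C) (hN : ∀ t, 0 ≤ t → NijenhuisEqs A c t)
    (hT : ∀ t, 0 ≤ t → TachibanaEqs A C (twinCoeffs A C).c₃ c t)
    (hT' : ∀ t, 0 ≤ t → TachibanaEqs A (twinCoeffs A C) (fun s => -C.c₃ s) c t) (ht : 0 ≤ t) :
    (A.a₁ t + 2 * t * A.b₁ t) * dt C.d₁ t + 2 * A.b₁ t * C.d₁ t
        - 2 * c * A.b₃ t * C.c₃ t = 0 ∧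
      (A.a₁ t + 2 * t * A.b₁ t) * dt (twinCoeffs A C).d₁ t + 2 * A.b₁ t * (twinCoeffs A C).d₁ t
        - 2 * c * A.b₃ t * (twinCoeffs A C).c₃ t = 0 := by
  have n1 := hr.a₁_ne ht
  have h12 := hr.a₁₂ t ht
  have d12 := hr.dt_a₁₂ ht
  obtain ⟨N1, N3⟩ := hN t ht
  obtain ⟨-, M2⟩ := hT t ht
  obtain ⟨-, M2'⟩ := hT' t ht
  have e1 : ∀ s, 0 ≤ s → C.d₁ s = c * C.c₂ s := fun s hs => by
    refine mul_left_cancel₀ (hr.a₁_ne hs) ?_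
    have := (hT s hs).1
    simp only [twinCoeffs] at this
    linear_combination this - c * hr.c₂ s hs
  have e2 : ∀ s, 0 ≤ s → (twinCoeffs A C).d₁ s = c * (twinCoeffs A C).c₂ s := fun s hs => by
    refine mul_left_cancel₀ (hr.a₁_ne hs) ?_
    linear_combination (hT' s hs).1 - c * hr.twin_c₂ hs + c * hr.twin_twin_c₃ hs
  have e1' : dt C.d₁ t = c * dt C.c₂ t := by
    rw [dt_congr e1 ht]
    exact dt_eq ((hasDerivWithinAt_dt C.smooth_c₂ ht).const_mul c) ht
  have e2' : dt (twinCoeffs A C).d₁ t = c * dt (twinCoeffs A C).c₂ t := by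
    rw [dt_congr e2 ht]
    exact dt_eq ((hasDerivWithinAt_dt (twinCoeffs A C).smooth_c₂ ht).const_mul c) ht
  have f1 := dt_c₂_identity n1 h12 d12 N1 N3 (hr.c₂ t ht) (hr.dt_c₂ ht) (hr.dt_twin_c₁ ht) rfl
    M2 M2'
  have dc2 : dt A.a₁ t * (twinCoeffs A C).c₂ t + A.a₁ t * dt (twinCoeffs A C).c₂ t
      = 2 * (dt A.a₃ t * (twinCoeffs A C).c₃ t + A.a₃ t * dt (twinCoeffs A C).c₃ t)
        - (dt A.a₂ t * (twinCoeffs A C).c₁ t + A.a₂ t * dt (twinCoeffs A C).c₁ t) := by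
    have h1 := dt_eq ((hasDerivWithinAt_dt A.smooth_a₁ ht).mul
      (hasDerivWithinAt_dt (twinCoeffs A C).smooth_c₂ ht)) ht
    have h2 := dt_eq ((((hasDerivWithinAt_dt A.smooth_a₃ ht).mul
      (hasDerivWithinAt_dt (twinCoeffs A C).smooth_c₃ ht)).const_mul 2).sub
      ((hasDerivWithinAt_dt A.smooth_a₂ ht).mul
        (hasDerivWithinAt_dt (twinCoeffs A C).smooth_c₁ ht))) ht
    rw [← h1, ← h2]
    exact dt_congr (fun s hs => hr.twin_c₂ hs) ht
  have tc1 : ∀ s, 0 ≤ s → -C.c₁ s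
      = A.a₁ s * (twinCoeffs A C).c₃ s - A.a₃ s * (twinCoeffs A C).c₁ s := fun s hs => by
    rw [hr.twin_c₁ hs]
    simp only [twinCoeffs]
    linear_combination C.c₁ s * hr.a₁₂ s hs
  have dc1 : -dt C.c₁ t = dt A.a₁ t * (twinCoeffs A C).c₃ t + A.a₁ t * dt (twinCoeffs A C).c₃ t
      - (dt A.a₃ t * (twinCoeffs A C).c₁ t + A.a₃ t * dt (twinCoeffs A C).c₁ t) := by
    have h1 := dt_eq (hasDerivWithinAt_dt C.smooth_c₁ ht).neg ht
    have h2 := dt_eq (((hasDerivWithinAt_dt A.smooth_a₁ ht).mul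
      (hasDerivWithinAt_dt (twinCoeffs A C).smooth_c₃ ht)).sub
      ((hasDerivWithinAt_dt A.smooth_a₃ ht).mul
        (hasDerivWithinAt_dt (twinCoeffs A C).smooth_c₁ ht))) ht
    rw [← h1, ← h2]
    exact dt_congr tc1 ht
  -- The twin's twin is -G, so the two Tachibana equations exchange roles up to sign.
  have f2 := dt_c₂_identity n1 h12 d12 N1 N3 (hr.twin_c₂ ht) dc2 dc1 (hr.twin_twin_c₃ ht)
    M2' (by linear_combination -M2)
  constructor
  · rw [e1', e1 t ht]
    linear_combination c * f1
  · rw [e2', e2 t ht]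
    linear_combination c * f2

end Scalar

/-! ### Integrability and the anti-Kähler condition in a chart. -/

section

variable {E : Type*} [NormedAddCommGroup E] [NormedSpace ℝ E]
  {γ : E → E →L[ℝ] E →L[ℝ] ℝ} {U : Set E} {p : E × E} {A : EndoCoeffs} {C : MetricCoeffs} {c : ℝ}

/-- Tachibana's operator on horizontal vectors, as a function of the coefficients. -/
noncomputable def tachibanaForm (A : EndoCoeffs) (C : MetricCoeffs) (e c t : ℝ)
    (γ : E →L[ℝ] E →L[ℝ] ℝ) (y X Y Z : E) : ℝ :=
  ((A.a₁ t + 2 * t * A.b₁ t) * dt C.c₁ t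
      + 2 * c * ((A.a₃ t + 2 * t * A.b₃ t) * C.c₃ t + e)) * (γ y X * γ Y Z)
    + (A.a₁ t * C.d₁ t - c * (A.a₃ t * C.c₃ t + e)) * (γ X Y * γ y Z + γ X Z * γ y Y)
    + ((A.a₁ t + 2 * t * A.b₁ t) * dt C.d₁ t + 2 * A.b₁ t * C.d₁ t - 2 * c * A.b₃ t * C.c₃ t)
      * (γ y X * γ y Y * γ y Z)

theorem tachibanaForm_eq_zero {e : ℝ → ℝ} {t : ℝ} (hT : TachibanaEqs A C e c t)
    (hd : (A.a₁ t + 2 * t * A.b₁ t) * dt C.d₁ t + 2 * A.b₁ t * C.d₁ t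
        - 2 * c * A.b₃ t * C.c₃ t = 0) (γ : E →L[ℝ] E →L[ℝ] ℝ) (y X Y Z : E) :
    tachibanaForm A C (e t) c t γ y X Y Z = 0 := by
  rw [tachibanaForm, hd, hT.2, hT.1]
  ring

theorem IsLocalMetric.tachibanaEqs (h : IsLocalMetric γ U) {x : E} (hx : x ∈ U)
    (hE : 1 < Module.finrank ℝ E) {e : ℝ → ℝ} (he : ContinuousOn e (Set.Ici 0))
    (hT : ∀ y X Y Z, tachibanaForm A C (e (energy γ (x, y))) c (energy γ (x, y)) (γ x) y X Y Z = 0)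
    (t : ℝ) (ht : 0 ≤ t) : TachibanaEqs A C e c t := by
  have key : ∀ t, 0 < t → TachibanaEqs A C e c t := by
    intro t ht
    obtain ⟨y, ξ, hen, horth, hy, hξ⟩ := h.exists_orthogonal hx hE ht
    have hyy := (h.pos x hx y hy).ne'
    have hξξ := (h.pos x hx ξ hξ).ne'
    have horth' : γ x ξ y = 0 := by rw [h.symm x hx, horth]
    -- With ξ orthogonal to y, the triple (ξ, ξ, y) isolates the second coefficient and (y, ξ, ξ)
    -- the first.
    have h1 := hT y ξ ξ y
    have h2 := hT y y ξ ξ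
    simp only [hen, tachibanaForm, horth, horth', mul_zero, zero_mul, add_zero, zero_add,
      mul_eq_zero, hyy, hξξ, or_false] at h1 h2
    exact ⟨sub_eq_zero.1 h1, h2⟩
  have k1 := A.smooth_a₁.continuousOn
  have k3 := A.smooth_a₃.continuousOn
  have l1 := A.smooth_b₁.continuousOn
  have l3 := A.smooth_b₃.continuousOn
  have m3 := C.smooth_c₃.continuousOn
  have n1 := C.smooth_d₁.continuousOn
  have m1 := continuousOn_dt C.smooth_c₁
  exact ⟨eq_of_eq_on_pos (by fun_prop) (by fun_prop) (fun t ht => (key t ht).1) t ht,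
    eq_of_eq_on_pos (by fun_prop) (by fun_prop) (fun t ht => (key t ht).2) t ht⟩

variable [FiniteDimensional ℝ E]

theorem IsLocalMetric.tachibana_liftMetric (h : IsLocalMetric γ U) (hp : p.1 ∈ U)
    (hr : CoeffRelations A C) (hc : ConstantCurvatureOn γ U c) (X Y Z : E) :
    tachibana (liftMetric C γ) (liftMetric (twinCoeffs A C) γ) (liftEndo A γ) p
        (frame γ p X 0) (frame γ p Y 0) (frame γ p Z 0)
      = tachibanaForm A C ((twinCoeffs A C).c₃ (energy γ p)) c (energy γ p) (γ p.1) p.2 X Y Z := by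
  have ht := h.energy_nonneg hp
  rw [h.tachibana_horizontal hp A C (hc _ hp) (h.liftMetric_twin hp hr)
    (h.liftMetric_symm hp _) (fun X Y Z => ?_) (e₃ := (twinCoeffs A C).c₃ (energy γ p))
    (f₃ := (twinCoeffs A C).d₃ (energy γ p)) (fun X Z => ?_) rfl rfl rfl rfl rfl, hr.a₄ _ ht,
    hr.b₄ _ ht, tachibanaForm]
  · ring
  · rw [h.fderiv_liftMetric hp]
    simp
  · rw [liftMetric_frame]
    simp

theorem IsLocalMetric.tachibana_twin (h : IsLocalMetric γ U) (hp : p.1 ∈ U)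
    (hsq : ∀ V, liftEndo A γ p (liftEndo A γ p V) = -V)
    (hr : CoeffRelations A C) (hc : ConstantCurvatureOn γ U c) (X Y Z : E) :
    tachibana (liftMetric (twinCoeffs A C) γ) (fun q => -liftMetric C γ q) (liftEndo A γ) p
        (frame γ p X 0) (frame γ p Y 0) (frame γ p Z 0)
      = tachibanaForm A (twinCoeffs A C) (-C.c₃ (energy γ p)) c (energy γ p) (γ p.1) p.2
          X Y Z := by
  have ht := h.energy_nonneg hp
  rw [h.tachibana_horizontal hp A (twinCoeffs A C) (hc _ hp)
    (fun V W => ?_) (fun V W => ?_) (fun X Y Z => ?_) (e₃ := -C.c₃ (energy γ p))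
    (f₃ := -C.d₃ (energy γ p)) (fun X Z => ?_) rfl rfl rfl rfl rfl, hr.a₄ _ ht,
    hr.b₄ _ ht, tachibanaForm]
  · ring
  · rw [h.liftMetric_twin hp hr, hsq, map_neg]
    rfl
  · simp only [_root_.neg_apply, h.liftMetric_symm hp C V W]
  · rw [fderiv_fun_neg]
    simp only [_root_.neg_apply]
    rw [h.fderiv_liftMetric hp]
    simp
    ring
  · rw [_root_.neg_apply, _root_.neg_apply, liftMetric_frame]
    simp
    ring

theorem IsLocalMetric.tensorF_eq_zero_iff (h : IsLocalMetric γ U) (hp : p.1 ∈ U)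
    (hAH : ∀ x ∈ U, ∀ y, AntiHermitianAt A C γ (x, y)) (hr : CoeffRelations A C) :
    (∀ X Y Z, tensorF (liftMetric C γ) (liftEndo A γ) p X Y Z = 0) ↔
      (∀ X Y, nijenhuis (liftEndo A γ) p X Y = 0) ∧
      (∀ X Y Z, tachibana (liftMetric C γ) (liftMetric (twinCoeffs A C) γ) (liftEndo A γ) p
        (frame γ p X 0) (frame γ p Y 0) (frame γ p Z 0) = 0) ∧
      (∀ X Y Z, tachibana (liftMetric (twinCoeffs A C) γ) (fun q => -liftMetric C γ q)
        (liftEndo A γ) p (frame γ p X 0) (frame γ p Y 0) (frame γ p Z 0) = 0) :=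
  (h.antiHermitianNear hp hAH).tensorF_eq_zero_iff
    ((h.eventually_base_mem hp).mono fun _ hq V W => h.liftMetric_twin hq hr V W)
    (h.differentiableAt_liftMetric hp _) (hor := fun X => frame γ p X 0)
    (h.exists_frame_add hp hr)

theorem IsLocalMetric.metricEqs (h : IsLocalMetric γ U) {x : E} (hx : x ∈ U)
    (hE : 1 < Module.finrank ℝ E) (hAH : ∀ x ∈ U, ∀ y, AntiHermitianAt A C γ (x, y))
    (hr : CoeffRelations A C) (hc : ConstantCurvatureOn γ U c)
    (hF : ∀ y X Y Z, tensorF (liftMetric C γ) (liftEndo A γ) (x, y) X Y Z = 0)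
    (t : ℝ) (ht : 0 ≤ t) : MetricEqs A C c t := by
  have hF' := fun y => (h.tensorF_eq_zero_iff (p := (x, y)) hx hAH hr).1 (hF y)
  have hN := h.nijenhuisEqs hx hE hAH hr (fun y => (hF' y).1) hc
  refine (hr.metricEqs_iff ht (hN t ht) (hr.denom_ne hN t ht)).2
    ⟨h.tachibanaEqs hx hE (twinCoeffs A C).smooth_c₃.continuousOn (fun y X Y Z => ?_) t ht,
      h.tachibanaEqs hx hE (e := fun s => -C.c₃ s) C.smooth_c₃.continuousOn.neg (fun y X Y Z => ?_) t ht⟩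
  · rw [← (hF' y).2.1 X Y Z, h.tachibana_liftMetric hx hr hc]
  · rw [← (hF' y).2.2 X Y Z, h.tachibana_twin hx (hAH x hx y).1 hr hc]

theorem IsLocalMetric.tensorF_eq_zero (h : IsLocalMetric γ U) (hp : p.1 ∈ U)
    (hAH : ∀ x ∈ U, ∀ y, AntiHermitianAt A C γ (x, y)) (hr : CoeffRelations A C)
    (hc : ConstantCurvatureOn γ U c) (hN : ∀ t, 0 ≤ t → NijenhuisEqs A c t)
    (hM : ∀ t, 0 ≤ t → MetricEqs A C c t) (X Y Z : E × E) :
    tensorF (liftMetric C γ) (liftEndo A γ) p X Y Z = 0 := by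
  have ht := h.energy_nonneg hp
  have hT := fun t ht => (hr.metricEqs_iff ht (hN t ht) (hr.denom_ne hN t ht)).1 (hM t ht)
  have hd := hr.dt_d₁ hN (fun t ht => (hT t ht).1) (fun t ht => (hT t ht).2) ht
  revert X Y Z
  refine (h.tensorF_eq_zero_iff hp hAH hr).2
    ⟨h.nijenhuis_eq_zero hp hAH hr hc (hN _ ht), fun X Y Z => ?_, fun X Y Z => ?_⟩
  · rw [h.tachibana_liftMetric hp hr hc]
    exact tachibanaForm_eq_zero (hT _ ht).1 hd.1 _ _ _ _ _
  · rw [h.tachibana_twin hp (hAH p.1 hp p.2).1 hr hc]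
    exact tachibanaForm_eq_zero (e := fun s => -C.c₃ s) (hT _ ht).2 hd.2 _ _ _ _ _

end

/-! ### From the manifold to its charts. -/

section

variable {n : ℕ} {M : Type*} [TopologicalSpace M] [ChartedSpace (EuclideanSpace ℝ (Fin n)) M]
  {e : OpenPartialHomeomorph M (EuclideanSpace ℝ (Fin n))}

theorem mfderiv_symm_injective
    (he : e ∈ IsManifold.maximalAtlas 𝓘(ℝ, EuclideanSpace ℝ (Fin n)) ∞ M)
    {x : EuclideanSpace ℝ (Fin n)} (hx : x ∈ e.target) :
    Function.Injective
      (mfderiv 𝓘(ℝ, EuclideanSpace ℝ (Fin n)) 𝓘(ℝ, EuclideanSpace ℝ (Fin n)) e.symm x) := by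
  have h1 : MDifferentiableAt 𝓘(ℝ, EuclideanSpace ℝ (Fin n)) 𝓘(ℝ, EuclideanSpace ℝ (Fin n))
      e.symm x :=
    ((contMDiffOn_symm_of_mem_maximalAtlas he).contMDiffAt
      (e.open_target.mem_nhds hx)).mdifferentiableAt (by simp)
  have h2 : MDifferentiableAt 𝓘(ℝ, EuclideanSpace ℝ (Fin n)) 𝓘(ℝ, EuclideanSpace ℝ (Fin n))
      e (e.symm x) :=
    ((contMDiffOn_of_mem_maximalAtlas he).contMDiffAt
      (e.open_source.mem_nhds (e.map_target hx))).mdifferentiableAt (by simp)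
  have h3 := mfderiv_comp x h2 h1
  have h4 : e ∘ e.symm =ᶠ[nhds x] id :=
    Filter.eventually_of_mem (e.open_target.mem_nhds hx) fun y hy => e.right_inv hy
  rw [h4.mfderiv_eq, mfderiv_id] at h3
  refine Function.LeftInverse.injective (g := mfderiv 𝓘(ℝ, EuclideanSpace ℝ (Fin n))
    𝓘(ℝ, EuclideanSpace ℝ (Fin n)) e (e.symm x)) fun X => ?_
  exact (congrArg (fun L => L X) h3).symm

variable [IsManifold 𝓘(ℝ, EuclideanSpace ℝ (Fin n)) ∞ M]

theorem contMDiffOn_mfderiv_symm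
    (he : e ∈ IsManifold.maximalAtlas 𝓘(ℝ, EuclideanSpace ℝ (Fin n)) ∞ M)
    (X : EuclideanSpace ℝ (Fin n)) :
    ContMDiffOn 𝓘(ℝ, EuclideanSpace ℝ (Fin n)) 𝓘(ℝ, EuclideanSpace ℝ (Fin n)).tangent ∞
      (fun x => (⟨e.symm x, mfderiv 𝓘(ℝ, EuclideanSpace ℝ (Fin n))
        𝓘(ℝ, EuclideanSpace ℝ (Fin n)) e.symm x X⟩ :
          TangentBundle 𝓘(ℝ, EuclideanSpace ℝ (Fin n)) M)) e.target := by
  have h1 := (contMDiffOn_symm_of_mem_maximalAtlas he).contMDiffOn_tangentMapWithin (m := ∞)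
    (by simp) e.open_target.uniqueMDiffOn
  have h2 : ContMDiff 𝓘(ℝ, EuclideanSpace ℝ (Fin n)) 𝓘(ℝ, EuclideanSpace ℝ (Fin n)).tangent ∞
      (fun x => (⟨x, X⟩ : TangentBundle 𝓘(ℝ, EuclideanSpace ℝ (Fin n))
        (EuclideanSpace ℝ (Fin n)))) := by
    intro x
    rw [Bundle.contMDiffAt_totalSpace]
    refine ⟨contMDiffAt_id, ?_⟩
    simpa using contMDiffAt_const
  refine (h1.comp h2.contMDiffOn fun x hx => hx).congr fun x hx => ?_
  simp only [Function.comp, tangentMapWithin]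
  rw [mfderivWithin_of_isOpen e.open_target hx]

variable (g : Bundle.ContMDiffRiemannianMetric 𝓘(ℝ, EuclideanSpace ℝ (Fin n)) ∞
  (EuclideanSpace ℝ (Fin n)) (TangentSpace 𝓘(ℝ, EuclideanSpace ℝ (Fin n)) (M := M)))

/-- Smoothness of `g` concerns a bundle section; pairing it with the smooth coordinate fields of the
chart gives smooth component functions. -/
theorem contMDiffOn_localMetric_apply
    (he : e ∈ IsManifold.maximalAtlas 𝓘(ℝ, EuclideanSpace ℝ (Fin n)) ∞ M)
    (X Y : EuclideanSpace ℝ (Fin n)) :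
    ContMDiffOn 𝓘(ℝ, EuclideanSpace ℝ (Fin n)) 𝓘(ℝ) ∞ (fun x => localMetric g e x X Y)
      e.target := by
  intro x hx
  have h3 : ContMDiffWithinAt 𝓘(ℝ, EuclideanSpace ℝ (Fin n))
      (𝓘(ℝ, EuclideanSpace ℝ (Fin n)).prod 𝓘(ℝ)) ∞
      (fun m ↦ Bundle.TotalSpace.mk' ℝ (E := Bundle.Trivial M ℝ) (e.symm m)
        (g.inner (e.symm m)
          (mfderiv 𝓘(ℝ, EuclideanSpace ℝ (Fin n)) 𝓘(ℝ, EuclideanSpace ℝ (Fin n)) e.symm m X)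
          (mfderiv 𝓘(ℝ, EuclideanSpace ℝ (Fin n)) 𝓘(ℝ, EuclideanSpace ℝ (Fin n)) e.symm m Y)))
      e.target x := by
    apply ContMDiffWithinAt.clm_bundle_apply₂ (F₁ := EuclideanSpace ℝ (Fin n))
      (F₂ := EuclideanSpace ℝ (Fin n))
    · exact ContMDiffAt.comp_contMDiffWithinAt x g.contMDiff.contMDiffAt
        (contMDiffOn_symm_of_mem_maximalAtlas he x hx)
    · exact contMDiffOn_mfderiv_symm he X x hx
    · exact contMDiffOn_mfderiv_symm he Y x hx
  rw [Bundle.contMDiffWithinAt_totalSpace] at h3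
  exact h3.2

theorem localMetric_pos
    (he : e ∈ IsManifold.maximalAtlas 𝓘(ℝ, EuclideanSpace ℝ (Fin n)) ∞ M)
    {x : EuclideanSpace ℝ (Fin n)} (hx : x ∈ e.target) {X : EuclideanSpace ℝ (Fin n)}
    (hX : X ≠ 0) : 0 < localMetric g e x X X := by
  refine g.pos (e.symm x) (mfderiv 𝓘(ℝ, EuclideanSpace ℝ (Fin n))
    𝓘(ℝ, EuclideanSpace ℝ (Fin n)) e.symm x X) fun h0 => hX ?_
  exact mfderiv_symm_injective he hx (h0.trans (map_zero _).symm)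

theorem isLocalMetric_localMetric
    (he : e ∈ IsManifold.maximalAtlas 𝓘(ℝ, EuclideanSpace ℝ (Fin n)) ∞ M) :
    IsLocalMetric (localMetric g e) e.target where
  isOpen := e.open_target
  smooth := contDiffOn_clm_apply.2 fun X => contDiffOn_clm_apply.2 fun Y =>
    contMDiffOn_iff_contDiffOn.1 (contMDiffOn_localMetric_apply g he X Y)
  symm x _ _ _ := g.symm (e.symm x) _ _
  pos _ hx _ hX := localMetric_pos g he hx hX

end

end AntiKaehler

theorem mainTheorem1 {n : ℕ} (hn : 2 ≤ n) {M : Type*} [TopologicalSpace M] [Nonempty M]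
    [ChartedSpace (EuclideanSpace ℝ (Fin n)) M]
    [IsManifold 𝓘(ℝ, EuclideanSpace ℝ (Fin n)) ∞ M]
    (g : Bundle.ContMDiffRiemannianMetric 𝓘(ℝ, EuclideanSpace ℝ (Fin n)) ∞
      (EuclideanSpace ℝ (Fin n)) (TangentSpace 𝓘(ℝ, EuclideanSpace ℝ (Fin n)) (M := M)))
    (A : AntiKaehler.EndoCoeffs) (C : AntiKaehler.MetricCoeffs)
    (hGJ : AntiKaehler.IsAlmostAntiHermitian g A C) :
    -- integrability of `J`
    (AntiKaehler.IsIntegrable g A ↔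
      ∃ c : ℝ, AntiKaehler.HasConstantCurvature g c ∧
        ∀ t : ℝ, 0 ≤ t → AntiKaehler.IntegrabilityEqs A c t) ∧
    -- characterization of the anti-Kähler structures
    (AntiKaehler.IsAntiKaehler g A C ↔
      AntiKaehler.IsIntegrable g A ∧
        ∃ c : ℝ, AntiKaehler.HasConstantCurvature g c ∧
          ∀ t : ℝ, 0 ≤ t → AntiKaehler.MetricEqs A C c t) ∧
    -- the denominators vanish nowhere on `TM`, whatever the sign of the curvature
    (∀ c : ℝ, AntiKaehler.HasConstantCurvature g c → AntiKaehler.IsIntegrable g A →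
      ∀ t : ℝ, 0 ≤ t → A.a₁ t ≠ 0 ∧ AntiKaehler.denom A c t ≠ 0 ∧
        (A.a₁ t ^ 2 - 2 * c * t) ^ 2 ≠
          -4 * A.a₃ t ^ 2 * c * t * (A.a₁ t ^ 2 + 2 * c * t + A.a₃ t ^ 2 * c * t)) := by
  open AntiKaehler in
  have hE : 1 < Module.finrank ℝ (EuclideanSpace ℝ (Fin n)) := by
    rw [finrank_euclideanSpace_fin]
    omega
  have hloc := fun e he => isLocalMetric_localMetric (e := e) g he
  obtain ⟨m⟩ := ‹Nonempty M›
  -- One chart at one point suffices for every condition on the coefficients, since these depend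
  -- only on t.
  have he₀ := IsManifold.chart_mem_maximalAtlas (I := 𝓘(ℝ, EuclideanSpace ℝ (Fin n))) (n := ∞) m
  have hx₀ := mem_chart_target (EuclideanSpace ℝ (Fin n)) m
  have hr : CoeffRelations A C := (hloc _ he₀).coeffRelations hx₀ hE (hGJ _ he₀ _ hx₀)
  have hN : IsIntegrable g A → ∀ c, HasConstantCurvature g c → ∀ t, 0 ≤ t → NijenhuisEqs A c t :=
    fun hI c hc => (hloc _ he₀).nijenhuisEqs hx₀ hE (hGJ _ he₀) hr (hI _ he₀ _ hx₀) (hc _ he₀)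
  have hcurv : IsIntegrable g A → HasConstantCurvature g (forcedCurvature A (1 / 2)) :=
    fun hI e he => (hloc e he).constantCurvatureOn (hGJ e he) hr (hI e he)
  have hint : IsAntiKaehler g A C → IsIntegrable g A := fun hF e he x hx y =>
    (((hloc e he).tensorF_eq_zero_iff (p := (x, y)) hx (hGJ e he) hr).1 (hF e he x hx y)).1
  refine ⟨⟨fun hI => ⟨_, hcurv hI, fun t ht => ?_⟩, ?_⟩, ⟨fun hF => ⟨hint hF, _, hcurv (hint hF), ?_⟩,
    ?_⟩, fun c hc hI t ht => ?_⟩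
  · have h := hN hI _ (hcurv hI)
    exact hr.integrabilityEqs ht (h t ht) (hr.denom_ne h t ht)
  · rintro ⟨c, hc, hI⟩ e he x hx y
    have h := (hloc e he).energy_nonneg (p := (x, y)) hx
    exact (hloc e he).nijenhuis_eq_zero hx (hGJ e he) hr (hc e he) (hr.nijenhuisEqs h (hI _ h))
  · exact (hloc _ he₀).metricEqs hx₀ hE (hGJ _ he₀) hr (hcurv (hint hF) _ he₀) (hF _ he₀ _ hx₀)
  · rintro ⟨hI, c, hc, hM⟩ e he x hx y
    exact (hloc e he).tensorF_eq_zero hx (hGJ e he) hr (hc e he) (hN hI c hc) hM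
  · have hD := hr.denom_ne (hN hI c hc) t ht
    refine ⟨hr.a₁_ne ht, hD, fun h0 => hD ?_⟩
    rw [denom]
    -- D = (a₁² - 2ct)² + 4a₃²ct(a₁² + 2ct + a₃²ct).
    linear_combination h0
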